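/- Let $M$ be a smooth oriented $m$-dimensional manifold without boundary (Hausdorff, second countable), let $T>0$, and let $F:M\times[0,T)\to\mathbb R^n$ be a smooth solution of mean curvature flow, i.e. $F$ is smooth, every $F_t=F(\cdot,t)$ is an immersion, and $\frac{d}{dt}F(x,t)=H(x,t)$, where $H$ is the mean curvature vector of $M_t=F_t(M)$, the trace of its second fundamental form $A$. Assume that the normal bundle of every $M_t$, $t\in[0,T)$, is flat, i.e. its normal connection has zero curvature. Let $\omega$ be a parallel (constant) $m$-form on $\mathbb R^n$ with $|\omega|=1$, where $|\omega|^2=\sum_{i_1<\dots<i_m}\omega(e_{i_1},\dots,e_{i_m})^2$, define $w$ by $F_t^*\omega=w\,d\mu_t$ with $d\mu_t$ the induced volume form, assume $w>0$ on $M\times[0,T)$, and put $v=1/w$. Let $\nabla$, $\Delta$, $\langle\cdot,\cdot\rangle$ denote gradient, Laplace--Beltrami operator and inner product of the induced metric on $M_t$. (i) The function $|A|^2v^2$ is smooth on $M\times[0,T)$ and $$\Big(\frac{d}{dt}-\Delta\Big)\big(|A|^2v^2\big)\le-2v^{-1}\big\langle\nabla v,\nabla(|A|^2v^2)\big\rangle\qquad\text{on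 }M\times[0,T)$$ (at $t=0$ the time derivative is one-sided). (ii) Assume in addition that the flow is proper, i.e. for every $t_1\in[0,T)$ and every compact $K\subset\mathbb R^n$ the set $\{(x,t)\in M\times[0,t_1]:F(x,t)\in K\}$ is compact. (This holds, for instance, if every $M_t$ is an entire graph of a smooth map over a fixed $m$-plane and every $F_t$ is injective.) If $v$ and $|A|^2$ are bounded on each $M_t$, with bounds that may depend on $t$, then for all $t\in[0,T)$ $$\sup_{M_t}|A|^2v^2\le\sup_{M_0}|A|^2v^2<\infty .$$ -/

import Mathlib

open scoped Manifold ContDiff Topology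

noncomputable section

namespace MCF

/-- `ℝ^d` with its Euclidean inner product. -/
abbrev E (d : ℕ) := EuclideanSpace ℝ (Fin d)

/-! ### Geometry of an immersion `φ` written in local coordinates `x^1, …, x^m`

All quantities below are the usual coordinate expressions at a point `p`. -/

section Coordinates

variable {m n : ℕ}

/-- The partial derivative `∂_i f`. -/
def pd {V : Type*} [NormedAddCommGroup V] [NormedSpace ℝ V]
    (i : Fin m) (f : E m → V) (p : E m) : V :=
  fderiv ℝ f p (EuclideanSpace.single i 1)

/-- The induced metric `g_{ij} = ⟨∂_i φ, ∂_j φ⟩`. -/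
def metric (φ : E m → E n) (p : E m) : Matrix (Fin m) (Fin m) ℝ :=
  Matrix.of fun i j => inner ℝ (pd i φ p) (pd j φ p)

/-- The inverse metric `g^{ij}`. -/
def metricInv (φ : E m → E n) (p : E m) : Matrix (Fin m) (Fin m) ℝ :=
  (metric φ p)⁻¹

/-- The Christoffel symbol `Γ^k_{ij}`. -/
def christoffel (φ : E m → E n) (k i j : Fin m) (p : E m) : ℝ :=
  (1 / 2) * ∑ l, metricInv φ p k l *
    (pd i (fun q => metric φ q l j) p + pd j (fun q => metric φ q l i) p
      - pd l (fun q => metric φ q i j) p)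

/-- The second fundamental form `A_{ij} = ∂_i ∂_j φ - Γ^k_{ij} ∂_k φ`, a vector of `ℝ^n`. -/
def coordSFF (φ : E m → E n) (i j : Fin m) (p : E m) : E n :=
  pd i (pd j φ) p - ∑ k, christoffel φ k i j p • pd k φ p

/-- The mean curvature vector `H = g^{ij} A_{ij}`. -/
def coordH (φ : E m → E n) (p : E m) : E n :=
  ∑ i, ∑ j, metricInv φ p i j • coordSFF φ i j p

/-- `|A|² = g^{ik} g^{jl} ⟨A_{ij}, A_{kl}⟩`. -/
def coordNormSqA (φ : E m → E n) (p : E m) : ℝ :=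
  ∑ i, ∑ j, ∑ k, ∑ l, metricInv φ p i k * metricInv φ p j l *
    inner ℝ (coordSFF φ i j p) (coordSFF φ k l p)

/-- Orthogonal projection of `z` to the normal space of `φ` at `p`. -/
def normalProj (φ : E m → E n) (p : E m) (z : E n) : E n :=
  z - ∑ i, ∑ j, (metricInv φ p i j * inner ℝ z (pd j φ p)) • pd i φ p

/-- The normal connection `∇^⊥_i ν = (∂_i ν)^⊥`. -/
def normalDeriv (φ : E m → E n) (i : Fin m) (ν : E m → E n) (p : E m) : E n :=
  normalProj φ p (pd i ν p)

/-- The curvature `∇^⊥_i ∇^⊥_j ν - ∇^⊥_j ∇^⊥_i ν` of the normal connection. -/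
def normalCurvature (φ : E m → E n) (i j : Fin m) (ν : E m → E n) (p : E m) : E n :=
  normalDeriv φ i (normalDeriv φ j ν) p - normalDeriv φ j (normalDeriv φ i ν) p

/-- The Laplace-Beltrami operator `Δ f = g^{ij} (∂_i ∂_j f - Γ^k_{ij} ∂_k f)`. -/
def coordLaplacian (φ : E m → E n) (f : E m → ℝ) (p : E m) : ℝ :=
  ∑ i, ∑ j, metricInv φ p i j *
    (pd i (pd j f) p - ∑ k, christoffel φ k i j p * pd k f p)

/-- `⟨∇ f, ∇ h⟩ = g^{ij} ∂_i f ∂_j h`. -/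
def coordGradInner (φ : E m → E n) (f h : E m → ℝ) (p : E m) : ℝ :=
  ∑ i, ∑ j, metricInv φ p i j * pd i f p * pd j h p

/-- The function `w` with `φ^* Ω = w dμ`, where `dμ = √(det g) dx^1 ∧ … ∧ dx^m`. -/
def coordW (Ω : E n [⋀^Fin m]→ₗ[ℝ] ℝ) (φ : E m → E n) (p : E m) : ℝ :=
  Ω (fun i => pd i φ p) / Real.sqrt (metric φ p).det

/-- The squared norm `∑_{i_1 < … < i_m} Ω(e_{i_1}, …, e_{i_m})²` of a constant `m`-form,
written as `1 / m!` times the sum over all multi-indices. -/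
def formNormSq (Ω : E n [⋀^Fin m]→ₗ[ℝ] ℝ) : ℝ :=
  (∑ I : Fin m → Fin n, Ω (fun j => EuclideanSpace.single (I j) 1) ^ 2) / (m.factorial : ℝ)

end Coordinates

/-! ### Immersed manifolds -/

section Manifold

variable {m n : ℕ} {M : Type*} [TopologicalSpace M] [ChartedSpace (E m) M]

variable (m M) in
/-- The atlas of `M` is oriented: all coordinate changes have positive Jacobian determinant. -/
def OrientedAtlas : Prop :=
  ∀ e ∈ atlas (E m) M, ∀ e' ∈ atlas (E m) M, ∀ p ∈ (e.symm ≫ₕ e').source,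
    0 < (fderiv ℝ (e.symm ≫ₕ e') p).det

variable (m) in
/-- The coordinates of the point `x` in the chart at `x`. -/
def coordPt (x : M) : E m := chartAt (E m) x x

variable (m) in
/-- The map `f`, written in the chart at `x`. -/
def inChart {V : Type*} (x : M) (f : M → V) : E m → V := f ∘ (chartAt (E m) x).symm

/-- The mean curvature vector of the immersion `f` at `x`. -/
def meanCurvature (f : M → E n) (x : M) : E n :=
  coordH (inChart m x f) (coordPt m x)

/-- `|A|²` for the immersion `f` at `x`. -/
def normSqA (f : M → E n) (x : M) : ℝ :=
  coordNormSqA (inChart m x f) (coordPt m x)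

/-- The function `w` with `f^* Ω = w dμ` (for an oriented atlas). -/
def graphW (Ω : E n [⋀^Fin m]→ₗ[ℝ] ℝ) (f : M → E n) (x : M) : ℝ :=
  coordW Ω (inChart m x f) (coordPt m x)

/-- The function `v = 1 / w`. -/
def graphV (Ω : E n [⋀^Fin m]→ₗ[ℝ] ℝ) (f : M → E n) (x : M) : ℝ :=
  1 / graphW Ω f x

/-- The Laplace-Beltrami operator of the metric induced by `f`, applied to `h`, at `x`. -/
def laplacian (f : M → E n) (h : M → ℝ) (x : M) : ℝ :=
  coordLaplacian (inChart m x f) (inChart m x h) (coordPt m x)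

/-- `⟨∇ h₁, ∇ h₂⟩` at `x` in the metric induced by `f`. -/
def gradInner (f : M → E n) (h₁ h₂ : M → ℝ) (x : M) : ℝ :=
  coordGradInner (inChart m x f) (inChart m x h₁) (inChart m x h₂) (coordPt m x)

/-- The normal bundle of `f` is flat: the curvature of the normal connection vanishes on all
local smooth normal fields `ν`. -/
def FlatNormalBundle (f : M → E n) : Prop :=
  ∀ x : M, ∀ ν : E m → E n, ContDiffAt ℝ ∞ ν (coordPt m x) →
    (∀ᶠ q in 𝓝 (coordPt m x), ∀ k, inner ℝ (ν q) (pd k (inChart m x f) q) = 0) →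
    ∀ i j, normalCurvature (inChart m x f) i j ν (coordPt m x) = 0

/-- A smooth solution `F : M × [0, T) → ℝ^n` of mean curvature flow through immersions.
Time derivatives are taken within `[0, T)`, so they are one-sided at `t = 0`. -/
structure IsSolution (T : ℝ) (F : M → ℝ → E n) : Prop where
  smooth : ContMDiffOn ((𝓡 m).prod 𝓘(ℝ, ℝ)) 𝓘(ℝ, E n) ∞
    (fun p : M × ℝ => F p.1 p.2) (Set.univ ×ˢ Set.Ico 0 T)
  immersion : ∀ t ∈ Set.Ico 0 T, ∀ x,
    Function.Injective (mfderiv (𝓡 m) 𝓘(ℝ, E n) (fun y => F y t) x)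
  flow : ∀ t ∈ Set.Ico 0 T, ∀ x,
    HasDerivWithinAt (F x) (meanCurvature (m := m) (fun y => F y t) x) (Set.Ico 0 T) t

/-- Properness of `F` on `M × [0, t₁]` for every `t₁ < T`: preimages of compact sets are
compact. -/
def IsProperFlow (T : ℝ) (F : M → ℝ → E n) : Prop :=
  ∀ t₁ ∈ Set.Ico 0 T, ∀ K : Set (E n), IsCompact K →
    IsCompact {p : M × ℝ | p.2 ∈ Set.Icc 0 t₁ ∧ F p.1 p.2 ∈ K}

/-- The function `|A|² v²` on `M × [0, T)`. -/
def normSqAV (Ω : E n [⋀^Fin m]→ₗ[ℝ] ℝ) (F : M → ℝ → E n) (x : M) (t : ℝ) : ℝ :=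
  normSqA (m := m) (fun y => F y t) x * graphV Ω (fun y => F y t) x ^ 2

end Manifold

end MCF

end

noncomputable section

namespace MCF

open Filter Set
open scoped Manifold ContDiff Topology

/-! ### Partial derivatives and second-order jets -/

section Calculus

variable {m n : ℕ} {V W X : Type*} [NormedAddCommGroup V] [NormedSpace ℝ V]
  [NormedAddCommGroup W] [NormedSpace ℝ W] [NormedAddCommGroup X] [NormedSpace ℝ X]

/-! All quantities are coordinate invariant, so every identity is checked at one point and one time
in coordinates adapted to them. Near a point p of M_t the immersion φ is a graph over its tangent
space at p. With orthonormal coordinates of that space as parameters, ⟨∂_iφ(q), ∂_jφ(p)⟩ = δ_ij for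
all q near p (`GraphAt`). Differentiating in q shows that the second and third derivatives of φ at p
are normal there. Hence at p: g = δ, ∂g = 0, Γ = 0, A_ij = ∂_i∂_jφ, and |∇A|² is the sum of the
squared third derivatives. The coordinate change is independent of time and H is invariant, so the
flow equation survives it (`LocalSolution.exists_graphSolution`).

Flatness enters through the Ricci equation alone: Σ_k ⟨A_ik,ξ⟩⟨A_jk,ζ⟩ is symmetric in i and j
(`RicciFlatAt`). It is used twice. For |A|² it turns Σ⟨A_jk,A_il⟩⟨A_kl,A_ij⟩ into ΣK_ik² with K_ik =
Σ_j⟨A_ij,A_kj⟩; the terms in K then cancel, and Σ⟨A_ij,A_kl⟩² ≤ |A|⁴ gives (d/dt-Δ)|A|² ≤ -2|∇A|² +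
2|A|⁴ (`evolution_normSqA`). For w it kills the terms of Δw in which two slots of ω carry second
derivatives, since a symmetric expression meets an alternating form, and leaves (d/dt-Δ)w = |A|²w
(`evolution_W`). In |A|²/w² the reaction terms cancel, and the gradient terms are absorbed by
|∇|A|²|² ≤ 4|A|²|∇A|² and Young's inequality. This is (i).

For (ii) a maximum need not be attained on a noncompact M, so the argument is localized by η = a -
|F|² - bt. Properness makes {η ≥ 0} compact up to any time t < T, and (d/dt-Δ)η = 2m - b. First, a
lower bound w ≥ w₀ at time 0 persists (`le_graphW_of_proper`): compare η with (a/w₀)w for b = 2m+1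
and let a grow. Next, for b = 2m and 0 < k < w₀², the quotient |A|²η²/(w²-k) is bounded on {η ≥ 0}
(`localized_normSqA_le`). At a maximum at time 0 the initial bound gives O(a²) with the sharp
constant. At a later maximum the shift k leaves a negative term that dominates the gradients of η,
and the bound is only O(a). Dividing by a², letting a → ∞ and then k → 0, gives |A|² ≤ S w², where S
is the initial supremum of |A|²v². -/

lemma pd_congr {f g : E m → V} {p : E m} (i : Fin m) (h : f =ᶠ[𝓝 p] g) :
    pd i f p = pd i g p := by
  simp [pd, h.fderiv_eq]

lemma eventuallyEq_pd {f g : E m → V} {p : E m} (i : Fin m) (h : f =ᶠ[𝓝 p] g) :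
    pd i f =ᶠ[𝓝 p] pd i g := by
  filter_upwards [h.eventuallyEq_nhds] with q hq using pd_congr i hq

lemma contDiffAt_pd {f : E m → V} {p : E m} (i : Fin m) (hf : ContDiffAt ℝ ∞ f p) :
    ContDiffAt ℝ ∞ (pd i f) p :=
  (hf.fderiv_right (m := ∞) (by simp)).clm_apply contDiffAt_const

lemma differentiableAt_of_smooth {F G : Type*} [NormedAddCommGroup F] [NormedSpace ℝ F]
    [NormedAddCommGroup G] [NormedSpace ℝ G] {f : F → G} {p : F}
    (hf : ContDiffAt ℝ ∞ f p) : DifferentiableAt ℝ f p :=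
  hf.differentiableAt (by simp)

lemma eventually_differentiableAt {F G : Type*} [NormedAddCommGroup F] [NormedSpace ℝ F]
    [NormedAddCommGroup G] [NormedSpace ℝ G] {f : F → G} {p : F}
    (hf : ContDiffAt ℝ ∞ f p) : ∀ᶠ q in 𝓝 p, DifferentiableAt ℝ f q := by
  have h1 : ContDiffAt ℝ 1 f p := hf.of_le (by exact_mod_cast le_top)
  filter_upwards [h1.eventually (by simp)] with q hq using hq.differentiableAt (by simp)

lemma pd_comm {f : E m → V} {p : E m} (hf : ContDiffAt ℝ ∞ f p) (i j : Fin m) :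
    pd i (pd j f) p = pd j (pd i f) p := by
  have h := hf.isSymmSndFDerivAt (by
    simpa using (WithTop.coe_le_coe.2 le_top : ((2 : ℕ∞) : WithTop ℕ∞) ≤ ∞))
  have hd : DifferentiableAt ℝ (fderiv ℝ f) p :=
    (hf.fderiv_right (m := ∞) (by simp)).differentiableAt (by simp)
  have key : ∀ k l : Fin m, pd k (pd l f) p =
      fderiv ℝ (fderiv ℝ f) p (EuclideanSpace.single k 1) (EuclideanSpace.single l 1) := by
    intro k l
    unfold pd
    rw [fderiv_clm_apply hd (differentiableAt_const _)]
    simp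
  rw [key, key]
  exact h _ _

lemma pd_const (i : Fin m) (c : V) (p : E m) : pd i (fun _ => c) p = 0 := by
  simp [pd]

lemma pd_add {f g : E m → V} {p : E m} (i : Fin m) (hf : DifferentiableAt ℝ f p)
    (hg : DifferentiableAt ℝ g p) : pd i (fun q => f q + g q) p = pd i f p + pd i g p := by
  simp [pd, fderiv_fun_add hf hg]

lemma pd_sub {f g : E m → V} {p : E m} (i : Fin m) (hf : DifferentiableAt ℝ f p)
    (hg : DifferentiableAt ℝ g p) : pd i (fun q => f q - g q) p = pd i f p - pd i g p := by
  simp [pd, fderiv_fun_sub hf hg]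

lemma pd_sum {ι : Type*} (s : Finset ι) {f : ι → E m → V} {p : E m} (i : Fin m)
    (hf : ∀ k ∈ s, DifferentiableAt ℝ (f k) p) :
    pd i (fun q => ∑ k ∈ s, f k q) p = ∑ k ∈ s, pd i (f k) p := by
  simp [pd, fderiv_fun_sum hf]

lemma pd_bilin (B : V →L[ℝ] W →L[ℝ] X) {f : E m → V} {g : E m → W} {p : E m} (i : Fin m)
    (hf : DifferentiableAt ℝ f p) (hg : DifferentiableAt ℝ g p) :
    pd i (fun q => B (f q) (g q)) p = B (pd i f p) (g p) + B (f p) (pd i g p) := by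
  have := (B.hasFDerivAt_of_bilinear hf.hasFDerivAt hg.hasFDerivAt).fderiv
  simp [pd, this, add_comm]

lemma contDiffAt_bilin (B : V →L[ℝ] W →L[ℝ] X) {f : E m → V} {g : E m → W} {p : E m}
    (hf : ContDiffAt ℝ ∞ f p) (hg : ContDiffAt ℝ ∞ g p) :
    ContDiffAt ℝ ∞ (fun q => B (f q) (g q)) p :=
  ((B.contDiff.contDiffAt).comp p hf).clm_apply hg

lemma pd_smul {f : E m → ℝ} {g : E m → V} {p : E m} (i : Fin m)
    (hf : DifferentiableAt ℝ f p) (hg : DifferentiableAt ℝ g p) :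
    pd i (fun q => f q • g q) p = pd i f p • g p + f p • pd i g p :=
  pd_bilin (ContinuousLinearMap.lsmul ℝ ℝ) i hf hg

lemma pd_inner {f g : E m → E n} {p : E m} (i : Fin m)
    (hf : DifferentiableAt ℝ f p) (hg : DifferentiableAt ℝ g p) :
    pd i (fun q => inner ℝ (f q) (g q)) p = inner ℝ (pd i f p) (g p) + inner ℝ (f p) (pd i g p) :=
  pd_bilin (innerSL ℝ) i hf hg

/-- The differential in terms of partial derivatives. -/
lemma fderiv_eq_sum_pd (f : E m → V) (p : E m) (v : E m) :
    fderiv ℝ f p v = ∑ i, v i • pd i f p := by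
  conv_lhs => rw [← (EuclideanSpace.basisFun (Fin m) ℝ).sum_repr v]
  simp [pd]

/-- `f` is smooth near `p`, with value `f₀`, first derivatives `fr`, `fs` in the directions `r`,
`s` and mixed second derivative `frs` at `p`. -/
structure Jet (r s : Fin m) (f : E m → V) (p : E m) (f₀ fr fs frs : V) : Prop where
  smooth : ContDiffAt ℝ ∞ f p
  val : f p = f₀
  left : pd r f p = fr
  right : pd s f p = fs
  mixed : pd s (pd r f) p = frs

namespace Jet

variable {r s : Fin m} {p : E m}

lemma of_smooth {f : E m → V} (hf : ContDiffAt ℝ ∞ f p) (r s : Fin m) :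
    Jet r s f p (f p) (pd r f p) (pd s f p) (pd s (pd r f) p) :=
  ⟨hf, rfl, rfl, rfl, rfl⟩

lemma congr {f g : E m → V} {f₀ fr fs frs : V} (h : Jet r s f p f₀ fr fs frs)
    (hfg : g =ᶠ[𝓝 p] f) : Jet r s g p f₀ fr fs frs :=
  ⟨h.smooth.congr_of_eventuallyEq hfg, hfg.eq_of_nhds.trans h.val,
    (pd_congr r hfg).trans h.left, (pd_congr s hfg).trans h.right,
    (pd_congr s (eventuallyEq_pd r hfg)).trans h.mixed⟩

lemma const (c : V) : Jet r s (fun _ => c) p c 0 0 0 := by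
  refine ⟨contDiffAt_const, rfl, pd_const _ _ _, pd_const _ _ _, ?_⟩
  have : pd r (fun _ : E m => c) = fun _ => 0 := funext fun q => pd_const r c q
  rw [this, pd_const]

/-- Leibniz rule to second order, from which products, scalar multiples and inner products all
follow. -/
lemma bilin (B : V →L[ℝ] W →L[ℝ] X) {f : E m → V} {g : E m → W} {f₀ fr fs frs : V}
    {g₀ gr gs grs : W} (hf : Jet r s f p f₀ fr fs frs) (hg : Jet r s g p g₀ gr gs grs) :
    Jet r s (fun q => B (f q) (g q)) p (B f₀ g₀) (B fr g₀ + B f₀ gr) (B fs g₀ + B f₀ gs)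
      (B frs g₀ + B fr gs + B fs gr + B f₀ grs) := by
  obtain ⟨hf, rfl, rfl, rfl, rfl⟩ := hf
  obtain ⟨hg, rfl, rfl, rfl, rfl⟩ := hg
  have hfd := differentiableAt_of_smooth hf
  have hgd := differentiableAt_of_smooth hg
  have hfd' := differentiableAt_of_smooth (contDiffAt_pd r hf)
  have hgd' := differentiableAt_of_smooth (contDiffAt_pd r hg)
  refine ⟨contDiffAt_bilin B hf hg, rfl, pd_bilin B r hfd hgd, pd_bilin B s hfd hgd, ?_⟩
  have : pd r (fun q => B (f q) (g q)) =ᶠ[𝓝 p]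
      fun q => B (pd r f q) (g q) + B (f q) (pd r g q) := by
    filter_upwards [eventually_differentiableAt hf, eventually_differentiableAt hg] with q h1 h2
    exact pd_bilin B r h1 h2
  rw [pd_congr s this, pd_add, pd_bilin B s hfd' hgd, pd_bilin B s hfd hgd']
  · abel
  · exact differentiableAt_of_smooth (contDiffAt_bilin B (contDiffAt_pd r hf) hg)
  · exact differentiableAt_of_smooth (contDiffAt_bilin B hf (contDiffAt_pd r hg))

lemma mul {f g : E m → ℝ} {f₀ fr fs frs g₀ gr gs grs : ℝ}
    (hf : Jet r s f p f₀ fr fs frs) (hg : Jet r s g p g₀ gr gs grs) :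
    Jet r s (fun q => f q * g q) p (f₀ * g₀) (fr * g₀ + f₀ * gr) (fs * g₀ + f₀ * gs)
      (frs * g₀ + fr * gs + fs * gr + f₀ * grs) :=
  hf.bilin (ContinuousLinearMap.mul ℝ ℝ) hg

lemma smul {f : E m → ℝ} {g : E m → V} {f₀ fr fs frs : ℝ} {g₀ gr gs grs : V}
    (hf : Jet r s f p f₀ fr fs frs) (hg : Jet r s g p g₀ gr gs grs) :
    Jet r s (fun q => f q • g q) p (f₀ • g₀) (fr • g₀ + f₀ • gr) (fs • g₀ + f₀ • gs)
      (frs • g₀ + fr • gs + fs • gr + f₀ • grs) :=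
  hf.bilin (ContinuousLinearMap.lsmul ℝ ℝ) hg

lemma inner {f g : E m → E n} {f₀ fr fs frs g₀ gr gs grs : E n}
    (hf : Jet r s f p f₀ fr fs frs) (hg : Jet r s g p g₀ gr gs grs) :
    Jet r s (fun q => inner ℝ (f q) (g q)) p (inner ℝ f₀ g₀) (inner ℝ fr g₀ + inner ℝ f₀ gr)
      (inner ℝ fs g₀ + inner ℝ f₀ gs)
      (inner ℝ frs g₀ + inner ℝ fr gs + inner ℝ fs gr + inner ℝ f₀ grs) :=
  hf.bilin (innerSL ℝ) hg

lemma add {f g : E m → V} {f₀ fr fs frs g₀ gr gs grs : V}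
    (hf : Jet r s f p f₀ fr fs frs) (hg : Jet r s g p g₀ gr gs grs) :
    Jet r s (fun q => f q + g q) p (f₀ + g₀) (fr + gr) (fs + gs) (frs + grs) := by
  obtain ⟨hf, rfl, rfl, rfl, rfl⟩ := hf
  obtain ⟨hg, rfl, rfl, rfl, rfl⟩ := hg
  have hfd := differentiableAt_of_smooth hf
  have hgd := differentiableAt_of_smooth hg
  refine ⟨hf.add hg, rfl, pd_add r hfd hgd, pd_add s hfd hgd, ?_⟩
  have : pd r (fun q => f q + g q) =ᶠ[𝓝 p] fun q => pd r f q + pd r g q := by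
    filter_upwards [eventually_differentiableAt hf, eventually_differentiableAt hg] with q h1 h2
    exact pd_add r h1 h2
  rw [pd_congr s this, pd_add s (differentiableAt_of_smooth (contDiffAt_pd r hf))
    (differentiableAt_of_smooth (contDiffAt_pd r hg))]

lemma sub {f g : E m → V} {f₀ fr fs frs g₀ gr gs grs : V}
    (hf : Jet r s f p f₀ fr fs frs) (hg : Jet r s g p g₀ gr gs grs) :
    Jet r s (fun q => f q - g q) p (f₀ - g₀) (fr - gr) (fs - gs) (frs - grs) := by
  have h := hf.add ((Jet.const (-1 : ℝ)).smul hg)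
  simpa [sub_eq_add_neg] using h

lemma sum {ι : Type*} (t : Finset ι) {f : ι → E m → V} {f₀ fr fs frs : ι → V}
    (hf : ∀ k ∈ t, Jet r s (f k) p (f₀ k) (fr k) (fs k) (frs k)) :
    Jet r s (fun q => ∑ k ∈ t, f k q) p (∑ k ∈ t, f₀ k) (∑ k ∈ t, fr k) (∑ k ∈ t, fs k)
      (∑ k ∈ t, frs k) := by
  classical
  induction t using Finset.induction_on with
  | empty => simpa using Jet.const (0 : V)
  | insert a t ha ih =>
    simp only [Finset.sum_insert ha]
    exact (hf a (by simp)).add (ih fun k hk => hf k (by simp [hk]))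

end Jet

/-- Derivative of a multilinear expression. -/
lemma pd_multilinear {ι : Type*} [Fintype ι] [DecidableEq ι]
    (A : ContinuousMultilinearMap ℝ (fun _ : ι => V) W) {a : ι → E m → V} {p : E m} (r : Fin m)
    (ha : ∀ i, DifferentiableAt ℝ (a i) p) :
    pd r (fun q => A fun i => a i q) p =
      ∑ i, A (Function.update (fun j => a j p) i (pd r (a i) p)) := by
  have := (HasFDerivAt.multilinear_comp A (fun i => (ha i).hasFDerivAt)).fderiv
  simp [pd, this, ContinuousMultilinearMap.toContinuousLinearMap]

lemma contDiffAt_multilinear {ι : Type*} [Fintype ι]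
    (A : ContinuousMultilinearMap ℝ (fun _ : ι => V) W) {a : ι → E m → V} {p : E m}
    (ha : ∀ i, ContDiffAt ℝ ∞ (a i) p) : ContDiffAt ℝ ∞ (fun q => A fun i => a i q) p :=
  A.contDiff.contDiffAt.comp p (contDiffAt_pi.2 ha)

/-- Leibniz rule: in the mixed derivative either both derivatives hit slot i, or they hit distinct
slots i and j, whence the sum over `univ.erase i`. -/
lemma Jet.multilinear {ι : Type*} [Fintype ι] [DecidableEq ι]
    (A : ContinuousMultilinearMap ℝ (fun _ : ι => V) W) {a : ι → E m → V} {p : E m} {r s : Fin m}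
    {a₀ ar as ars : ι → V} (ha : ∀ i, Jet r s (a i) p (a₀ i) (ar i) (as i) (ars i)) :
    Jet r s (fun q => A fun i => a i q) p (A a₀) (∑ i, A (Function.update a₀ i (ar i)))
      (∑ i, A (Function.update a₀ i (as i)))
      (∑ i, (A (Function.update a₀ i (ars i)) + ∑ j ∈ Finset.univ.erase i,
        A (Function.update (Function.update a₀ i (ar i)) j (as j)))) := by
  have hs : ∀ i, ContDiffAt ℝ ∞ (a i) p := fun i => (ha i).smooth
  have hd : ∀ i, DifferentiableAt ℝ (a i) p := fun i => differentiableAt_of_smooth (hs i)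
  obtain rfl : a₀ = fun i => a i p := funext fun i => (ha i).val.symm
  obtain rfl : ar = fun i => pd r (a i) p := funext fun i => (ha i).left.symm
  obtain rfl : as = fun i => pd s (a i) p := funext fun i => (ha i).right.symm
  obtain rfl : ars = fun i => pd s (pd r (a i)) p := funext fun i => (ha i).mixed.symm
  refine ⟨contDiffAt_multilinear A hs, rfl, pd_multilinear A r hd, pd_multilinear A s hd, ?_⟩
  -- With slot i replaced by its derivative, each summand of the first derivative is again A applied
  -- to a family, so the first-order rule applies a second time.
  set b : ι → ι → E m → V := fun i => Function.update a i (pd r (a i)) with hb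
  have hbv : ∀ i q, (fun j => b i j q) =
      Function.update (fun j => a j q) i (pd r (a i) q) := by
    intro i q; ext j
    by_cases h : j = i
    · subst h; simp [hb]
    · simp [hb, h]
  have hbs : ∀ i j, ContDiffAt ℝ ∞ (b i j) p := by
    intro i j
    by_cases h : j = i
    · subst h; simpa [hb] using contDiffAt_pd r (hs j)
    · simpa [hb, h] using hs j
  have : pd r (fun q => A fun i => a i q) =ᶠ[𝓝 p] fun q => ∑ i, A (fun j => b i j q) := by
    have : ∀ᶠ q in 𝓝 p, ∀ i, DifferentiableAt ℝ (a i) q :=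
      eventually_all.2 fun i => eventually_differentiableAt (hs i)
    filter_upwards [this] with q hq
    rw [pd_multilinear A r hq]
    simp only [hbv]
  rw [pd_congr s this, pd_sum _ _ fun i _ =>
    differentiableAt_of_smooth (contDiffAt_multilinear A (hbs i))]
  refine Finset.sum_congr rfl fun i _ => ?_
  rw [pd_multilinear A s fun j => differentiableAt_of_smooth (hbs i j),
    ← Finset.add_sum_erase _ _ (Finset.mem_univ i)]
  congr 1
  · rw [hbv]; simp [hb]
  · refine Finset.sum_congr rfl fun j hj => ?_
    rw [hbv]; simp [hb, Finset.ne_of_mem_erase hj]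

/-- Smoothness of the entries of an inverse matrix. -/
lemma contDiffWithinAt_matrix_det {ι : Type*} [Fintype ι] [DecidableEq ι]
    {G : X → Matrix ι ι ℝ} {S : Set X} {x : X}
    (hG : ∀ i j, ContDiffWithinAt ℝ ∞ (fun y => G y i j) S x) :
    ContDiffWithinAt ℝ ∞ (fun y => (G y).det) S x := by
  simp only [Matrix.det_apply']
  exact ContDiffWithinAt.sum fun σ _ => contDiffWithinAt_const.mul
    (contDiffWithinAt_prod fun i _ => hG _ _)

lemma contDiffWithinAt_matrix_inv {ι : Type*} [Fintype ι] [DecidableEq ι]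
    {G : X → Matrix ι ι ℝ} {S : Set X} {x : X}
    (hG : ∀ i j, ContDiffWithinAt ℝ ∞ (fun y => G y i j) S x) (hx : (G x).det ≠ 0) (i j : ι) :
    ContDiffWithinAt ℝ ∞ (fun y => (G y)⁻¹ i j) S x := by
  have hdet := contDiffWithinAt_matrix_det hG
  have hadj : ContDiffWithinAt ℝ ∞ (fun y => (G y).adjugate i j) S x := by
    simp only [Matrix.adjugate_apply]
    refine contDiffWithinAt_matrix_det fun k l => ?_
    by_cases h : k = j
    · subst h; simpa using contDiffWithinAt_const
    · simpa [Matrix.updateRow_ne h] using hG k l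
  simp only [Matrix.inv_def, Ring.inverse_eq_inv', Matrix.smul_apply, smul_eq_mul]
  exact (hdet.inv hx).mul hadj

end Calculus

/-! ### Metric, Christoffel symbols and second fundamental form of an immersion -/

section Immersion

variable {m n : ℕ} {V : Type*} [NormedAddCommGroup V] [NormedSpace ℝ V]
variable {φ : E m → E n} {p : E m}

lemma metric_det_pos (h : Function.Injective (fderiv ℝ φ p)) : 0 < (metric φ p).det := by
  have hli : LinearIndependent ℝ (fun i => pd i φ p) := by
    have := (EuclideanSpace.basisFun (Fin m) ℝ).toBasis.linearIndependent.map'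
      (fderiv ℝ φ p : E m →ₗ[ℝ] E n) (LinearMap.ker_eq_bot.2 h)
    have h2 : (⇑(fderiv ℝ φ p : E m →ₗ[ℝ] E n) ∘
        (EuclideanSpace.basisFun (Fin m) ℝ).toBasis) = fun i => pd i φ p := by
      ext i
      simp [pd]
    rwa [h2] at this
  exact (Matrix.posDef_gram_of_linearIndependent hli).det_pos

lemma metric_symm (φ : E m → E n) (p : E m) (i j : Fin m) : metric φ p i j = metric φ p j i := by
  simp [metric, real_inner_comm]

lemma metricInv_symm (φ : E m → E n) (p : E m) (i j : Fin m) :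
    metricInv φ p i j = metricInv φ p j i := by
  have h : (metric φ p).transpose = metric φ p := by ext i j; exact metric_symm φ p j i
  have : (metricInv φ p).transpose = metricInv φ p := by
    rw [metricInv, Matrix.transpose_nonsing_inv, h]
  exact congrFun (congrFun this j) i

lemma sum_metricInv_mul_metric (h : (metric φ p).det ≠ 0) (i j : Fin m) :
    ∑ k, metricInv φ p i k * metric φ p k j = if i = j then 1 else 0 := by
  have := Matrix.nonsing_inv_mul (metric φ p) (isUnit_iff_ne_zero.2 h)
  rw [← Matrix.mul_apply, metricInv, this, Matrix.one_apply]

lemma contDiffAt_metric (hφ : ContDiffAt ℝ ∞ φ p) (i j : Fin m) :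
    ContDiffAt ℝ ∞ (fun q => metric φ q i j) p := by
  simpa [metric] using (contDiffAt_pd i hφ).inner ℝ (contDiffAt_pd j hφ)

lemma contDiffAt_metric_det (hφ : ContDiffAt ℝ ∞ φ p) :
    ContDiffAt ℝ ∞ (fun q => (metric φ q).det) p :=
  contDiffWithinAt_matrix_det (S := univ) fun i j => contDiffAt_metric hφ i j

lemma contDiffAt_metricInv (hφ : ContDiffAt ℝ ∞ φ p) (h : (metric φ p).det ≠ 0) (i j : Fin m) :
    ContDiffAt ℝ ∞ (fun q => metricInv φ q i j) p :=
  contDiffWithinAt_matrix_inv (S := univ) (fun i j => contDiffAt_metric hφ i j) h i j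

lemma eventually_metric_det_ne_zero (hφ : ContDiffAt ℝ ∞ φ p) (h : (metric φ p).det ≠ 0) :
    ∀ᶠ q in 𝓝 p, (metric φ q).det ≠ 0 :=
  (contDiffAt_metric_det hφ).continuousAt.eventually_ne h

lemma pd_metric (hφ : ContDiffAt ℝ ∞ φ p) (k i j : Fin m) :
    pd k (fun q => metric φ q i j) p =
      inner ℝ (pd k (pd i φ) p) (pd j φ p) + inner ℝ (pd i φ p) (pd k (pd j φ) p) := by
  simp only [metric, Matrix.of_apply]
  exact pd_inner k (differentiableAt_of_smooth (contDiffAt_pd i hφ))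
    (differentiableAt_of_smooth (contDiffAt_pd j hφ))

/-- Expanding ∂g by the product rule, symmetry of second derivatives cancels all but ⟨∂_i∂_jφ,
∂_lφ⟩. So Γ^k_ij ∂_kφ is the tangential part of ∂_i∂_jφ, and A_ij the normal part. -/
lemma christoffel_eq (hφ : ContDiffAt ℝ ∞ φ p) (k i j : Fin m) :
    christoffel φ k i j p =
      ∑ l, metricInv φ p k l * inner ℝ (pd i (pd j φ) p) (pd l φ p) := by
  rw [christoffel, Finset.mul_sum]
  refine Finset.sum_congr rfl fun l _ => ?_
  rw [pd_metric hφ, pd_metric hφ, pd_metric hφ, pd_comm hφ l i, pd_comm hφ l j, pd_comm hφ j i,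
    real_inner_comm (pd l φ p) (pd i (pd j φ) p),
    real_inner_comm (pd i φ p) (pd j (pd l φ) p)]
  ring

/-- The Hessian of `f` with respect to the metric induced by `φ`. -/
def covHess (φ : E m → E n) (f : E m → V) (i j : Fin m) (p : E m) : V :=
  pd i (pd j f) p - ∑ k, christoffel φ k i j p • pd k f p

lemma coordSFF_eq_covHess (φ : E m → E n) (i j : Fin m) (p : E m) :
    coordSFF φ i j p = covHess φ φ i j p := rfl

lemma coordLaplacian_eq_covHess (φ : E m → E n) (f : E m → ℝ) (p : E m) :
    coordLaplacian φ f p = ∑ i, ∑ j, metricInv φ p i j • covHess φ f i j p := rfl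

lemma inner_coordSFF_pd (hφ : ContDiffAt ℝ ∞ φ p) (h : (metric φ p).det ≠ 0) (i j l : Fin m) :
    inner ℝ (coordSFF φ i j p) (pd l φ p) = 0 := by
  simp only [coordSFF, inner_sub_left, sum_inner, real_inner_smul_left, christoffel_eq hφ]
  have : ∀ k, (inner ℝ (pd k φ p) (pd l φ p) : ℝ) = metric φ p l k := fun k => by
    rw [metric_symm]; rfl
  simp only [this, Finset.sum_mul]
  rw [Finset.sum_comm]
  have h2 : ∀ k, ∑ y, metricInv φ p y k * inner ℝ (pd i (pd j φ) p) (pd k φ p) * metric φ p l y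
      = (if k = l then 1 else 0) * inner ℝ (pd i (pd j φ) p) (pd k φ p) := by
    intro k
    rw [← sum_metricInv_mul_metric h, Finset.sum_mul]
    refine Finset.sum_congr rfl fun y _ => ?_
    rw [metricInv_symm φ p y k, metric_symm φ p l y]; ring
  simp [h2]

lemma normalProj_pd (h : (metric φ p).det ≠ 0) (l : Fin m) : normalProj φ p (pd l φ p) = 0 := by
  have : ∀ i, ∑ j, (metricInv φ p i j * inner ℝ (pd l φ p) (pd j φ p)) =
      if i = l then 1 else 0 := by
    intro i
    rw [← sum_metricInv_mul_metric h]
    refine Finset.sum_congr rfl fun j _ => ?_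
    rw [metric_symm φ p j l]; rfl
  simp only [normalProj, ← Finset.sum_smul, this]
  simp

/-- `normalProj` as a linear map. -/
def normalProjL (φ : E m → E n) (p : E m) : E n →ₗ[ℝ] E n :=
  LinearMap.id - ∑ i, ∑ j, metricInv φ p i j •
    (innerₗ (E n) (pd j φ p)).smulRight (pd i φ p)

lemma normalProj_eq (φ : E m → E n) (p : E m) (z : E n) :
    normalProj φ p z = normalProjL φ p z := by
  simp [normalProj, normalProjL, LinearMap.sum_apply, smul_smul, real_inner_comm]

lemma normalProj_of_normal {z : E n} (hz : ∀ l, inner ℝ z (pd l φ p) = 0) :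
    normalProj φ p z = z := by
  simp [normalProj, hz]

lemma normalProj_pd_pd (hφ : ContDiffAt ℝ ∞ φ p) (h : (metric φ p).det ≠ 0) (i j : Fin m) :
    normalProj φ p (pd i (pd j φ) p) = coordSFF φ i j p := by
  rw [← normalProj_of_normal (inner_coordSFF_pd hφ h i j), coordSFF, normalProj_eq,
    normalProj_eq, map_sub, map_sum]
  simp [← normalProj_eq, normalProj_pd h]

end Immersion

/-! ### Invariance under orientation preserving changes of coordinates -/

section Reparametrization

lemma inner_sum_smul_sum_smul {ι F : Type*} [Fintype ι] [NormedAddCommGroup F]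
    [InnerProductSpace ℝ F] (α β : ι → ℝ) (C D : ι → F) :
    (inner ℝ (∑ a, α a • C a) (∑ c, β c • D c) : ℝ) =
      ∑ a, ∑ c, (α a * β c) • (inner ℝ (C a) (D c) : ℝ) := by
  simp only [sum_inner, inner_sum, real_inner_smul_left, real_inner_smul_right, smul_eq_mul]
  rw [Finset.sum_comm]
  exact Finset.sum_congr rfl fun a _ => Finset.sum_congr rfl fun b _ => by ring

lemma sum_swap_pairs {ι V : Type*} [Fintype ι] [AddCommMonoid V] (f : ι → ι → ι → ι → V) :
    ∑ i, ∑ j, ∑ a, ∑ b, f i j a b = ∑ a, ∑ b, ∑ i, ∑ j, f i j a b := by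
  have h1 : ∀ i, ∑ j, ∑ a, ∑ b, f i j a b = ∑ a, ∑ b, ∑ j, f i j a b := fun i => by
    rw [Finset.sum_comm]
    exact Finset.sum_congr rfl fun a _ => Finset.sum_comm
  simp only [h1]
  rw [Finset.sum_comm]
  exact Finset.sum_congr rfl fun a _ => Finset.sum_comm

variable {m n : ℕ} {V : Type*} [NormedAddCommGroup V] [NormedSpace ℝ V]

lemma pd_comp {τ : E m → E m} {f : E m → V} {p : E m} (hτ : DifferentiableAt ℝ τ p)
    (hf : DifferentiableAt ℝ f (τ p)) (i : Fin m) :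
    pd i (fun q => f (τ q)) p = ∑ a, (pd i τ p) a • pd a f (τ p) := by
  have : pd i (fun q => f (τ q)) p = fderiv ℝ f (τ p) (pd i τ p) := by
    have := fderiv_comp p hf hτ
    simp only [Function.comp_def] at this
    simp [pd, this]
  rw [this, fderiv_eq_sum_pd]

lemma contDiffAt_coord {τ : E m → E m} {p : E m} (hτ : ContDiffAt ℝ ∞ τ p) (a : Fin m) :
    ContDiffAt ℝ ∞ (fun q => τ q a) p :=
  (EuclideanSpace.proj (𝕜 := ℝ) a).contDiff.contDiffAt.comp p hτ

lemma pd_coord {τ : E m → E m} {p : E m} (hτ : DifferentiableAt ℝ τ p) (i a : Fin m) :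
    pd i (fun q => τ q a) p = pd i τ p a := by
  have h := ((EuclideanSpace.proj (𝕜 := ℝ) a : E m →L[ℝ] ℝ).hasFDerivAt.comp p
    hτ.hasFDerivAt).fderiv
  have h' : fderiv ℝ (fun q => τ q a) p = (EuclideanSpace.proj (𝕜 := ℝ) a : E m →L[ℝ] ℝ).comp
    (fderiv ℝ τ p) := h
  simp [pd, h']

lemma pd_pd_comp {τ : E m → E m} {f : E m → V} {p : E m} (hτ : ContDiffAt ℝ ∞ τ p)
    (hf : ContDiffAt ℝ ∞ f (τ p)) (i j : Fin m) :
    pd i (pd j (fun q => f (τ q))) p =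
      ∑ a, ∑ b, (pd i τ p a * pd j τ p b) • pd a (pd b f) (τ p) +
        ∑ b, (pd i (pd j τ) p) b • pd b f (τ p) := by
  have hev : pd j (fun q => f (τ q)) =ᶠ[𝓝 p] fun q => ∑ b, (pd j τ q) b • pd b f (τ q) := by
    filter_upwards [eventually_differentiableAt hτ,
      hτ.continuousAt.eventually (eventually_differentiableAt hf)] with q h1 h2
    exact pd_comp h1 h2 j
  have h1 : ∀ b, ContDiffAt ℝ ∞ (fun q => pd j τ q b) p :=
    fun b => contDiffAt_coord (contDiffAt_pd j hτ) b
  have h2 : ∀ b, ContDiffAt ℝ ∞ (fun q => pd b f (τ q)) p :=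
    fun b => (contDiffAt_pd b hf).comp p hτ
  rw [pd_congr i hev, pd_sum (f := fun b q => (pd j τ q) b • pd b f (τ q)) _ _ fun b _ =>
    differentiableAt_of_smooth ((h1 b).smul (h2 b))]
  have : ∀ b, pd i (fun q => (pd j τ q) b • pd b f (τ q)) p =
      ∑ a, (pd i τ p a * pd j τ p b) • pd a (pd b f) (τ p) +
        (pd i (pd j τ) p) b • pd b f (τ p) := by
    intro b
    rw [pd_smul i (differentiableAt_of_smooth (h1 b)) (differentiableAt_of_smooth (h2 b)),
      pd_comp (differentiableAt_of_smooth hτ) (differentiableAt_of_smooth (contDiffAt_pd b hf)),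
      pd_coord (differentiableAt_of_smooth (contDiffAt_pd j hτ)), Finset.smul_sum, add_comm]
    congr 1
    refine Finset.sum_congr rfl fun a _ => ?_
    rw [smul_smul, mul_comm]
  simp only [this, Finset.sum_add_distrib]
  congr 1
  exact Finset.sum_comm

/-- Two nested double contractions: in this form the contraction lemmas, for coordinate changes, for
jets and for time derivatives, apply to one pair of indices at a time. -/
lemma coordNormSqA_eq_sum_smul (ψ : E m → E n) (x : E m) : coordNormSqA ψ x =
    ∑ j, ∑ l, metricInv ψ x j l • ∑ i, ∑ k, metricInv ψ x i k •
      (inner ℝ (coordSFF ψ i j x) (coordSFF ψ k l x) : ℝ) := by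
  have h : coordNormSqA ψ x = ∑ i, ∑ k, ∑ j, ∑ l, metricInv ψ x i k * metricInv ψ x j l *
      inner ℝ (coordSFF ψ i j x) (coordSFF ψ k l x) :=
    Finset.sum_congr rfl fun i _ => Finset.sum_comm
  rw [h, sum_swap_pairs]
  simp only [smul_eq_mul, Finset.mul_sum]
  refine Finset.sum_congr rfl fun i _ => Finset.sum_congr rfl fun k _ =>
    Finset.sum_congr rfl fun j _ => Finset.sum_congr rfl fun l _ => ?_
  ring

/-- Near `p`, the map `φ'` is the immersion `φ` composed with the orientation preserving
change of coordinates `τ`. -/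
structure Reparam (τ : E m → E m) (p : E m) (φ φ' : E m → E n) : Prop where
  smooth : ContDiffAt ℝ ∞ τ p
  det_pos : 0 < (fderiv ℝ τ p).det
  smooth_map : ContDiffAt ℝ ∞ φ (τ p)
  immersion : (metric φ (τ p)).det ≠ 0
  eq : φ' =ᶠ[𝓝 p] fun q => φ (τ q)

/-- The Jacobian matrix of `τ`. -/
def jac (τ : E m → E m) (p : E m) : Matrix (Fin m) (Fin m) ℝ := Matrix.of fun a i => pd i τ p a

lemma det_jac (τ : E m → E m) (p : E m) : (jac τ p).det = (fderiv ℝ τ p).det := by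
  rw [ContinuousLinearMap.det,
    ← LinearMap.det_toMatrix (EuclideanSpace.basisFun (Fin m) ℝ).toBasis]
  rfl

namespace Reparam

variable {τ : E m → E m} {p : E m} {φ φ' : E m → E n}

lemma smooth' (h : Reparam τ p φ φ') : ContDiffAt ℝ ∞ φ' p :=
  (h.smooth_map.comp p h.smooth).congr_of_eventuallyEq h.eq

lemma pd_map (h : Reparam τ p φ φ') (i : Fin m) :
    pd i φ' p = ∑ a, jac τ p a i • pd a φ (τ p) := by
  rw [pd_congr i h.eq, pd_comp (differentiableAt_of_smooth h.smooth)
    (differentiableAt_of_smooth h.smooth_map)]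
  rfl

lemma metric_eq (h : Reparam τ p φ φ') :
    metric φ' p = (jac τ p).transpose * metric φ (τ p) * jac τ p := by
  ext i j
  simp only [metric, Matrix.of_apply, h.pd_map, Matrix.mul_apply, Matrix.transpose_apply,
    sum_inner, inner_sum, real_inner_smul_left, real_inner_smul_right, Finset.sum_mul]
  refine Finset.sum_congr rfl fun a _ => Finset.sum_congr rfl fun b _ => ?_
  rw [real_inner_comm (pd a φ (τ p))]
  ring

/-- Inversion of g' = Jᵀ g J. -/
lemma metricInv_eq (h : Reparam τ p φ φ') (a b : Fin m) :
    ∑ i, ∑ j, metricInv φ' p i j * (jac τ p a i * jac τ p b j) = metricInv φ (τ p) a b := by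
  have hJ : IsUnit (jac τ p).det := isUnit_iff_ne_zero.2 (by rw [det_jac]; exact h.det_pos.ne')
  have hg : IsUnit (metric φ (τ p)).det := isUnit_iff_ne_zero.2 h.immersion
  have key : jac τ p * metricInv φ' p * (jac τ p).transpose = metricInv φ (τ p) := by
    rw [metricInv, h.metric_eq, Matrix.mul_inv_rev, Matrix.mul_inv_rev, ← Matrix.mul_assoc,
      Matrix.mul_nonsing_inv _ hJ, Matrix.one_mul, Matrix.mul_assoc, Matrix.nonsing_inv_mul,
      Matrix.mul_one, metricInv]
    rwa [Matrix.det_transpose]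
  rw [← key]
  simp only [Matrix.mul_apply, Matrix.transpose_apply, Finset.sum_mul]
  rw [Finset.sum_comm]
  refine Finset.sum_congr rfl fun i _ => Finset.sum_congr rfl fun j _ => ?_
  ring

/-- The trace of a covariant 2-tensor does not depend on coordinates; the invariance of H, Δ,
⟨∇·,∇·⟩ and |A|² reduces to this. -/
lemma contract (h : Reparam τ p φ φ') (B : Fin m → Fin m → V) :
    ∑ i, ∑ j, metricInv φ' p i j • (∑ a, ∑ b, (jac τ p a i * jac τ p b j) • B a b) =
      ∑ a, ∑ b, metricInv φ (τ p) a b • B a b := by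
  simp only [← h.metricInv_eq, Finset.smul_sum, Finset.sum_smul, smul_smul]
  exact sum_swap_pairs _

/-- Transformation law of Γ. The inhomogeneous term ∂_i∂_jτ is the one that the chain rule for
second derivatives produces, so the two cancel in the Hessian (`covHess_eq`). -/
lemma jac_christoffel (h : Reparam τ p φ φ') (c i j : Fin m) :
    ∑ k, jac τ p c k * christoffel φ' k i j p =
      ∑ a, ∑ b, (jac τ p a i * jac τ p b j) * christoffel φ c a b (τ p) +
        pd i (pd j τ) p c := by
  have h1 : ∑ k, jac τ p c k * christoffel φ' k i j p =
      ∑ d, metricInv φ (τ p) c d * inner ℝ (pd i (pd j φ') p) (pd d φ (τ p)) := by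
    simp only [christoffel_eq h.smooth', h.pd_map _, inner_sum, real_inner_smul_right,
      ← h.metricInv_eq, Finset.mul_sum, Finset.sum_mul]
    rw [Finset.sum_comm_cycle]
    refine Finset.sum_congr rfl fun k _ => ?_
    refine Finset.sum_congr rfl fun l _ => Finset.sum_congr rfl fun d _ => ?_
    ring
  have h2 : pd i (pd j φ') p = ∑ a, ∑ b, (jac τ p a i * jac τ p b j) • pd a (pd b φ) (τ p) +
        ∑ b, (pd i (pd j τ) p) b • pd b φ (τ p) := by
    rw [pd_congr i (eventuallyEq_pd j h.eq), pd_pd_comp h.smooth h.smooth_map]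
    rfl
  simp only [h1, h2, inner_add_left, mul_add, Finset.sum_add_distrib, christoffel_eq h.smooth_map]
  congr 1
  · simp only [sum_inner, real_inner_smul_left, Finset.mul_sum]
    rw [Finset.sum_comm]
    refine Finset.sum_congr rfl fun a _ => ?_
    rw [Finset.sum_comm]
    refine Finset.sum_congr rfl fun b _ => Finset.sum_congr rfl fun d _ => ?_
    ring
  · simp only [sum_inner, real_inner_smul_left, Finset.mul_sum]
    rw [Finset.sum_comm]
    have : ∀ b, ∑ d, metricInv φ (τ p) c d *
        ((pd i (pd j τ) p) b * inner ℝ (pd b φ (τ p)) (pd d φ (τ p))) =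
        (if c = b then 1 else 0) * pd i (pd j τ) p b := by
      intro b
      rw [← sum_metricInv_mul_metric h.immersion, Finset.sum_mul]
      refine Finset.sum_congr rfl fun d _ => ?_
      rw [metric_symm]
      simp only [metric, Matrix.of_apply]
      ring
    simp [this]

lemma covHess_eq (h : Reparam τ p φ φ') {f f' : E m → V} (hf : ContDiffAt ℝ ∞ f (τ p))
    (hf' : f' =ᶠ[𝓝 p] fun q => f (τ q)) (i j : Fin m) :
    covHess φ' f' i j p =
      ∑ a, ∑ b, (jac τ p a i * jac τ p b j) • covHess φ f a b (τ p) := by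
  have h1 : ∀ k, pd k f' p = ∑ c, jac τ p c k • pd c f (τ p) := by
    intro k
    rw [pd_congr k hf', pd_comp (differentiableAt_of_smooth h.smooth)
      (differentiableAt_of_smooth hf)]
    rfl
  have h2 : ∑ k, christoffel φ' k i j p • pd k f' p =
      ∑ c, (∑ k, jac τ p c k * christoffel φ' k i j p) • pd c f (τ p) := by
    simp only [h1, Finset.smul_sum, Finset.sum_smul, smul_smul]
    rw [Finset.sum_comm]
    simp only [mul_comm]
  have h3 : pd i (pd j f') p = ∑ a, ∑ b, (jac τ p a i * jac τ p b j) • pd a (pd b f) (τ p) +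
        ∑ b, (pd i (pd j τ) p) b • pd b f (τ p) := by
    rw [pd_congr i (eventuallyEq_pd j hf'), pd_pd_comp h.smooth hf]
    rfl
  rw [covHess, h2, h3]
  simp only [h.jac_christoffel, add_smul, Finset.sum_add_distrib, covHess, smul_sub,
    Finset.sum_sub_distrib, Finset.sum_smul, Finset.smul_sum, smul_smul]
  rw [add_sub_add_right_eq_sub]
  congr 1
  rw [Finset.sum_comm]
  refine Finset.sum_congr rfl fun a _ => ?_
  rw [Finset.sum_comm]

lemma coordSFF_eq (h : Reparam τ p φ φ') (i j : Fin m) :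
    coordSFF φ' i j p = ∑ a, ∑ b, (jac τ p a i * jac τ p b j) • coordSFF φ a b (τ p) :=
  h.covHess_eq h.smooth_map h.eq i j

lemma coordH_eq (h : Reparam τ p φ φ') : coordH φ' p = coordH φ (τ p) := by
  simp only [coordH, h.coordSFF_eq, h.contract]

lemma coordLaplacian_eq (h : Reparam τ p φ φ') {f f' : E m → ℝ} (hf : ContDiffAt ℝ ∞ f (τ p))
    (hf' : f' =ᶠ[𝓝 p] fun q => f (τ q)) :
    coordLaplacian φ' f' p = coordLaplacian φ f (τ p) := by
  simp only [coordLaplacian_eq_covHess, h.covHess_eq hf hf', h.contract]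

lemma coordGradInner_eq (h : Reparam τ p φ φ') {f f' k k' : E m → ℝ}
    (hf : DifferentiableAt ℝ f (τ p)) (hf' : f' =ᶠ[𝓝 p] fun q => f (τ q))
    (hk : DifferentiableAt ℝ k (τ p)) (hk' : k' =ᶠ[𝓝 p] fun q => k (τ q)) :
    coordGradInner φ' f' k' p = coordGradInner φ f k (τ p) := by
  have hτ := differentiableAt_of_smooth h.smooth
  have := h.contract fun a b => pd a f (τ p) * pd b k (τ p)
  simp only [smul_eq_mul] at this
  simp only [coordGradInner, mul_assoc]
  rw [← this]
  refine Finset.sum_congr rfl fun i _ => Finset.sum_congr rfl fun j _ => ?_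
  rw [pd_congr i hf', pd_congr j hk', pd_comp hτ hf, pd_comp hτ hk, Finset.sum_mul_sum]
  simp only [smul_eq_mul, jac, Matrix.of_apply]
  congr 1
  refine Finset.sum_congr rfl fun a _ => Finset.sum_congr rfl fun b _ => ?_
  ring

lemma coordNormSqA_eq (h : Reparam τ p φ φ') : coordNormSqA φ' p = coordNormSqA φ (τ p) := by
  have h3 : ∀ j l, ∑ i, ∑ k, metricInv φ' p i k •
        (inner ℝ (coordSFF φ' i j p) (coordSFF φ' k l p) : ℝ) =
      ∑ b, ∑ d, (jac τ p b j * jac τ p d l) • ∑ a, ∑ c, metricInv φ (τ p) a c •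
        (inner ℝ (coordSFF φ a b (τ p)) (coordSFF φ c d (τ p)) : ℝ) := by
    intro j l
    have h4 : ∀ i k, (inner ℝ (coordSFF φ' i j p) (coordSFF φ' k l p) : ℝ) =
        ∑ a, ∑ c, (jac τ p a i * jac τ p c k) •
          (inner ℝ (∑ b, jac τ p b j • coordSFF φ a b (τ p))
            (∑ d, jac τ p d l • coordSFF φ c d (τ p)) : ℝ) := by
      intro i k
      simp only [h.coordSFF_eq, mul_smul, ← Finset.smul_sum (r := jac τ p _ _)]
      simpa only [mul_smul, Finset.smul_sum] using
        inner_sum_smul_sum_smul (fun a => jac τ p a i) (fun c => jac τ p c k)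
        (fun a => ∑ b, jac τ p b j • coordSFF φ a b (τ p))
        (fun c => ∑ d, jac τ p d l • coordSFF φ c d (τ p))
    simp only [h4, h.contract]
    simp only [sum_inner, inner_sum, real_inner_smul_left, real_inner_smul_right,
      smul_eq_mul, Finset.mul_sum]
    rw [sum_swap_pairs, Finset.sum_comm]
    refine Finset.sum_congr rfl fun i _ => Finset.sum_congr rfl fun k _ =>
      Finset.sum_congr rfl fun j _ => Finset.sum_congr rfl fun l _ => ?_
    ring
  rw [coordNormSqA_eq_sum_smul, coordNormSqA_eq_sum_smul, ← h.contract]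
  simp only [h3]

/-- The numerator picks up det J and the denominator |det J|, so here the sign of the Jacobian
matters. -/
lemma coordW_eq (h : Reparam τ p φ φ') (Ω : E n [⋀^Fin m]→ₗ[ℝ] ℝ) :
    coordW Ω φ' p = coordW Ω φ (τ p) := by
  have h1 : Ω (fun i => pd i φ' p) = (jac τ p).det * Ω (fun i => pd i φ (τ p)) := by
    have hv : (fun i => pd i φ' p) = fun i => fderiv ℝ φ (τ p) (pd i τ p) := by
      ext1 i
      rw [h.pd_map, fderiv_eq_sum_pd]
      rfl
    have hdet := congrArg (fun A => A fun i => pd i τ p)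
      ((Ω.compLinearMap (fderiv ℝ φ (τ p) : E m →ₗ[ℝ] E n)).eq_smul_basis_det
        (EuclideanSpace.basisFun (Fin m) ℝ).toBasis)
    simp only [AlternatingMap.compLinearMap_apply, AlternatingMap.smul_apply, smul_eq_mul] at hdet
    rw [hv, mul_comm]
    refine hdet.trans ?_
    congr 1
    simp [pd]
  have hd : 0 < (jac τ p).det := by rw [det_jac]; exact h.det_pos
  have h2 : Real.sqrt (metric φ' p).det = (jac τ p).det * Real.sqrt (metric φ (τ p)).det := by
    rw [h.metric_eq, Matrix.det_mul, Matrix.det_mul, Matrix.det_transpose,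
      mul_right_comm, Real.sqrt_mul (mul_self_nonneg _), Real.sqrt_mul_self hd.le]
  rw [coordW, coordW, h1, h2, mul_div_mul_left _ _ hd.ne']

end Reparam
end Reparametrization

/-! ### The Ricci equation -/

section Ricci

variable {m n : ℕ} {φ φ' : E m → E n} {p : E m}

lemma sum_mul_sum_pairs {ι : Type*} [Fintype ι] (x y : ι → ι → ℝ) :
    (∑ a, ∑ c, x a c) * (∑ b, ∑ d, y b d) = ∑ c, ∑ d, ∑ a, ∑ b, x a c * y b d := by
  simp only [← Finset.sum_mul_sum]
  rw [Finset.sum_comm, Finset.sum_comm (f := fun b d => y b d)]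

lemma inner_normalProj_pd (h : (metric φ p).det ≠ 0) (z : E n) (l : Fin m) :
    inner ℝ (normalProj φ p z) (pd l φ p) = 0 := by
  simp only [normalProj, inner_sub_left, sum_inner, real_inner_smul_left]
  rw [Finset.sum_comm]
  have h2 : ∀ j, ∑ i, metricInv φ p i j * inner ℝ z (pd j φ p) * inner ℝ (pd i φ p) (pd l φ p)
      = (if j = l then 1 else 0) * inner ℝ z (pd j φ p) := by
    intro j
    rw [← sum_metricInv_mul_metric h, Finset.sum_mul]
    refine Finset.sum_congr rfl fun i _ => ?_
    rw [metricInv_symm φ p i j]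
    simp only [metric, Matrix.of_apply]
    ring
  simp [h2]

lemma inner_normalProj_of_normal {y : E n} (hy : ∀ l, inner ℝ y (pd l φ p) = 0) (z : E n) :
    inner ℝ (normalProj φ p z) y = inner ℝ z y := by
  simp [normalProj, inner_sub_left, sum_inner, real_inner_smul_left,
    real_inner_comm y (pd _ φ p), hy]

lemma contDiffAt_normalProj (hφ : ContDiffAt ℝ ∞ φ p) (h : (metric φ p).det ≠ 0)
    {Y : E m → E n} (hY : ContDiffAt ℝ ∞ Y p) :
    ContDiffAt ℝ ∞ (fun q => normalProj φ q (Y q)) p :=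
  hY.sub <| ContDiffAt.sum fun i _ => ContDiffAt.sum fun j _ =>
    ((contDiffAt_metricInv hφ h i j).mul (hY.inner ℝ (contDiffAt_pd j hφ))).smul
      (contDiffAt_pd i hφ)

/-- Write the projection as Y minus coefficients times ∂_kφ. Derivatives of the coefficients
multiply tangent vectors and project to zero; derivatives of ∂_kφ project to A_ik. -/
lemma normalProj_pd_normalProj (hφ : ContDiffAt ℝ ∞ φ p) (h : (metric φ p).det ≠ 0)
    {Y : E m → E n} (hY : ContDiffAt ℝ ∞ Y p) (i : Fin m) :
    normalProj φ p (pd i (fun q => normalProj φ q (Y q)) p) =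
      normalProj φ p (pd i Y p) - ∑ k, ∑ l,
        (metricInv φ p k l * inner ℝ (Y p) (pd l φ p)) • coordSFF φ i k p := by
  have hc : ∀ k l, ContDiffAt ℝ ∞ (fun q => metricInv φ q k l * inner ℝ (Y q) (pd l φ q)) p :=
    fun k l => (contDiffAt_metricInv hφ h k l).mul (hY.inner ℝ (contDiffAt_pd l hφ))
  have ht : ∀ k l, ContDiffAt ℝ ∞
      (fun q => (metricInv φ q k l * inner ℝ (Y q) (pd l φ q)) • pd k φ q) p :=
    fun k l => (hc k l).smul (contDiffAt_pd k hφ)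
  have h1 : pd i (fun q => normalProj φ q (Y q)) p = pd i Y p - ∑ k, ∑ l,
      (pd i (fun q => metricInv φ q k l * inner ℝ (Y q) (pd l φ q)) p • pd k φ p +
        (metricInv φ p k l * inner ℝ (Y p) (pd l φ p)) • pd i (pd k φ) p) := by
    simp only [normalProj]
    rw [pd_sub i (differentiableAt_of_smooth hY) (differentiableAt_of_smooth
      (ContDiffAt.sum fun k _ => ContDiffAt.sum fun l _ => ht k l)),
      pd_sum _ _ fun k _ => differentiableAt_of_smooth (ContDiffAt.sum fun l _ => ht k l)]
    congr 1
    refine Finset.sum_congr rfl fun k _ => ?_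
    rw [pd_sum _ _ fun l _ => differentiableAt_of_smooth (ht k l)]
    refine Finset.sum_congr rfl fun l _ => ?_
    rw [pd_smul i (differentiableAt_of_smooth (hc k l))
      (differentiableAt_of_smooth (contDiffAt_pd k hφ))]
  rw [h1, normalProj_eq, map_sub, map_sum]
  simp only [map_sum, map_add, map_smul, ← normalProj_eq, normalProj_pd h,
    normalProj_pd_pd hφ h, smul_zero, zero_add]

/-- The right hand side of the Ricci equation of `φ` at `p` vanishes. -/
def RicciFlatAt (φ : E m → E n) (p : E m) : Prop :=
  ∀ (i j : Fin m) (ξ ζ : E n),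
    ∑ k, ∑ l, metricInv φ p k l •
        ((inner ℝ (coordSFF φ i k p) ξ : ℝ) * (inner ℝ (coordSFF φ j l p) ζ : ℝ)) =
      ∑ k, ∑ l, metricInv φ p k l •
        ((inner ℝ (coordSFF φ j k p) ξ : ℝ) * (inner ℝ (coordSFF φ i l p) ζ : ℝ))

/-- The Ricci equation: the curvature of the normal connection on normal fields. -/
lemma normalCurvature_normalProj (hφ : ContDiffAt ℝ ∞ φ p) (h : (metric φ p).det ≠ 0)
    (i j : Fin m) (ζ : E n) :
    normalCurvature φ i j (fun q => normalProj φ q ζ) p =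
      ∑ k, ∑ l, (metricInv φ p k l * inner ℝ (coordSFF φ j l p) ζ) • coordSFF φ i k p -
      ∑ k, ∑ l, (metricInv φ p k l * inner ℝ (coordSFF φ i l p) ζ) • coordSFF φ j k p := by
  set ν : E m → E n := fun q => normalProj φ q ζ with hν
  have hνs : ContDiffAt ℝ ∞ ν p := contDiffAt_normalProj hφ h contDiffAt_const
  have key : ∀ i j, normalDeriv φ i (normalDeriv φ j ν) p =
      normalProj φ p (pd i (pd j ν) p) + ∑ k, ∑ l,
        (metricInv φ p k l * inner ℝ (coordSFF φ j l p) ζ) • coordSFF φ i k p := by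
    intro i j
    -- Differentiate ⟨ν, ∂_lφ⟩ = 0, which holds near p.
    have h1 : ∀ l, (inner ℝ (pd j ν p) (pd l φ p) : ℝ) = - inner ℝ (coordSFF φ j l p) ζ := by
      intro l
      have hz : (fun q => (inner ℝ (ν q) (pd l φ q) : ℝ)) =ᶠ[𝓝 p] fun _ => 0 := by
        filter_upwards [eventually_metric_det_ne_zero hφ h] with q hq
          using inner_normalProj_pd hq ζ l
      have h2 := pd_inner j (differentiableAt_of_smooth hνs)
        (differentiableAt_of_smooth (contDiffAt_pd l hφ))
      rw [pd_congr j hz, pd_const] at h2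
      have h3 : (inner ℝ (ν p) (pd j (pd l φ) p) : ℝ) = inner ℝ (coordSFF φ j l p) ζ := by
        rw [real_inner_comm, ← inner_normalProj_of_normal (inner_normalProj_pd h ζ),
          normalProj_pd_pd hφ h, real_inner_comm,
          inner_normalProj_of_normal (inner_coordSFF_pd hφ h j l), real_inner_comm]
      linarith
    rw [normalDeriv]
    have h4 := normalProj_pd_normalProj hφ h (contDiffAt_pd j hνs) i
    simp only [h1, mul_neg, neg_smul, Finset.sum_neg_distrib, sub_neg_eq_add] at h4
    exact h4
  rw [normalCurvature, key, key, pd_comm hνs i j]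
  abel

/-- Projections of constant vectors ζ are enough test fields: their curvature, paired with ξ, is the
difference of the two sides of `RicciFlatAt`. -/
lemma ricciFlatAt_of_normalCurvature (hφ : ContDiffAt ℝ ∞ φ p) (h : (metric φ p).det ≠ 0)
    (hflat : ∀ ν : E m → E n, ContDiffAt ℝ ∞ ν p →
      (∀ᶠ q in 𝓝 p, ∀ k, inner ℝ (ν q) (pd k φ q) = 0) →
      ∀ i j, normalCurvature φ i j ν p = 0) : RicciFlatAt φ p := by
  intro i j ξ ζ
  have h1 := hflat (fun q => normalProj φ q ζ) (contDiffAt_normalProj hφ h contDiffAt_const)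
    (by filter_upwards [eventually_metric_det_ne_zero hφ h] with q hq k
          using inner_normalProj_pd hq ζ k) i j
  rw [normalCurvature_normalProj hφ h, sub_eq_zero] at h1
  have h2 := congrArg (fun z => (inner ℝ z ξ : ℝ)) h1
  simp only [sum_inner, real_inner_smul_left] at h2
  convert h2 using 1 <;>
  · refine Finset.sum_congr rfl fun k _ => Finset.sum_congr rfl fun l _ => ?_
    rw [smul_eq_mul]
    ring

lemma RicciFlatAt.reparam {τ : E m → E m} (hr : Reparam τ p φ φ')
    (h : RicciFlatAt φ (τ p)) : RicciFlatAt φ' p := by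
  intro i j ξ ζ
  have key : ∀ i j, ∑ k, ∑ l, metricInv φ' p k l •
        ((inner ℝ (coordSFF φ' i k p) ξ : ℝ) * (inner ℝ (coordSFF φ' j l p) ζ : ℝ)) =
      ∑ a, ∑ b, (jac τ p a i * jac τ p b j) * ∑ c, ∑ d, metricInv φ (τ p) c d •
        ((inner ℝ (coordSFF φ a c (τ p)) ξ : ℝ) * (inner ℝ (coordSFF φ b d (τ p)) ζ : ℝ)) := by
    intro i j
    have h1 : ∀ k l, ((inner ℝ (coordSFF φ' i k p) ξ : ℝ) * (inner ℝ (coordSFF φ' j l p) ζ : ℝ)) =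
        ∑ c, ∑ d, (jac τ p c k * jac τ p d l) • ∑ a, ∑ b, (jac τ p a i * jac τ p b j) *
        ((inner ℝ (coordSFF φ a c (τ p)) ξ : ℝ) * (inner ℝ (coordSFF φ b d (τ p)) ζ : ℝ)) := by
      intro k l
      simp only [hr.coordSFF_eq, sum_inner, real_inner_smul_left, smul_eq_mul]
      rw [sum_mul_sum_pairs]
      simp only [Finset.mul_sum]
      refine Finset.sum_congr rfl fun c _ => Finset.sum_congr rfl fun d _ =>
        Finset.sum_congr rfl fun a _ => Finset.sum_congr rfl fun b _ => ?_
      ring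
    simp only [h1, hr.contract]
    simp only [Finset.smul_sum, Finset.mul_sum]
    rw [sum_swap_pairs]
    refine Finset.sum_congr rfl fun a _ => Finset.sum_congr rfl fun b _ =>
      Finset.sum_congr rfl fun c _ => Finset.sum_congr rfl fun d _ => ?_
    simp only [smul_eq_mul]
    ring
  rw [key, key, Finset.sum_comm]
  refine Finset.sum_congr rfl fun a _ => Finset.sum_congr rfl fun b _ => ?_
  rw [h b a ξ ζ, mul_comm (jac τ p b i)]

end Ricci

/-! ### Joint smoothness in space and time -/

section TimeDependent

variable {m n : ℕ} {V W X : Type*} [NormedAddCommGroup V] [NormedSpace ℝ V]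
  {U : Set (E m)} {T : ℝ}

/-- `f` is smooth in space and time on `U × [0, T)`. -/
def JointSmooth (U : Set (E m)) (T : ℝ) (f : E m → ℝ → V) : Prop :=
  ContDiffOn ℝ ∞ (fun z : E m × ℝ => f z.1 z.2) (U ×ˢ Ico 0 T)

lemma uniqueDiffOn_cylinder (hU : IsOpen U) : UniqueDiffOn ℝ (U ×ˢ Ico 0 T) :=
  hU.uniqueDiffOn.prod (uniqueDiffOn_Ico 0 T)

namespace JointSmooth

variable {f : E m → ℝ → V} {q : E m} {t : ℝ}

lemma contDiffAt (hf : JointSmooth U T f) (hU : IsOpen U) (hq : q ∈ U) (ht : t ∈ Ico 0 T) :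
    ContDiffAt ℝ ∞ (fun y => f y t) q := by
  have h : ContDiffOn ℝ ∞ (fun y => f y t) U :=
    hf.comp (contDiff_id.prodMk contDiff_const).contDiffOn fun y hy => ⟨hy, ht⟩
  exact h.contDiffAt (hU.mem_nhds hq)

lemma hasFDerivWithinAt (hf : JointSmooth U T f) (hq : q ∈ U) (ht : t ∈ Ico 0 T) :
    HasFDerivWithinAt (fun z : E m × ℝ => f z.1 z.2)
      (fderivWithin ℝ (fun z : E m × ℝ => f z.1 z.2) (U ×ˢ Ico 0 T) (q, t))
      (U ×ˢ Ico 0 T) (q, t) :=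
  (hf.differentiableOn (by simp) _ ⟨hq, ht⟩).hasFDerivWithinAt

lemma hasDerivWithinAt' (hf : JointSmooth U T f) (hq : q ∈ U) (ht : t ∈ Ico 0 T) :
    HasDerivWithinAt (f q)
      (fderivWithin ℝ (fun z : E m × ℝ => f z.1 z.2) (U ×ˢ Ico 0 T) (q, t) (0, 1))
      (Ico 0 T) t := by
  have h1 : HasFDerivWithinAt (fun s : ℝ => (q, s)) (ContinuousLinearMap.inr ℝ (E m) ℝ)
      (Ico 0 T) t := (hasFDerivAt_prodMk_right q t).hasFDerivWithinAt
  have h2 := (hf.hasFDerivWithinAt hq ht).comp t h1 (fun s hs => ⟨hq, hs⟩)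
  have h3 := h2.hasDerivWithinAt
  simpa [Function.comp_def] using h3

lemma hasDerivWithinAt (hf : JointSmooth U T f) (hq : q ∈ U) (ht : t ∈ Ico 0 T) :
    HasDerivWithinAt (f q) (derivWithin (f q) (Ico 0 T) t) (Ico 0 T) t :=
  (hf.hasDerivWithinAt' hq ht).differentiableWithinAt.hasDerivWithinAt

lemma derivWithin_eq (hf : JointSmooth U T f) (hq : q ∈ U) (ht : t ∈ Ico 0 T) :
    derivWithin (f q) (Ico 0 T) t =
      fderivWithin ℝ (fun z : E m × ℝ => f z.1 z.2) (U ×ˢ Ico 0 T) (q, t) (0, 1) :=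
  (hf.hasDerivWithinAt' hq ht).derivWithin (uniqueDiffOn_Ico 0 T t ht)

lemma pd_eq (hf : JointSmooth U T f) (hU : IsOpen U) (hq : q ∈ U) (ht : t ∈ Ico 0 T)
    (i : Fin m) : pd i (fun y => f y t) q =
      fderivWithin ℝ (fun z : E m × ℝ => f z.1 z.2) (U ×ˢ Ico 0 T) (q, t)
        (EuclideanSpace.single i 1, 0) := by
  have h1 : HasFDerivWithinAt (fun y : E m => (y, t)) (ContinuousLinearMap.inl ℝ (E m) ℝ)
      U q := (hasFDerivAt_prodMk_left q t).hasFDerivWithinAt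
  have h2 := HasFDerivWithinAt.comp (g := fun z : E m × ℝ => f z.1 z.2) (t := U ×ˢ Ico 0 T) q
    (hf.hasFDerivWithinAt hq ht) h1 (fun s hs => ⟨hs, ht⟩)
  have h3 := (h2.hasFDerivAt (hU.mem_nhds hq)).fderiv
  simp only [Function.comp_def] at h3
  simp [pd, h3]

lemma smooth_fderivWithin (hf : JointSmooth U T f) (hU : IsOpen U) (v : E m × ℝ) :
    JointSmooth U T (fun q t =>
      fderivWithin ℝ (fun z : E m × ℝ => f z.1 z.2) (U ×ˢ Ico 0 T) (q, t) v) :=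
  (ContDiffOn.fderivWithin hf (uniqueDiffOn_cylinder hU) (m := ∞) (by simp)).clm_apply
    contDiffOn_const

lemma smooth_pd (hf : JointSmooth U T f) (hU : IsOpen U) (i : Fin m) :
    JointSmooth U T (fun q t => pd i (fun y => f y t) q) :=
  (hf.smooth_fderivWithin hU (EuclideanSpace.single i 1, 0)).congr fun _ hz =>
    hf.pd_eq hU hz.1 hz.2 i

/-- Space and time derivatives commute up to and including t = 0, because every point of U × [0,T)
lies in the closure of its interior and the second derivative within the set is therefore symmetric.
-/
lemma hasDerivWithinAt_pd (hf : JointSmooth U T f) (hU : IsOpen U) (hq : q ∈ U)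
    (ht : t ∈ Ico 0 T) (i : Fin m) :
    HasDerivWithinAt (fun s => pd i (fun y => f y s) q)
      (pd i (fun y => derivWithin (f y) (Ico 0 T) t) q) (Ico 0 T) t := by
  set F : E m × ℝ → V := fun z => f z.1 z.2
  set S := U ×ˢ Ico 0 T with hS
  have hST : UniqueDiffOn ℝ S := uniqueDiffOn_cylinder hU
  have hsymm : IsSymmSndFDerivWithinAt ℝ F S (q, t) := by
    refine ContDiffWithinAt.isSymmSndFDerivWithinAt (hf _ ⟨hq, ht⟩)
      (by simpa using (WithTop.coe_le_coe.2 le_top : ((2 : ℕ∞) : WithTop ℕ∞) ≤ ∞)) hST ?_ ⟨hq, ht⟩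
    rw [hS, interior_prod_eq, hU.interior_eq, interior_Ico, closure_prod_eq,
      closure_Ioo (ht.1.trans_lt ht.2).ne]
    exact ⟨subset_closure hq, ht.1, ht.2.le⟩
  have hD : DifferentiableWithinAt ℝ (fderivWithin ℝ F S) S (q, t) :=
    (ContDiffOn.fderivWithin hf hST (m := ∞) (by simp)).differentiableOn (by simp) _ ⟨hq, ht⟩
  have happ : ∀ v w : E m × ℝ, fderivWithin ℝ (fun z => fderivWithin ℝ F S z v) S
      (q, t) w = fderivWithin ℝ (fderivWithin ℝ F S) S (q, t) w v := by
    intro v w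
    rw [fderivWithin_clm_apply (hST _ ⟨hq, ht⟩) hD (differentiableWithinAt_const _)]
    simp
  have h1 := (hf.smooth_fderivWithin hU (EuclideanSpace.single i 1, 0)).hasDerivWithinAt' hq ht
  have h2 := (hf.smooth_fderivWithin hU (0, 1)).pd_eq hU hq ht i
  have h3 : (fun y => derivWithin (f y) (Ico 0 T) t) =ᶠ[𝓝 q] fun y =>
      fderivWithin ℝ F S (y, t) (0, 1) := by
    filter_upwards [hU.mem_nhds hq] with y hy using hf.derivWithin_eq hy ht
  rw [pd_congr i h3]
  have h4 : pd i (fun y => fderivWithin ℝ F S (y, t) (0, 1)) q =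
      fderivWithin ℝ (fderivWithin ℝ F S) S (q, t) (0, 1)
        (EuclideanSpace.single i 1, 0) := by
    refine h2.trans ?_
    refine (happ (0, 1) _).trans ?_
    exact hsymm _ _
  rw [h4]
  have h5 := happ (EuclideanSpace.single i 1, 0) (0, 1)
  rw [← h5]
  exact h1.congr (fun s hs => hf.pd_eq hU hq hs i) (hf.pd_eq hU hq ht i)

end JointSmooth
end TimeDependent

/-! ### Mean curvature flow in a coordinate domain -/

section TimeDependent

variable {m n : ℕ} {V W : Type*} [NormedAddCommGroup V] [NormedSpace ℝ V]
  {U : Set (E m)} {T : ℝ}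

namespace JointSmooth

lemma const (c : V) : JointSmooth U T (fun _ _ => c) := contDiffOn_const

lemma add {f g : E m → ℝ → V} (hf : JointSmooth U T f) (hg : JointSmooth U T g) :
    JointSmooth U T (fun q t => f q t + g q t) := ContDiffOn.add hf hg

lemma sub {f g : E m → ℝ → V} (hf : JointSmooth U T f) (hg : JointSmooth U T g) :
    JointSmooth U T (fun q t => f q t - g q t) := ContDiffOn.sub hf hg

lemma mul {f g : E m → ℝ → ℝ} (hf : JointSmooth U T f) (hg : JointSmooth U T g) :
    JointSmooth U T (fun q t => f q t * g q t) := ContDiffOn.mul hf hg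

lemma smul {f : E m → ℝ → ℝ} {g : E m → ℝ → V} (hf : JointSmooth U T f)
    (hg : JointSmooth U T g) : JointSmooth U T (fun q t => f q t • g q t) := ContDiffOn.smul hf hg

lemma inner {f g : E m → ℝ → E n} (hf : JointSmooth U T f) (hg : JointSmooth U T g) :
    JointSmooth U T (fun q t => (inner ℝ (f q t) (g q t) : ℝ)) := ContDiffOn.inner ℝ hf hg

lemma sum {ι : Type*} (s : Finset ι) {f : ι → E m → ℝ → V} (hf : ∀ k ∈ s, JointSmooth U T (f k)) :
    JointSmooth U T (fun q t => ∑ k ∈ s, f k q t) := ContDiffOn.sum hf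

lemma div {f g : E m → ℝ → ℝ} (hf : JointSmooth U T f) (hg : JointSmooth U T g)
    (h : ∀ q ∈ U, ∀ t ∈ Ico 0 T, g q t ≠ 0) :
    JointSmooth U T (fun q t => f q t / g q t) :=
  ContDiffOn.div hf hg fun z hz => h z.1 hz.1 z.2 hz.2

end JointSmooth

/-- A mean curvature flow of immersions of an open set of `ℝ^m`. -/
structure LocalSolution (U : Set (E m)) (T : ℝ) (Φ : E m → ℝ → E n) : Prop where
  isOpen : IsOpen U
  smooth : JointSmooth U T Φ
  immersion : ∀ q ∈ U, ∀ t ∈ Ico 0 T, 0 < (metric (fun y => Φ y t) q).det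
  flow : ∀ q ∈ U, ∀ t ∈ Ico 0 T,
    HasDerivWithinAt (Φ q) (coordH (fun y => Φ y t) q) (Ico 0 T) t

namespace LocalSolution

variable {Φ : E m → ℝ → E n}

lemma smooth_metric (h : LocalSolution U T Φ) (i j : Fin m) :
    JointSmooth U T (fun q t => metric (fun y => Φ y t) q i j) := by
  simpa [metric] using (h.smooth.smooth_pd h.isOpen i).inner (h.smooth.smooth_pd h.isOpen j)

lemma smooth_det (h : LocalSolution U T Φ) :
    JointSmooth U T (fun q t => (metric (fun y => Φ y t) q).det) := fun z hz =>
  contDiffWithinAt_matrix_det (G := fun z : E m × ℝ => metric (fun y => Φ y z.2) z.1)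
    fun i j => h.smooth_metric i j z hz

lemma smooth_metricInv (h : LocalSolution U T Φ) (i j : Fin m) :
    JointSmooth U T (fun q t => metricInv (fun y => Φ y t) q i j) := fun z hz =>
  contDiffWithinAt_matrix_inv (G := fun z : E m × ℝ => metric (fun y => Φ y z.2) z.1)
    (fun i j => h.smooth_metric i j z hz) (h.immersion z.1 hz.1 z.2 hz.2).ne' i j

lemma smooth_christoffel (h : LocalSolution U T Φ) (k i j : Fin m) :
    JointSmooth U T (fun q t => christoffel (fun y => Φ y t) k i j q) :=
  (JointSmooth.const (1 / 2 : ℝ)).mul <| JointSmooth.sum _ fun l _ =>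
    (h.smooth_metricInv k l).mul <|
      (((h.smooth_metric l j).smooth_pd h.isOpen i).add
        ((h.smooth_metric l i).smooth_pd h.isOpen j)).sub
        ((h.smooth_metric i j).smooth_pd h.isOpen l)

lemma smooth_SFF (h : LocalSolution U T Φ) (i j : Fin m) :
    JointSmooth U T (fun q t => coordSFF (fun y => Φ y t) i j q) :=
  ((h.smooth.smooth_pd h.isOpen j).smooth_pd h.isOpen i).sub <| JointSmooth.sum _ fun k _ =>
    (h.smooth_christoffel k i j).smul (h.smooth.smooth_pd h.isOpen k)

lemma smooth_normSqA (h : LocalSolution U T Φ) :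
    JointSmooth U T (fun q t => coordNormSqA (fun y => Φ y t) q) :=
  JointSmooth.sum _ fun i _ => JointSmooth.sum _ fun j _ => JointSmooth.sum _ fun k _ =>
    JointSmooth.sum _ fun l _ => ((h.smooth_metricInv i k).mul (h.smooth_metricInv j l)).mul
      ((h.smooth_SFF i j).inner (h.smooth_SFF k l))

lemma smooth_sqrt_det (h : LocalSolution U T Φ) :
    JointSmooth U T (fun q t => Real.sqrt (metric (fun y => Φ y t) q).det) := fun z hz =>
  (h.smooth_det z hz).sqrt (h.immersion z.1 hz.1 z.2 hz.2).ne'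

end LocalSolution

/-- Expansion in the standard basis exhibits Ω as a polynomial in the components, hence continuous.
-/
lemma form_eq_sum (Ω : E n [⋀^Fin m]→ₗ[ℝ] ℝ) (a : Fin m → E n) :
    Ω a = ∑ I : Fin m → Fin n, (∏ i, a i (I i)) * Ω fun i => EuclideanSpace.single (I i) 1 := by
  have h : ∀ i, a i = ∑ k, a i k • EuclideanSpace.single k (1 : ℝ) := fun i => by
    conv_lhs => rw [← (EuclideanSpace.basisFun (Fin n) ℝ).sum_repr (a i)]
    simp
  have h2 := Ω.toMultilinearMap.map_sum (fun i k => a i k • EuclideanSpace.single k (1 : ℝ))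
  simp only [← h] at h2
  refine h2.trans (Finset.sum_congr rfl fun I _ => ?_)
  exact Ω.toMultilinearMap.map_smul_univ (fun i => a i (I i))
    (fun i => EuclideanSpace.single (I i) 1)

/-- An alternating form on `ℝ^n`, as a continuous multilinear map. -/
def contForm (Ω : E n [⋀^Fin m]→ₗ[ℝ] ℝ) : ContinuousMultilinearMap ℝ (fun _ : Fin m => E n) ℝ :=
  { Ω.toMultilinearMap with
    cont := by
      change Continuous fun a => Ω a
      rw [funext (form_eq_sum Ω)]
      fun_prop }

lemma contForm_apply (Ω : E n [⋀^Fin m]→ₗ[ℝ] ℝ) (a : Fin m → E n) : contForm Ω a = Ω a := rfl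

namespace LocalSolution

variable {Φ : E m → ℝ → E n}

lemma smooth_form (h : LocalSolution U T Φ) (Ω : E n [⋀^Fin m]→ₗ[ℝ] ℝ) :
    JointSmooth U T (fun q t => Ω fun i => pd i (fun y => Φ y t) q) :=
  (contForm Ω).contDiff.comp_contDiffOn <| contDiffOn_pi.2 fun i => h.smooth.smooth_pd h.isOpen i

lemma smooth_W (h : LocalSolution U T Φ) (Ω : E n [⋀^Fin m]→ₗ[ℝ] ℝ) :
    JointSmooth U T (fun q t => coordW Ω (fun y => Φ y t) q) :=
  (h.smooth_form Ω).div h.smooth_sqrt_det fun q hq t ht =>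
    (Real.sqrt_pos.2 (h.immersion q hq t ht)).ne'

lemma contDiffAt (h : LocalSolution U T Φ) {q : E m} (hq : q ∈ U) {t : ℝ} (ht : t ∈ Ico 0 T) :
    ContDiffAt ℝ ∞ (fun y => Φ y t) q := h.smooth.contDiffAt h.isOpen hq ht

lemma hasDerivWithinAt_pd (h : LocalSolution U T Φ) {q : E m} (hq : q ∈ U) {t : ℝ}
    (ht : t ∈ Ico 0 T) (i : Fin m) :
    HasDerivWithinAt (fun s => pd i (fun y => Φ y s) q)
      (pd i (fun y => coordH (fun z => Φ z t) y) q) (Ico 0 T) t := by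
  have h1 := h.smooth.hasDerivWithinAt_pd h.isOpen hq ht i
  rwa [pd_congr i (g := fun y => coordH (fun z => Φ z t) y)] at h1
  filter_upwards [h.isOpen.mem_nhds hq] with y hy
  exact (h.flow y hy t ht).derivWithin (uniqueDiffOn_Ico 0 T t ht)

lemma hasDerivWithinAt_pd_pd (h : LocalSolution U T Φ) {q : E m} (hq : q ∈ U) {t : ℝ}
    (ht : t ∈ Ico 0 T) (i j : Fin m) :
    HasDerivWithinAt (fun s => pd i (pd j (fun y => Φ y s)) q)
      (pd i (pd j (fun y => coordH (fun z => Φ z t) y)) q) (Ico 0 T) t := by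
  have h1 := (h.smooth.smooth_pd h.isOpen j).hasDerivWithinAt_pd h.isOpen hq ht i
  rwa [pd_congr i (g := pd j (fun y => coordH (fun z => Φ z t) y))] at h1
  filter_upwards [h.isOpen.mem_nhds hq] with y hy
  exact (h.hasDerivWithinAt_pd hy ht j).derivWithin (uniqueDiffOn_Ico 0 T t ht)

/-- A change of coordinates of a local solution. -/
lemma comp (h : LocalSolution U T Φ) {τ : E m → E m} {U' : Set (E m)} (hU' : IsOpen U')
    (hτ : ∀ q ∈ U', ContDiffAt ℝ ∞ τ q) (hdet : ∀ q ∈ U', 0 < (fderiv ℝ τ q).det)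
    (hmaps : MapsTo τ U' U) : LocalSolution U' T (fun q t => Φ (τ q) t) := by
  have hr : ∀ q ∈ U', ∀ t ∈ Ico 0 T, Reparam τ q (fun y => Φ y t) (fun y => Φ (τ y) t) :=
    fun q hq t ht => ⟨hτ q hq, hdet q hq, h.contDiffAt (hmaps hq) ht,
      (h.immersion _ (hmaps hq) t ht).ne', EventuallyEq.rfl⟩
  refine ⟨hU', ?_, ?_, ?_⟩
  · have h1 : ContDiffOn ℝ ∞ (fun z : E m × ℝ => (τ z.1, z.2)) (U' ×ˢ Ico 0 T) := by
      refine ContDiffOn.prodMk (fun z hz => ?_) contDiffOn_snd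
      exact ((hτ z.1 hz.1).comp z contDiffAt_fst).contDiffWithinAt
    exact ContDiffOn.comp h.smooth h1 fun z hz => ⟨hmaps hz.1, hz.2⟩
  · intro q hq t ht
    rw [(hr q hq t ht).metric_eq, Matrix.det_mul, Matrix.det_mul, Matrix.det_transpose, det_jac]
    have := hdet q hq
    have := h.immersion _ (hmaps hq) t ht
    positivity
  · intro q hq t ht
    rw [(hr q hq t ht).coordH_eq]
    exact h.flow _ (hmaps hq) t ht

end LocalSolution

end TimeDependent

/-! ### Graph coordinates and the jets of the geometric quantities -/

section Graph

variable {m n : ℕ} {V : Type*} [NormedAddCommGroup V] [NormedSpace ℝ V]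

/-- As h is δ with vanishing first derivatives at p, no mixed products survive in the second
derivative. -/
lemma Jet.contract {r s : Fin m} {p : E m} {h : Fin m → Fin m → E m → ℝ}
    {h2 : Fin m → Fin m → ℝ} {B : Fin m → Fin m → E m → V} {B₀ Br Bs Brs : Fin m → Fin m → V}
    (hh : ∀ i j, Jet r s (h i j) p (if i = j then 1 else 0) 0 0 (h2 i j))
    (hB : ∀ i j, Jet r s (B i j) p (B₀ i j) (Br i j) (Bs i j) (Brs i j)) :
    Jet r s (fun q => ∑ i, ∑ j, h i j q • B i j q) p (∑ i, B₀ i i) (∑ i, Br i i) (∑ i, Bs i i)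
      (∑ i, Brs i i + ∑ i, ∑ j, h2 i j • B₀ i j) := by
  have := Jet.sum Finset.univ fun i _ => Jet.sum Finset.univ fun j _ => (hh i j).smul (hB i j)
  simpa [ite_smul, Finset.sum_add_distrib, add_comm] using this

/-- Near `p` the map `φ` is a graph over its tangent space at `p`, parametrized by
orthonormal coordinates of that space. -/
structure GraphAt (φ : E m → E n) (p : E m) : Prop where
  smooth : ∀ᶠ q in 𝓝 p, ContDiffAt ℝ ∞ φ q
  graph : ∀ᶠ q in 𝓝 p, ∀ i j, (inner ℝ (pd i φ q) (pd j φ p) : ℝ) = if i = j then 1 else 0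

/-- Differentiates the graph condition. Hypothesis and conclusion hold in a neighbourhood, so the
step can be iterated to reach third derivatives. -/
lemma eventually_inner_pd_eq_zero {f : E m → E n} {p : E m} {z : E n} {c : ℝ}
    (hs : ContDiffAt ℝ ∞ f p)
    (hf : ∀ᶠ q in 𝓝 p, (inner ℝ (f q) z : ℝ) = c) (r : Fin m) :
    ∀ᶠ q in 𝓝 p, (inner ℝ (pd r f q) z : ℝ) = 0 := by
  have h1 : (fun q => (inner ℝ (f q) z : ℝ)) =ᶠ[𝓝 p] fun _ => c := hf
  filter_upwards [eventuallyEq_pd r h1, eventually_differentiableAt hs] with q h2 h3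
  have h4 := pd_inner r h3 (differentiableAt_const z)
  rw [h2, pd_const, pd_const, inner_zero_right, add_zero] at h4
  exact h4.symm

namespace GraphAt

variable {φ : E m → E n} {p : E m}

lemma smoothAt (h : GraphAt φ p) : ContDiffAt ℝ ∞ φ p := h.smooth.self_of_nhds

lemma inner_pd (h : GraphAt φ p) (i j : Fin m) :
    (inner ℝ (pd i φ p) (pd j φ p) : ℝ) = if i = j then 1 else 0 := h.graph.self_of_nhds i j

lemma metric_eq_one (h : GraphAt φ p) : metric φ p = 1 := by
  ext i j
  rw [Matrix.one_apply]
  exact h.inner_pd i j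

lemma det_metric (h : GraphAt φ p) : (metric φ p).det = 1 := by rw [h.metric_eq_one, Matrix.det_one]

lemma eventually_inner_pd_pd (h : GraphAt φ p) (i j l : Fin m) :
    ∀ᶠ q in 𝓝 p, (inner ℝ (pd i (pd j φ) q) (pd l φ p) : ℝ) = 0 :=
  eventually_inner_pd_eq_zero (contDiffAt_pd j h.smoothAt) (h.graph.mono fun _ hq => hq j l) i

lemma eventually_inner_pd3 (h : GraphAt φ p) (k i j l : Fin m) :
    ∀ᶠ q in 𝓝 p, (inner ℝ (pd k (pd i (pd j φ)) q) (pd l φ p) : ℝ) = 0 :=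
  eventually_inner_pd_eq_zero (contDiffAt_pd i (contDiffAt_pd j h.smoothAt))
    (h.eventually_inner_pd_pd i j l) k

lemma inner_pd_pd (h : GraphAt φ p) (i j l : Fin m) :
    (inner ℝ (pd i (pd j φ) p) (pd l φ p) : ℝ) = 0 :=
  (h.eventually_inner_pd_pd i j l).self_of_nhds

lemma inner_pd_pd' (h : GraphAt φ p) (i j l : Fin m) :
    (inner ℝ (pd l φ p) (pd i (pd j φ) p) : ℝ) = 0 := by
  rw [real_inner_comm, h.inner_pd_pd]

lemma inner_pd3 (h : GraphAt φ p) (k i j l : Fin m) :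
    (inner ℝ (pd k (pd i (pd j φ)) p) (pd l φ p) : ℝ) = 0 :=
  (h.eventually_inner_pd3 k i j l).self_of_nhds

lemma inner_pd3' (h : GraphAt φ p) (k i j l : Fin m) :
    (inner ℝ (pd l φ p) (pd k (pd i (pd j φ)) p) : ℝ) = 0 := by
  rw [real_inner_comm, h.inner_pd3]

lemma jet_metric (h : GraphAt φ p) (r s i j : Fin m) :
    Jet r s (fun q => metric φ q i j) p (if i = j then 1 else 0) 0 0
      (inner ℝ (pd r (pd i φ) p) (pd s (pd j φ) p) +
        inner ℝ (pd s (pd i φ) p) (pd r (pd j φ) p)) := by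
  have h1 := (Jet.of_smooth (contDiffAt_pd i h.smoothAt) r s).inner
    (Jet.of_smooth (contDiffAt_pd j h.smoothAt) r s)
  simp [h.inner_pd, h.inner_pd_pd, h.inner_pd_pd', h.inner_pd3, h.inner_pd3'] at h1
  exact h1

/-- Differentiate g⁻¹g = 1 twice: since ∂g = 0 at p, the second derivative of g⁻¹ is minus that of
g. -/
lemma jet_metricInv (h : GraphAt φ p) (r s i j : Fin m) :
    Jet r s (fun q => metricInv φ q i j) p (if i = j then 1 else 0) 0 0
      (-(inner ℝ (pd r (pd i φ) p) (pd s (pd j φ) p) +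
        inner ℝ (pd s (pd i φ) p) (pd r (pd j φ) p))) := by
  have hdet : (metric φ p).det ≠ 0 := by rw [h.det_metric]; exact one_ne_zero
  have hJ := fun k => Jet.of_smooth (contDiffAt_metricInv h.smoothAt hdet i k) r s
  have hval : ∀ k, metricInv φ p i k = if i = k then 1 else 0 := fun k => by
    rw [metricInv, h.metric_eq_one, inv_one, Matrix.one_apply]
  have h1 := (Jet.sum Finset.univ fun k _ => (hJ k).mul (h.jet_metric r s k j))
  have h2 := (Jet.const (r := r) (s := s) (p := p) (if i = j then (1 : ℝ) else 0)).congr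
    (g := fun q => ∑ k, metricInv φ q i k * metric φ q k j) (by
      filter_upwards [eventually_metric_det_ne_zero h.smoothAt hdet] with q hq
      exact sum_metricInv_mul_metric hq i j)
  have hl := h1.left.symm.trans h2.left
  have hr := h1.right.symm.trans h2.right
  have hm := h1.mixed.symm.trans h2.mixed
  simp [hval, Finset.sum_add_distrib] at hl hr hm
  refine ⟨(hJ j).smooth, hval j, hl, hr, ?_⟩
  linarith

lemma christoffel_eventuallyEq (h : GraphAt φ p) (k i j : Fin m) :
    christoffel φ k i j =ᶠ[𝓝 p]
      fun q => ∑ l, metricInv φ q k l * inner ℝ (pd i (pd j φ) q) (pd l φ q) := by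
  filter_upwards [h.smooth] with q hq using christoffel_eq hq k i j

/-- The second derivative may stay unspecified: in A_ij it multiplies the tangent vector ∂_kφ and
disappears once paired with a normal vector. -/
lemma jet_christoffel (h : GraphAt φ p) (r s k i j : Fin m) :
    ∃ x, Jet r s (christoffel φ k i j) p 0 (inner ℝ (pd i (pd j φ) p) (pd r (pd k φ) p))
      (inner ℝ (pd i (pd j φ) p) (pd s (pd k φ) p)) x := by
  have h1 := (Jet.sum Finset.univ fun l _ => (h.jet_metricInv r s k l).mul
    ((Jet.of_smooth (contDiffAt_pd i (contDiffAt_pd j h.smoothAt)) r s).inner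
    (Jet.of_smooth (contDiffAt_pd l h.smoothAt) r s))).congr (h.christoffel_eventuallyEq k i j)
  simp only [h.inner_pd_pd, h.inner_pd3, zero_mul, mul_zero, ite_mul, one_mul, zero_add,
      add_zero, Finset.sum_ite_eq, Finset.mem_univ, if_true, Finset.sum_const_zero] at h1
  exact ⟨_, h1⟩

/-- The mixed second derivative of the second fundamental form, up to tangential terms. -/
lemma jet_SFF (h : GraphAt φ p) (r s i j : Fin m) :
    ∃ x : Fin m → ℝ, Jet r s (coordSFF φ i j) p (pd i (pd j φ) p)
      (pd r (pd i (pd j φ)) p -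
        ∑ k, (inner ℝ (pd i (pd j φ) p) (pd r (pd k φ) p) : ℝ) • pd k φ p)
      (pd s (pd i (pd j φ)) p -
        ∑ k, (inner ℝ (pd i (pd j φ) p) (pd s (pd k φ) p) : ℝ) • pd k φ p)
      (pd s (pd r (pd i (pd j φ))) p - ∑ k, (x k • pd k φ p +
        (inner ℝ (pd i (pd j φ) p) (pd r (pd k φ) p) : ℝ) • pd s (pd k φ) p +
        (inner ℝ (pd i (pd j φ) p) (pd s (pd k φ) p) : ℝ) • pd r (pd k φ) p)) := by
  choose x hx using fun k => h.jet_christoffel r s k i j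
  refine ⟨x, ?_⟩
  have h1 := (Jet.of_smooth (contDiffAt_pd i (contDiffAt_pd j h.smoothAt)) r s).sub
    (Jet.sum Finset.univ fun k _ => (hx k).smul
      (Jet.of_smooth (contDiffAt_pd k h.smoothAt) r s))
  simp at h1
  exact h1

lemma coordSFF_eq (h : GraphAt φ p) (i j : Fin m) : coordSFF φ i j p = pd i (pd j φ) p :=
  (h.jet_SFF i i i j).choose_spec.val

end GraphAt
end Graph

/-! ### Second derivatives of |A|² and of H in graph coordinates -/

section Graph

variable {m n : ℕ}

namespace GraphAt

variable {φ : E m → E n} {p : E m}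

/-- The last sum has coefficient -2 = -2 - 2 + 2: each factor differentiated twice contributes -2
through the derivatives of Γ, and the tangential parts of the two first derivatives multiply to +2.
-/
lemma jet_inner_SFF (h : GraphAt φ p) (r i j k l : Fin m) :
    Jet r r (fun q => (inner ℝ (coordSFF φ i j q) (coordSFF φ k l q) : ℝ)) p
      (inner ℝ (pd i (pd j φ) p) (pd k (pd l φ) p))
      (inner ℝ (pd r (pd i (pd j φ)) p) (pd k (pd l φ) p) +
        inner ℝ (pd i (pd j φ) p) (pd r (pd k (pd l φ)) p))
      (inner ℝ (pd r (pd i (pd j φ)) p) (pd k (pd l φ) p) +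
        inner ℝ (pd i (pd j φ) p) (pd r (pd k (pd l φ)) p))
      (inner ℝ (pd r (pd r (pd i (pd j φ))) p) (pd k (pd l φ) p) +
        inner ℝ (pd i (pd j φ) p) (pd r (pd r (pd k (pd l φ))) p) +
        2 * inner ℝ (pd r (pd i (pd j φ)) p) (pd r (pd k (pd l φ)) p) -
        2 * ∑ a, inner ℝ (pd i (pd j φ) p) (pd r (pd a φ) p) *
          inner ℝ (pd k (pd l φ) p) (pd r (pd a φ) p)) := by
  obtain ⟨x, hx⟩ := h.jet_SFF r r i j
  obtain ⟨y, hy⟩ := h.jet_SFF r r k l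
  have h1 := hx.inner hy
  convert h1 using 1
  · simp [inner_sub_left, inner_sub_right, sum_inner, inner_sum, real_inner_smul_left,
      real_inner_smul_right, h.inner_pd_pd, h.inner_pd_pd']
  · simp [inner_sub_left, inner_sub_right, sum_inner, inner_sum, real_inner_smul_left,
      real_inner_smul_right, h.inner_pd_pd, h.inner_pd_pd']
  · simp only [inner_sub_left, inner_sub_right, inner_add_left, inner_add_right, sum_inner,
      inner_sum, real_inner_smul_left, real_inner_smul_right, h.inner_pd_pd, h.inner_pd_pd',
      h.inner_pd3, h.inner_pd3', h.inner_pd, mul_ite, mul_one, mul_zero,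
      Finset.sum_ite_eq', Finset.sum_neg_distrib, Finset.mem_univ, if_true, Finset.sum_const_zero,
      sub_zero, zero_sub, zero_add,
      Finset.mul_sum, Finset.sum_add_distrib,
      real_inner_comm (pd k (pd l φ) p) (pd r (pd _ φ) p)]
    have h3 : ∑ a, (inner ℝ (pd i (pd j φ) p) (pd r (pd a φ) p) : ℝ) *
          inner ℝ (pd k (pd l φ) p) (pd r (pd a φ) p) =
        ∑ a, (inner ℝ (pd k (pd l φ) p) (pd r (pd a φ) p) : ℝ) *
          inner ℝ (pd i (pd j φ) p) (pd r (pd a φ) p) :=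
      Finset.sum_congr rfl fun a _ => mul_comm _ _
    simp only [← Finset.mul_sum, h3]
    ring

lemma jet_normSqA (h : GraphAt φ p) (r : Fin m) :
    Jet r r (coordNormSqA φ) p
      (∑ j, ∑ i, inner ℝ (pd i (pd j φ) p) (pd i (pd j φ) p))
      (∑ j, ∑ i, (inner ℝ (pd r (pd i (pd j φ)) p) (pd i (pd j φ) p) +
        inner ℝ (pd i (pd j φ) p) (pd r (pd i (pd j φ)) p)))
      (∑ j, ∑ i, (inner ℝ (pd r (pd i (pd j φ)) p) (pd i (pd j φ) p) +
        inner ℝ (pd i (pd j φ) p) (pd r (pd i (pd j φ)) p)))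
      (∑ j, (∑ i, (inner ℝ (pd r (pd r (pd i (pd j φ))) p) (pd i (pd j φ) p) +
        inner ℝ (pd i (pd j φ) p) (pd r (pd r (pd i (pd j φ))) p) +
        2 * inner ℝ (pd r (pd i (pd j φ)) p) (pd r (pd i (pd j φ)) p) -
        2 * ∑ a, inner ℝ (pd i (pd j φ) p) (pd r (pd a φ) p) *
          inner ℝ (pd i (pd j φ) p) (pd r (pd a φ) p)) +
        ∑ i, ∑ k, (-(inner ℝ (pd r (pd i φ) p) (pd r (pd k φ) p) +
          inner ℝ (pd r (pd i φ) p) (pd r (pd k φ) p))) •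
          inner ℝ (pd i (pd j φ) p) (pd k (pd j φ) p)) +
        ∑ j, ∑ l, (-(inner ℝ (pd r (pd j φ) p) (pd r (pd l φ) p) +
          inner ℝ (pd r (pd j φ) p) (pd r (pd l φ) p))) •
          ∑ i, inner ℝ (pd i (pd j φ) p) (pd i (pd l φ) p)) :=
  (Jet.contract (fun j l => h.jet_metricInv r r j l) fun j l =>
    Jet.contract (fun i k => h.jet_metricInv r r i k) fun i k =>
      h.jet_inner_SFF r i j k l).congr (Eventually.of_forall fun q => coordNormSqA_eq_sum_smul φ q)

lemma pd_pd_comm (h : GraphAt φ p) (i j : Fin m) : pd i (pd j φ) =ᶠ[𝓝 p] pd j (pd i φ) := by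
  filter_upwards [h.smooth] with q hq using pd_comm hq i j

lemma eventually_smooth_pd (h : GraphAt φ p) (i : Fin m) :
    ∀ᶠ q in 𝓝 p, ContDiffAt ℝ ∞ (pd i φ) q := by
  filter_upwards [h.smooth] with q hq using contDiffAt_pd i hq

lemma pd3_comm (h : GraphAt φ p) (r i : Fin m) :
    pd r (pd r (pd i φ)) =ᶠ[𝓝 p] pd i (pd r (pd r φ)) := by
  have h1 : pd r (pd r (pd i φ)) =ᶠ[𝓝 p] pd r (pd i (pd r φ)) :=
    eventuallyEq_pd r (h.pd_pd_comm r i)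
  refine h1.trans ?_
  filter_upwards [h.eventually_smooth_pd r] with q hq using pd_comm hq r i

lemma pd4_comm (h : GraphAt φ p) (r i j : Fin m) :
    pd r (pd r (pd i (pd j φ))) p = pd i (pd j (pd r (pd r φ))) p := by
  have h1 : pd r (pd i (pd j φ)) =ᶠ[𝓝 p] pd i (pd r (pd j φ)) := by
    filter_upwards [h.eventually_smooth_pd j] with q hq using pd_comm hq r i
  rw [pd_congr r h1, pd_comm (contDiffAt_pd r (contDiffAt_pd j h.smoothAt)) r i]
  exact pd_congr i (h.pd3_comm r j)

lemma ricci (h : GraphAt φ p) (hR : RicciFlatAt φ p) (i j : Fin m) (ξ ζ : E n) :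
    ∑ k, (inner ℝ (pd i (pd k φ) p) ξ : ℝ) * inner ℝ (pd j (pd k φ) p) ζ =
      ∑ k, (inner ℝ (pd j (pd k φ) p) ξ : ℝ) * inner ℝ (pd i (pd k φ) p) ζ := by
  have h1 := hR i j ξ ζ
  have hval : ∀ k l, metricInv φ p k l = if k = l then 1 else 0 := fun k l => by
    rw [metricInv, h.metric_eq_one, inv_one, Matrix.one_apply]
  simpa [hval, h.coordSFF_eq] using h1

/-- The mean curvature vector in graph coordinates. -/
lemma coordH_eq (h : GraphAt φ p) : coordH φ p = ∑ k, pd k (pd k φ) p := by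
  have hval : ∀ k l, metricInv φ p k l = if k = l then 1 else 0 := fun k l => by
    rw [metricInv, h.metric_eq_one, inv_one, Matrix.one_apply]
  simp [coordH, hval, h.coordSFF_eq]

lemma exists_jet_H (h : GraphAt φ p) (r s : Fin m) :
    ∃ x : Fin m → Fin m → ℝ, Jet r s (coordH φ) p (∑ k, pd k (pd k φ) p)
      (∑ k, (pd r (pd k (pd k φ)) p -
        ∑ a, (inner ℝ (pd k (pd k φ) p) (pd r (pd a φ) p) : ℝ) • pd a φ p))
      (∑ k, (pd s (pd k (pd k φ)) p -
        ∑ a, (inner ℝ (pd k (pd k φ) p) (pd s (pd a φ) p) : ℝ) • pd a φ p))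
      (∑ k, (pd s (pd r (pd k (pd k φ))) p - ∑ a, (x k a • pd a φ p +
        (inner ℝ (pd k (pd k φ) p) (pd r (pd a φ) p) : ℝ) • pd s (pd a φ) p +
        (inner ℝ (pd k (pd k φ) p) (pd s (pd a φ) p) : ℝ) • pd r (pd a φ) p)) +
        ∑ k, ∑ l, (-(inner ℝ (pd r (pd k φ) p) (pd s (pd l φ) p) +
          inner ℝ (pd s (pd k φ) p) (pd r (pd l φ) p) : ℝ)) • pd k (pd l φ) p) := by
  choose x hx using fun k l => h.jet_SFF r s k l
  exact ⟨fun k => x k k, Jet.contract (fun k l => h.jet_metricInv r s k l) fun k l => hx k l⟩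

lemma pd_H (h : GraphAt φ p) (r : Fin m) :
    pd r (coordH φ) p = ∑ k, pd r (pd k (pd k φ)) p -
      ∑ a, (inner ℝ (coordH φ p) (pd r (pd a φ) p) : ℝ) • pd a φ p := by
  obtain ⟨x, hx⟩ := h.exists_jet_H r r
  rw [hx.left, Finset.sum_sub_distrib, h.coordH_eq]
  congr 1
  rw [Finset.sum_comm]
  simp only [sum_inner, Finset.sum_smul]

/-- Pairing with a normal ν removes the unspecified tangential coefficients. The last double sum is
the second derivative of g⁻¹ in H = g^{kl}A_kl. -/
lemma inner_pd_pd_H (h : GraphAt φ p) (i j : Fin m) {ν : E n}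
    (hν : ∀ a, (inner ℝ (pd a φ p) ν : ℝ) = 0) :
    (inner ℝ (pd i (pd j (coordH φ)) p) ν : ℝ) =
      ∑ k, inner ℝ (pd i (pd j (pd k (pd k φ))) p) ν -
      ∑ a, (inner ℝ (coordH φ p) (pd j (pd a φ) p) * inner ℝ (pd i (pd a φ) p) ν +
        inner ℝ (coordH φ p) (pd i (pd a φ) p) * inner ℝ (pd j (pd a φ) p) ν) -
      ∑ k, ∑ l, (inner ℝ (pd j (pd k φ) p) (pd i (pd l φ) p) +
          inner ℝ (pd i (pd k φ) p) (pd j (pd l φ) p)) * inner ℝ (pd k (pd l φ) p) ν := by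
  obtain ⟨x, hx⟩ := h.exists_jet_H j i
  rw [hx.mixed, h.coordH_eq]
  simp only [inner_add_left, sum_inner, inner_sub_left, real_inner_smul_left, hν, mul_zero,
    zero_add, Finset.sum_sub_distrib, neg_mul, Finset.sum_neg_distrib]
  rw [← sub_eq_add_neg]
  congr 2
  rw [Finset.sum_comm]
  refine Finset.sum_congr rfl fun a _ => ?_
  rw [Finset.sum_add_distrib, Finset.sum_mul, Finset.sum_mul]

end GraphAt
end Graph

/-! ### Algebraic identities and inequalities for A -/

section Algebra

variable {ι F : Type*} [Fintype ι] [NormedAddCommGroup F] [InnerProductSpace ℝ F]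

/-- `K_{ik} = ∑_j ⟨b_{ij}, b_{kj}⟩`. -/
def sqForm (b : ι → ι → F) (i k : ι) : ℝ := ∑ j, inner ℝ (b i j) (b k j)

/-- The Ricci symmetry with ξ = b_il and ζ = b_ij exchanges j and l inside the sum over k. The
summand becomes ⟨b_lk,b_il⟩⟨b_jk,b_ij⟩, where l and j separate and each factor sums to K_ik. -/
lemma sum_inner_mul_inner_of_ricci {b : ι → ι → F} (hb : ∀ i j, b i j = b j i)
    (hR : ∀ i j ξ ζ, ∑ k, (inner ℝ (b i k) ξ : ℝ) * inner ℝ (b j k) ζ =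
      ∑ k, (inner ℝ (b j k) ξ : ℝ) * inner ℝ (b i k) ζ) :
    ∑ i, ∑ j, ∑ k, ∑ l, (inner ℝ (b j k) (b i l) : ℝ) * inner ℝ (b k l) (b i j) =
      ∑ i, ∑ k, sqForm b i k ^ 2 := by
  have h1 : ∀ i j l, ∑ k, (inner ℝ (b j k) (b i l) : ℝ) * inner ℝ (b k l) (b i j) =
      ∑ k, (inner ℝ (b l k) (b i l) : ℝ) * inner ℝ (b j k) (b i j) := by
    intro i j l
    rw [← hR j l]
    exact Finset.sum_congr rfl fun k _ => by rw [hb k l]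
  have h2 : ∀ i, ∑ j, ∑ k, ∑ l, (inner ℝ (b j k) (b i l) : ℝ) * inner ℝ (b k l) (b i j) =
      ∑ k, sqForm b i k ^ 2 := by
    intro i
    have h3 : ∀ j, ∑ k, ∑ l, (inner ℝ (b j k) (b i l) : ℝ) * inner ℝ (b k l) (b i j) =
        ∑ k, ∑ l, (inner ℝ (b l k) (b i l) : ℝ) * inner ℝ (b j k) (b i j) := fun j => by
      rw [Finset.sum_comm, Finset.sum_congr rfl fun l _ => h1 i j l, Finset.sum_comm]
    simp only [h3]
    rw [Finset.sum_comm]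
    refine Finset.sum_congr rfl fun k _ => ?_
    have h4 : ∑ l, (inner ℝ (b l k) (b i l) : ℝ) = sqForm b i k :=
      Finset.sum_congr rfl fun l _ => by rw [real_inner_comm, hb l k]
    simp only [← Finset.sum_mul, h4, ← Finset.mul_sum, sq]
  exact Finset.sum_congr rfl fun i _ => h2 i

lemma sum_inner_sq_le (b : ι → ι → F) :
    ∑ i, ∑ j, ∑ k, ∑ l, (inner ℝ (b i j) (b k l) : ℝ) ^ 2 ≤
      (∑ i, ∑ j, (inner ℝ (b i j) (b i j) : ℝ)) ^ 2 := by
  rw [sq, Finset.sum_mul_sum]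
  have h : ∀ i, ∑ k, (∑ j, (inner ℝ (b i j) (b i j) : ℝ)) * ∑ l, (inner ℝ (b k l) (b k l) : ℝ) =
      ∑ j, ∑ k, ∑ l, (inner ℝ (b i j) (b i j) : ℝ) * inner ℝ (b k l) (b k l) := by
    intro i
    simp only [Finset.sum_mul_sum]
    exact Finset.sum_comm
  simp only [h]
  refine Finset.sum_le_sum fun i _ => Finset.sum_le_sum fun j _ => Finset.sum_le_sum fun k _ =>
    Finset.sum_le_sum fun l _ => ?_
  rw [sq]
  exact real_inner_mul_inner_self_le _ _

/-- Cauchy–Schwarz for each r. With b = A and c = ∇A it is the Kato inequality. -/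
lemma sum_inner_sq_le_mul (b : ι → ι → F) (c : ι → ι → ι → F) :
    ∑ r, (∑ i, ∑ j, (inner ℝ (c r i j) (b i j) : ℝ)) ^ 2 ≤
      (∑ i, ∑ j, (inner ℝ (b i j) (b i j) : ℝ)) *
        ∑ r, ∑ i, ∑ j, (inner ℝ (c r i j) (c r i j) : ℝ) := by
  rw [Finset.mul_sum]
  refine Finset.sum_le_sum fun r _ => ?_
  simp only [← Fintype.sum_prod_type']
  have h1 : |∑ x : ι × ι, (inner ℝ (c r x.1 x.2) (b x.1 x.2) : ℝ)| ≤
      ∑ x : ι × ι, ‖c r x.1 x.2‖ * ‖b x.1 x.2‖ :=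
    (Finset.abs_sum_le_sum_abs _ _).trans
      (Finset.sum_le_sum fun x _ => abs_real_inner_le_norm _ _)
  calc (∑ x : ι × ι, (inner ℝ (c r x.1 x.2) (b x.1 x.2) : ℝ)) ^ 2
      ≤ (∑ x : ι × ι, ‖c r x.1 x.2‖ * ‖b x.1 x.2‖) ^ 2 := sq_le_sq.2 (h1.trans (le_abs_self _))
    _ ≤ (∑ x : ι × ι, ‖c r x.1 x.2‖ ^ 2) * ∑ x : ι × ι, ‖b x.1 x.2‖ ^ 2 :=
      Finset.sum_mul_sq_le_sq_mul_sq _ _ _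
    _ = _ := by
      simp only [real_inner_self_eq_norm_sq]
      ring

end Algebra

/-! ### The Laplacian of |A|² and the Hessian of H, contracted with A -/

section Graph

variable {m n : ℕ}

namespace GraphAt

variable {φ : E m → E n} {p : E m}

lemma symm_pd_pd (h : GraphAt φ p) (i j : Fin m) : pd i (pd j φ) p = pd j (pd i φ) p :=
  pd_comm h.smoothAt i j

lemma normSqA_eq (h : GraphAt φ p) : coordNormSqA φ p =
    ∑ i, ∑ j, (inner ℝ (pd i (pd j φ) p) (pd i (pd j φ) p) : ℝ) := by
  -- The jet needs a direction r; for m = 0 both sides are empty sums.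
  by_cases hm : Nonempty (Fin m)
  · obtain ⟨r⟩ := hm
    rw [(h.jet_normSqA r).val, Finset.sum_comm]
  · rw [not_nonempty_iff] at hm
    simp [coordNormSqA]

lemma pd_normSqA (h : GraphAt φ p) (r : Fin m) : pd r (coordNormSqA φ) p =
    2 * ∑ i, ∑ j, (inner ℝ (pd r (pd i (pd j φ)) p) (pd i (pd j φ) p) : ℝ) := by
  rw [(h.jet_normSqA r).left, Finset.sum_comm, Finset.mul_sum]
  refine Finset.sum_congr rfl fun i _ => ?_
  rw [Finset.mul_sum]
  refine Finset.sum_congr rfl fun j _ => ?_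
  rw [real_inner_comm (pd r (pd i (pd j φ)) p)]
  ring

lemma pd_pd_normSqA (h : GraphAt φ p) (r : Fin m) : pd r (pd r (coordNormSqA φ)) p =
    2 * (∑ i, ∑ j, inner ℝ (pd i (pd j (pd r (pd r φ))) p) (pd i (pd j φ) p)) +
    2 * (∑ i, ∑ j, inner ℝ (pd r (pd i (pd j φ)) p) (pd r (pd i (pd j φ)) p)) -
    2 * (∑ i, ∑ j, ∑ a, (inner ℝ (pd i (pd j φ) p) (pd r (pd a φ) p)) ^ 2) -
    4 * ∑ i, ∑ k, inner ℝ (pd i (pd r φ) p) (pd k (pd r φ) p) *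
      sqForm (fun i j => pd i (pd j φ) p) i k := by
  have hK : ∀ j l, ∑ i, (inner ℝ (pd i (pd j φ) p) (pd i (pd l φ) p) : ℝ) =
      sqForm (fun i j => pd i (pd j φ) p) j l := fun j l =>
    Finset.sum_congr rfl fun i _ => by rw [h.symm_pd_pd i j, h.symm_pd_pd i l]
  have hr : ∀ i, pd r (pd i φ) p = pd i (pd r φ) p := fun i => h.symm_pd_pd r i
  have h3 : ∑ j, ∑ i, ∑ k, (-(inner ℝ (pd r (pd i φ) p) (pd r (pd k φ) p) +
          inner ℝ (pd r (pd i φ) p) (pd r (pd k φ) p) : ℝ)) •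
          (inner ℝ (pd i (pd j φ) p) (pd k (pd j φ) p) : ℝ) =
      -(2 * ∑ i, ∑ k, inner ℝ (pd i (pd r φ) p) (pd k (pd r φ) p) *
      sqForm (fun i j => pd i (pd j φ) p) i k) := by
    rw [Finset.sum_comm, Finset.mul_sum, ← Finset.sum_neg_distrib]
    refine Finset.sum_congr rfl fun i _ => ?_
    rw [Finset.sum_comm, Finset.mul_sum, ← Finset.sum_neg_distrib]
    refine Finset.sum_congr rfl fun k _ => ?_
    rw [← Finset.smul_sum, hr, hr, smul_eq_mul]
    simp only [sqForm]
    ring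
  have h4 : ∑ j, ∑ l, (-(inner ℝ (pd r (pd j φ) p) (pd r (pd l φ) p) +
          inner ℝ (pd r (pd j φ) p) (pd r (pd l φ) p) : ℝ)) •
          ∑ i, (inner ℝ (pd i (pd j φ) p) (pd i (pd l φ) p) : ℝ) =
      -(2 * ∑ i, ∑ k, inner ℝ (pd i (pd r φ) p) (pd k (pd r φ) p) *
      sqForm (fun i j => pd i (pd j φ) p) i k) := by
    rw [Finset.mul_sum, ← Finset.sum_neg_distrib]
    refine Finset.sum_congr rfl fun i _ => ?_
    rw [Finset.mul_sum, ← Finset.sum_neg_distrib]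
    refine Finset.sum_congr rfl fun k _ => ?_
    rw [hK, hr, hr, smul_eq_mul]
    ring
  rw [(h.jet_normSqA r).mixed, Finset.sum_add_distrib, h3, h4, Finset.sum_comm]
  have h5 : ∑ i, ∑ j, ((inner ℝ (pd r (pd r (pd i (pd j φ))) p) (pd i (pd j φ) p) : ℝ) +
        inner ℝ (pd i (pd j φ) p) (pd r (pd r (pd i (pd j φ))) p) +
        2 * inner ℝ (pd r (pd i (pd j φ)) p) (pd r (pd i (pd j φ)) p) -
        2 * ∑ a, inner ℝ (pd i (pd j φ) p) (pd r (pd a φ) p) *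
          inner ℝ (pd i (pd j φ) p) (pd r (pd a φ) p)) =
      2 * (∑ i, ∑ j, inner ℝ (pd i (pd j (pd r (pd r φ))) p) (pd i (pd j φ) p)) +
      2 * (∑ i, ∑ j, inner ℝ (pd r (pd i (pd j φ)) p) (pd r (pd i (pd j φ)) p)) -
      2 * (∑ i, ∑ j, ∑ a, (inner ℝ (pd i (pd j φ) p) (pd r (pd a φ) p)) ^ 2) := by
    simp only [Finset.mul_sum, ← Finset.sum_add_distrib, ← Finset.sum_sub_distrib]
    refine Finset.sum_congr rfl fun i _ => Finset.sum_congr rfl fun j _ => ?_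
    rw [h.pd4_comm r i j, real_inner_comm _ (pd i (pd j φ) p)]
    simp only [← Finset.mul_sum, ← sq]
    ring
  rw [h5]
  ring

/-- Simons' identity before the Hessian of H is formed: the fourth derivatives of φ that remain are
exchanged for ∂_i∂_jH by `sum_inner_pd_pd_H`. -/
lemma laplace_normSqA (h : GraphAt φ p) : ∑ r, pd r (pd r (coordNormSqA φ)) p =
    2 * (∑ i, ∑ j, ∑ r, inner ℝ (pd i (pd j (pd r (pd r φ))) p) (pd i (pd j φ) p)) +
    2 * (∑ r, ∑ i, ∑ j, inner ℝ (pd r (pd i (pd j φ)) p) (pd r (pd i (pd j φ)) p)) -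
    2 * (∑ i, ∑ j, ∑ k, ∑ l, (inner ℝ (pd i (pd j φ) p) (pd k (pd l φ) p)) ^ 2) -
    4 * ∑ i, ∑ k, sqForm (fun i j => pd i (pd j φ) p) i k ^ 2 := by
  simp only [h.pd_pd_normSqA, Finset.sum_sub_distrib, Finset.sum_add_distrib, ← Finset.mul_sum]
  have hc : ∀ f : Fin m → Fin m → Fin m → ℝ, ∑ r, ∑ i, ∑ j, f r i j = ∑ i, ∑ j, ∑ r, f r i j :=
    fun f => by
      rw [Finset.sum_comm]
      exact Finset.sum_congr rfl fun i _ => Finset.sum_comm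
  congr 1
  · congr 1
    · congr 1
      rw [hc]
    · congr 1
      rw [hc]
  · congr 1
    rw [hc]
    refine Finset.sum_congr rfl fun i _ => Finset.sum_congr rfl fun k _ => ?_
    rw [← Finset.sum_mul, sq]
    rfl

/-- The contraction of the Hessian of the mean curvature vector with the second fundamental
form. -/
lemma sum_inner_pd_pd_H (h : GraphAt φ p) :
    ∑ i, ∑ j, (inner ℝ (pd i (pd j (coordH φ)) p) (pd i (pd j φ) p) : ℝ) =
      ∑ i, ∑ j, ∑ r, inner ℝ (pd i (pd j (pd r (pd r φ))) p) (pd i (pd j φ) p) -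
      2 * (∑ i, ∑ k, inner ℝ (coordH φ p) (pd i (pd k φ) p) *
        sqForm (fun i j => pd i (pd j φ) p) i k) -
      2 * ∑ i, ∑ j, ∑ k, ∑ l, (inner ℝ (pd j (pd k φ) p) (pd i (pd l φ) p) : ℝ) *
        inner ℝ (pd k (pd l φ) p) (pd i (pd j φ) p) := by
  have h1 : ∀ i j, (inner ℝ (pd i (pd j (coordH φ)) p) (pd i (pd j φ) p) : ℝ) = _ := fun i j =>
    h.inner_pd_pd_H i j fun a => h.inner_pd_pd' i j a
  simp only [h1, Finset.sum_sub_distrib, add_mul, Finset.sum_add_distrib]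
  have e1 : ∑ i, ∑ j, ∑ a, (inner ℝ (coordH φ p) (pd j (pd a φ) p) : ℝ) *
      inner ℝ (pd i (pd a φ) p) (pd i (pd j φ) p) = ∑ i, ∑ k,
        inner ℝ (coordH φ p) (pd i (pd k φ) p) * sqForm (fun i j => pd i (pd j φ) p) i k := by
    rw [Finset.sum_comm]
    refine Finset.sum_congr rfl fun j _ => ?_
    rw [Finset.sum_comm]
    refine Finset.sum_congr rfl fun a _ => ?_
    rw [← Finset.mul_sum]
    congr 1
    refine Finset.sum_congr rfl fun i _ => ?_
    rw [real_inner_comm, h.symm_pd_pd i j, h.symm_pd_pd i a]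
  have e2 : ∑ i, ∑ j, ∑ a, (inner ℝ (coordH φ p) (pd i (pd a φ) p) : ℝ) *
      inner ℝ (pd j (pd a φ) p) (pd i (pd j φ) p) = ∑ i, ∑ k,
        inner ℝ (coordH φ p) (pd i (pd k φ) p) * sqForm (fun i j => pd i (pd j φ) p) i k := by
    refine Finset.sum_congr rfl fun i _ => ?_
    rw [Finset.sum_comm]
    refine Finset.sum_congr rfl fun a _ => ?_
    rw [← Finset.mul_sum]
    congr 1
    refine Finset.sum_congr rfl fun j _ => ?_
    rw [real_inner_comm, h.symm_pd_pd j a]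
  have e3 : ∑ i, ∑ j, ∑ k, ∑ l, (inner ℝ (pd i (pd k φ) p) (pd j (pd l φ) p) : ℝ) *
      inner ℝ (pd k (pd l φ) p) (pd i (pd j φ) p) =
      ∑ i, ∑ j, ∑ k, ∑ l, (inner ℝ (pd j (pd k φ) p) (pd i (pd l φ) p) : ℝ) *
        inner ℝ (pd k (pd l φ) p) (pd i (pd j φ) p) := by
    rw [Finset.sum_comm]
    refine Finset.sum_congr rfl fun i _ => Finset.sum_congr rfl fun j _ =>
      Finset.sum_congr rfl fun k _ => Finset.sum_congr rfl fun l _ => ?_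
    rw [h.symm_pd_pd i j]
  rw [e1, e2, e3]
  ring

end GraphAt
end Graph

/-! ### Time derivatives in graph coordinates and the evolution of |A|² -/

section Graph

variable {m n : ℕ} {V : Type*} [NormedAddCommGroup V] [NormedSpace ℝ V]

lemma hasDerivWithinAt_contract {S : Set ℝ} {t : ℝ} {h : Fin m → Fin m → ℝ → ℝ}
    {h' : Fin m → Fin m → ℝ} {B : Fin m → Fin m → ℝ → V} {B' : Fin m → Fin m → V}
    (h0 : ∀ i j, h i j t = if i = j then 1 else 0)
    (hh : ∀ i j, HasDerivWithinAt (h i j) (h' i j) S t)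
    (hB : ∀ i j, HasDerivWithinAt (B i j) (B' i j) S t) :
    HasDerivWithinAt (fun s => ∑ i, ∑ j, h i j s • B i j s)
      (∑ i, B' i i + ∑ i, ∑ j, h' i j • B i j t) S t := by
  have h1 := HasDerivWithinAt.fun_sum (u := Finset.univ) fun i _ =>
    HasDerivWithinAt.fun_sum (u := Finset.univ) fun j _ => (hh i j).fun_smul (hB i j)
  simpa [h0, ite_smul, Finset.sum_add_distrib] using h1

/-- A local solution which at time `t` is, near `p`, a graph over the tangent space at `p`, in
orthonormal coordinates of that space, with flat normal bundle at `p`. -/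
structure GraphSolution (U : Set (E m)) (T : ℝ) (Φ : E m → ℝ → E n) (p : E m) (t : ℝ) : Prop
    extends LocalSolution U T Φ where
  mem : p ∈ U
  time : t ∈ Ico 0 T
  graphAt : GraphAt (fun y => Φ y t) p
  ricci : RicciFlatAt (fun y => Φ y t) p

namespace GraphSolution

variable {U : Set (E m)} {T : ℝ} {Φ : E m → ℝ → E n} {p : E m} {t : ℝ}

lemma inner_pd_H (h : GraphSolution U T Φ p t) (i j : Fin m) :
    (inner ℝ (pd i (coordH fun y => Φ y t) p) (pd j (fun y => Φ y t) p) : ℝ) =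
      -inner ℝ (coordH (fun y => Φ y t) p) (pd i (pd j fun y => Φ y t) p) := by
  rw [h.graphAt.pd_H]
  simp [inner_sub_left, sum_inner, real_inner_smul_left, h.graphAt.inner_pd3,
    h.graphAt.inner_pd]

lemma hasDeriv_metric (h : GraphSolution U T Φ p t) (i j : Fin m) :
    HasDerivWithinAt (fun s => metric (fun y => Φ y s) p i j)
      (-2 * inner ℝ (coordH (fun y => Φ y t) p) (pd i (pd j fun y => Φ y t) p)) (Ico 0 T) t := by
  have h1 := (h.hasDerivWithinAt_pd h.mem h.time i).inner ℝ (h.hasDerivWithinAt_pd h.mem h.time j)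
  refine h1.congr_deriv ?_
  rw [h.inner_pd_H, real_inner_comm, h.inner_pd_H, h.graphAt.symm_pd_pd j i]
  ring

lemma metricInv_apply (h : GraphSolution U T Φ p t) (i j : Fin m) :
    metricInv (fun y => Φ y t) p i j = if i = j then 1 else 0 := by
  rw [metricInv, h.graphAt.metric_eq_one, inv_one, Matrix.one_apply]

lemma hasDeriv_metricInv (h : GraphSolution U T Φ p t) (i j : Fin m) :
    HasDerivWithinAt (fun s => metricInv (fun y => Φ y s) p i j)
      (2 * inner ℝ (coordH (fun y => Φ y t) p) (pd i (pd j fun y => Φ y t) p)) (Ico 0 T) t := by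
  have hJ := fun k => (h.smooth_metricInv i k).hasDerivWithinAt h.mem h.time
  have h1 := HasDerivWithinAt.fun_sum (u := Finset.univ) fun k _ =>
    (hJ k).fun_mul (h.hasDeriv_metric k j)
  have h2 : HasDerivWithinAt (fun s => ∑ k, metricInv (fun y => Φ y s) p i k *
      metric (fun y => Φ y s) p k j) 0 (Ico 0 T) t :=
    (hasDerivWithinAt_const t (Ico 0 T) (if i = j then (1 : ℝ) else 0)).congr
      (fun s hs => sum_metricInv_mul_metric (h.immersion p h.mem s hs).ne' i j)
      (sum_metricInv_mul_metric (h.immersion p h.mem t h.time).ne' i j)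
  have h3 := (uniqueDiffOn_Ico 0 T t h.time).eq_deriv _ h1 h2
  simp [h.metricInv_apply, h.graphAt.metric_eq_one, Matrix.one_apply, Finset.sum_add_distrib] at h3
  have h4 := hJ j
  rwa [show derivWithin (fun s => metricInv (fun y => Φ y s) p i j) (Ico 0 T) t =
    2 * inner ℝ (coordH (fun y => Φ y t) p) (pd i (pd j fun y => Φ y t) p) by linarith] at h4

lemma christoffel_apply (h : GraphSolution U T Φ p t) (k i j : Fin m) :
    christoffel (fun y => Φ y t) k i j p = 0 :=
  (h.graphAt.jet_christoffel k k k i j).choose_spec.val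

/-- Since Γ = 0 at (p,t), the time derivative of the Christoffel term is ∂_tΓ times tangent vectors;
the values x are irrelevant because |A|² pairs them with normal vectors. -/
lemma exists_hasDeriv_SFF (h : GraphSolution U T Φ p t) (i j : Fin m) :
    ∃ x : Fin m → ℝ, HasDerivWithinAt (fun s => coordSFF (fun y => Φ y s) i j p)
      (pd i (pd j (coordH fun y => Φ y t)) p - ∑ k, x k • pd k (fun y => Φ y t) p)
      (Ico 0 T) t := by
  have h1 := (h.hasDerivWithinAt_pd_pd h.mem h.time i j).fun_sub <|
    HasDerivWithinAt.fun_sum (u := Finset.univ) fun k _ =>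
      ((h.smooth_christoffel k i j).hasDerivWithinAt h.mem h.time).fun_smul
        (h.hasDerivWithinAt_pd h.mem h.time k)
  simp only [h.christoffel_apply, zero_smul, zero_add] at h1
  exact ⟨_, h1⟩

lemma hasDeriv_normSqA (h : GraphSolution U T Φ p t) :
    HasDerivWithinAt (fun s => coordNormSqA (fun y => Φ y s) p)
      (2 * (∑ i, ∑ j, inner ℝ (pd i (pd j (coordH fun y => Φ y t)) p)
          (pd i (pd j fun y => Φ y t) p)) +
        4 * ∑ i, ∑ k, inner ℝ (coordH (fun y => Φ y t) p) (pd i (pd k fun y => Φ y t) p) *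
          sqForm (fun i j => pd i (pd j fun y => Φ y t) p) i k) (Ico 0 T) t := by
  choose x hx using h.exists_hasDeriv_SFF
  have hS : ∀ i j k l, HasDerivWithinAt (fun s => (inner ℝ (coordSFF (fun y => Φ y s) i j p)
      (coordSFF (fun y => Φ y s) k l p) : ℝ))
      (inner ℝ (pd i (pd j fun y => Φ y t) p) (pd k (pd l (coordH fun y => Φ y t)) p) +
        inner ℝ (pd i (pd j (coordH fun y => Φ y t)) p) (pd k (pd l fun y => Φ y t) p))
      (Ico 0 T) t := by
    intro i j k l
    have h1 := (hx i j).inner ℝ (hx k l)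
    simpa [h.graphAt.coordSFF_eq, inner_sub_left, inner_sub_right, sum_inner, inner_sum,
      real_inner_smul_left, real_inner_smul_right, h.graphAt.inner_pd_pd,
      h.graphAt.inner_pd_pd'] using h1
  have h2 := hasDerivWithinAt_contract h.metricInv_apply h.hasDeriv_metricInv fun j l =>
    hasDerivWithinAt_contract h.metricInv_apply h.hasDeriv_metricInv fun i k => hS i j k l
  have h3 : (fun s => coordNormSqA (fun y => Φ y s) p) = _ :=
    funext fun s => coordNormSqA_eq_sum_smul (fun y => Φ y s) p
  rw [h3]
  refine h2.congr_deriv ?_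
  have hsw : ∀ i j, pd i (pd j fun y => Φ y t) p = pd j (pd i fun y => Φ y t) p :=
    fun i j => h.graphAt.symm_pd_pd i j
  simp only [h.metricInv_apply, ite_mul, one_mul, zero_mul, Finset.sum_ite_eq, Finset.mem_univ,
    if_true, h.graphAt.coordSFF_eq, smul_eq_mul, Finset.sum_add_distrib]
  have e1 : ∑ j, ∑ i, (inner ℝ (pd i (pd j (coordH fun y => Φ y t)) p)
      (pd i (pd j fun y => Φ y t) p) : ℝ) = ∑ i, ∑ j,
      inner ℝ (pd i (pd j (coordH fun y => Φ y t)) p) (pd i (pd j fun y => Φ y t) p) :=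
    Finset.sum_comm
  have e2 : ∑ j, ∑ i, (inner ℝ (pd i (pd j fun y => Φ y t) p)
      (pd i (pd j (coordH fun y => Φ y t)) p) : ℝ) = ∑ i, ∑ j,
      inner ℝ (pd i (pd j (coordH fun y => Φ y t)) p) (pd i (pd j fun y => Φ y t) p) := by
    rw [Finset.sum_comm]
    exact Finset.sum_congr rfl fun i _ => Finset.sum_congr rfl fun j _ => real_inner_comm _ _
  have e3 : ∑ j, ∑ i, ∑ k, 2 * (inner ℝ (coordH (fun y => Φ y t) p)
      (pd i (pd k fun y => Φ y t) p) : ℝ) * inner ℝ (pd i (pd j fun y => Φ y t) p)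
        (pd k (pd j fun y => Φ y t) p) =
      2 * ∑ i, ∑ k, inner ℝ (coordH (fun y => Φ y t) p) (pd i (pd k fun y => Φ y t) p) *
          sqForm (fun i j => pd i (pd j fun y => Φ y t) p) i k := by
    rw [Finset.sum_comm, Finset.mul_sum]
    refine Finset.sum_congr rfl fun i _ => ?_
    rw [Finset.sum_comm, Finset.mul_sum]
    refine Finset.sum_congr rfl fun k _ => ?_
    rw [← Finset.mul_sum, mul_assoc]
    rfl
  have e4 : ∑ j, ∑ l, 2 * (inner ℝ (coordH (fun y => Φ y t) p)
      (pd j (pd l fun y => Φ y t) p) : ℝ) * ∑ i, inner ℝ (pd i (pd j fun y => Φ y t) p)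
        (pd i (pd l fun y => Φ y t) p) =
      2 * ∑ i, ∑ k, inner ℝ (coordH (fun y => Φ y t) p) (pd i (pd k fun y => Φ y t) p) *
          sqForm (fun i j => pd i (pd j fun y => Φ y t) p) i k := by
    rw [Finset.mul_sum]
    refine Finset.sum_congr rfl fun i _ => ?_
    rw [Finset.mul_sum]
    refine Finset.sum_congr rfl fun k _ => ?_
    rw [mul_assoc]
    congr 2
    exact Finset.sum_congr rfl fun a _ => by rw [hsw a i, hsw a k]
  rw [e1, e2, e3, e4]
  ring

/-- The square of the norm of the covariant derivative of the second fundamental form, in graph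
coordinates. -/
def gradSqA (φ : E m → E n) (p : E m) : ℝ :=
  ∑ r, ∑ i, ∑ j, inner ℝ (pd r (pd i (pd j φ)) p) (pd r (pd i (pd j φ)) p)

/-- The evolution inequality of `|A|²`. -/
lemma evolution_normSqA (h : GraphSolution U T Φ p t) :
    ∃ u' : ℝ, HasDerivWithinAt (fun s => coordNormSqA (fun y => Φ y s) p) u' (Ico 0 T) t ∧
      u' - ∑ r, pd r (pd r (coordNormSqA fun y => Φ y t)) p ≤
        -2 * gradSqA (fun y => Φ y t) p + 2 * coordNormSqA (fun y => Φ y t) p ^ 2 := by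
  refine ⟨_, h.hasDeriv_normSqA, ?_⟩
  -- The terms ⟨H,A_ik⟩K_ik from ∂_t g⁻¹ cancel those in the Hessian of H. By Ricci the remaining
  -- cubic sum is ΣK_ik², which cancels -4ΣK_ik² in the Laplacian. Only 2Σ⟨A_ij,A_kl⟩² - 2|∇A|² is
  -- left.
  rw [h.graphAt.laplace_normSqA, h.graphAt.sum_inner_pd_pd_H, gradSqA, h.graphAt.normSqA_eq,
    sum_inner_mul_inner_of_ricci (b := fun i j => pd i (pd j fun y => Φ y t) p)
      (fun i j => h.graphAt.symm_pd_pd i j) (h.graphAt.ricci h.ricci)]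
  have := sum_inner_sq_le fun i j => pd i (pd j fun y => Φ y t) p
  linarith

lemma sum_pd_normSqA_sq_le (h : GraphSolution U T Φ p t) :
    ∑ r, pd r (coordNormSqA fun y => Φ y t) p ^ 2 ≤
      4 * coordNormSqA (fun y => Φ y t) p * gradSqA (fun y => Φ y t) p := by
  have := sum_inner_sq_le_mul (fun i j => pd i (pd j fun y => Φ y t) p)
    fun r i j => pd r (pd i (pd j fun y => Φ y t)) p
  simp only [h.graphAt.pd_normSqA, mul_pow, ← Finset.mul_sum]
  rw [gradSqA, h.graphAt.normSqA_eq]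
  linarith

end GraphSolution
end Graph

/-! ### Determinants and alternating forms -/

section Form

variable {m n : ℕ} {V : Type*} [NormedAddCommGroup V] [NormedSpace ℝ V]

lemma pd_pi {ι : Type*} [Fintype ι] {f : ι → E m → ℝ} {p : E m} (r : Fin m)
    (hf : ∀ j, DifferentiableAt ℝ (f j) p) :
    pd r (fun q j => f j q) p = fun j => pd r (f j) p := by
  have := (hasFDerivAt_pi.2 fun j => (hf j).hasFDerivAt).fderiv
  ext j
  simp [pd, this]

lemma Jet.pi {ι : Type*} [Fintype ι] {f : ι → E m → ℝ} {p : E m} {r s : Fin m}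
    {f₀ fr fs frs : ι → ℝ} (hf : ∀ j, Jet r s (f j) p (f₀ j) (fr j) (fs j) (frs j)) :
    Jet r s (fun q j => f j q) p f₀ fr fs frs := by
  have hs : ∀ j, ContDiffAt ℝ ∞ (f j) p := fun j => (hf j).smooth
  refine ⟨contDiffAt_pi.2 hs, funext fun j => (hf j).val, ?_, ?_, ?_⟩
  · rw [pd_pi r fun j => differentiableAt_of_smooth (hs j)]
    exact funext fun j => (hf j).left
  · rw [pd_pi s fun j => differentiableAt_of_smooth (hs j)]
    exact funext fun j => (hf j).right
  · have h1 : pd r (fun q j => f j q) =ᶠ[𝓝 p] fun q j => pd r (f j) q := by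
      filter_upwards [eventually_all.2 fun j => eventually_differentiableAt (hs j)] with q hq
        using pd_pi r hq
    rw [pd_congr s h1, pd_pi s fun j => differentiableAt_of_smooth (contDiffAt_pd r (hs j))]
    exact funext fun j => (hf j).mixed

/-- The determinant, as a continuous multilinear function of the rows. -/
def detForm (m : ℕ) : ContinuousMultilinearMap ℝ (fun _ : Fin m => Fin m → ℝ) ℝ :=
  { (Matrix.detRowAlternating (R := ℝ) (n := Fin m)).toMultilinearMap with
    cont := by
      change Continuous fun a : Matrix (Fin m) (Fin m) ℝ => a.det
      fun_prop }

lemma detForm_apply (a : Matrix (Fin m) (Fin m) ℝ) : detForm m (fun i => a i) = a.det := rfl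

lemma detForm_update_one (i : Fin m) (v : Fin m → ℝ) :
    detForm m (Function.update (fun i j => if i = j then 1 else 0) i v) = v i := by
  have h1 : (Matrix.updateRow (1 : Matrix (Fin m) (Fin m) ℝ) i v).det = v i := by
    rw [← Matrix.cramer_transpose_apply, Matrix.transpose_one, Matrix.cramer_one]
    rfl
  rw [← h1, Matrix.updateRow, ← detForm_apply]
  congr 1

/-- In the multilinear rule, terms with two differentiated rows vanish with the first derivatives; a
single replaced row of the identity contributes its diagonal entry. -/
lemma jet_det {G : E m → Matrix (Fin m) (Fin m) ℝ} {p : E m} {r s : Fin m}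
    {G2 : Fin m → Fin m → ℝ}
    (hG : ∀ i j, Jet r s (fun q => G q i j) p (if i = j then 1 else 0) 0 0 (G2 i j)) :
    Jet r s (fun q => (G q).det) p 1 0 0 (∑ i, G2 i i) := by
  have h1 := Jet.multilinear (detForm m) fun i => Jet.pi fun j => hG i j
  have hz : ∀ (a : Fin m → Fin m → ℝ) i, detForm m (Function.update a i (fun _ => 0)) = 0 :=
    fun a i => (detForm m).map_update_zero a i
  simp only [hz, detForm_update_one, Finset.sum_const_zero, add_zero] at h1
  have h0 : detForm m (fun i j => if i = j then 1 else 0) = 1 := by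
    have h2 : (fun i j => if i = j then (1 : ℝ) else 0) = (1 : Matrix (Fin m) (Fin m) ℝ) := by
      ext i j
      rw [Matrix.one_apply]
    rw [h2]
    exact Matrix.det_one
  rw [h0] at h1
  exact h1

/-- Expand β in a basis: the hypothesis says that the tensors Σ x_k ⊗ y_k and Σ y_k ⊗ x_k coincide.
-/
lemma sum_bilin_comm {ι : Type*} [Fintype ι] (β : E n →ₗ[ℝ] E n →ₗ[ℝ] ℝ) {x y : ι → E n}
    (h : ∀ ξ ζ : E n, ∑ k, (inner ℝ (x k) ξ : ℝ) * inner ℝ (y k) ζ =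
      ∑ k, (inner ℝ (y k) ξ : ℝ) * inner ℝ (x k) ζ) :
    ∑ k, β (x k) (y k) = ∑ k, β (y k) (x k) := by
  set ε := EuclideanSpace.basisFun (Fin n) ℝ
  have hx : ∀ z z' : E n, β z z' =
      ∑ a, ∑ b, (inner ℝ z (ε a) * inner ℝ z' (ε b)) * β (ε a) (ε b) := by
    intro z z'
    conv_lhs => rw [← ε.sum_repr' z, ← ε.sum_repr' z']
    simp only [map_sum, LinearMap.sum_apply, map_smul, LinearMap.smul_apply, smul_eq_mul,
      Finset.mul_sum, real_inner_comm _ (ε _)]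
    rw [Finset.sum_comm]
    refine Finset.sum_congr rfl fun a _ => Finset.sum_congr rfl fun b _ => ?_
    ring
  have hsum : ∀ u v : ι → E n, ∑ k, β (u k) (v k) =
      ∑ a, ∑ b, (∑ k, inner ℝ (u k) (ε a) * inner ℝ (v k) (ε b)) * β (ε a) (ε b) := by
    intro u v
    simp only [hx (u _) (v _), Finset.sum_mul]
    rw [Finset.sum_comm]
    exact Finset.sum_congr rfl fun a _ => Finset.sum_comm
  rw [hsum, hsum]
  simp only [h]

/-- The sum is symmetric under x ↔ y by `sum_bilin_comm` and antisymmetric because Ω alternates.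
This is how flatness enters the equation for w. -/
lemma sum_form_update_update_eq_zero {ι : Type*} [Fintype ι] (Ω : E n [⋀^Fin m]→ₗ[ℝ] ℝ)
    (a : Fin m → E n) {i j : Fin m} (hij : i ≠ j) {x y : ι → E n}
    (h : ∀ ξ ζ : E n, ∑ k, (inner ℝ (x k) ξ : ℝ) * inner ℝ (y k) ζ =
      ∑ k, (inner ℝ (y k) ξ : ℝ) * inner ℝ (x k) ζ) :
    ∑ k, Ω (Function.update (Function.update a i (x k)) j (y k)) = 0 := by
  have hu : ∀ z z', Function.update (Function.update a i z) j z' =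
      Function.update (Function.update a j z') i z := fun z z' => Function.update_comm hij _ _ _
  let β : E n →ₗ[ℝ] E n →ₗ[ℝ] ℝ := LinearMap.mk₂ ℝ
    (fun z z' => Ω (Function.update (Function.update a i z) j z'))
    (fun z₁ z₂ z' => by simp only [hu, AlternatingMap.map_update_add])
    (fun c z z' => by simp only [hu, AlternatingMap.map_update_smul])
    (fun z z₁ z₂ => by simp only [AlternatingMap.map_update_add])
    (fun c z z' => by simp only [AlternatingMap.map_update_smul])
  have h1 := sum_bilin_comm β h
  have h2 : ∀ z z', β z' z = -β z z' := by
    intro z z'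
    have := Ω.map_swap (Function.update (Function.update a i z) j z') hij
    have h3 : (Function.update (Function.update a i z) j z') ∘ Equiv.swap i j =
        Function.update (Function.update a i z') j z := by
      ext k
      by_cases hki : k = i
      · subst hki; simp [hij]
      · by_cases hkj : k = j
        · subst hkj; simp [hij]
        · simp [Equiv.swap_apply_of_ne_of_ne hki hkj, hki, hkj]
    rw [h3] at this
    exact this
  have h4 : ∑ k, β (y k) (x k) = -∑ k, β (x k) (y k) := by
    rw [← Finset.sum_neg_distrib]
    exact Finset.sum_congr rfl fun k _ => h2 _ _
  have h5 : ∑ k, β (x k) (y k) = 0 := by linarith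
  exact h5

end Form

/-! ### Evolution of w and of |F|² -/

section Graph

variable {m n : ℕ}

namespace GraphAt

variable {φ : E m → E n} {p : E m}

/-- The derivatives are solved from √det g · √det g = det g. -/
lemma jet_sqrt_det (h : GraphAt φ p) (r : Fin m) :
    Jet r r (fun q => Real.sqrt (metric φ q).det) p 1 0 0
      (∑ i, inner ℝ (pd r (pd i φ) p) (pd r (pd i φ) p)) := by
  have hdet := jet_det fun i j => h.jet_metric r r i j
  have hs : ContDiffAt ℝ ∞ (fun q => Real.sqrt (metric φ q).det) p :=
    hdet.smooth.sqrt (by rw [h.det_metric]; exact one_ne_zero)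
  have h1 := Jet.of_smooth hs r r
  have h2 := h1.mul h1
  have h3 := hdet.congr (g := fun q => Real.sqrt (metric φ q).det * Real.sqrt (metric φ q).det) (by
    have : ∀ᶠ q in 𝓝 p, 0 < (metric φ q).det :=
      hdet.smooth.continuousAt.eventually_const_lt (by simp [h.det_metric])
    filter_upwards [this] with q hq using Real.mul_self_sqrt hq.le)
  have hl := h2.left.symm.trans h3.left
  have hm := h2.mixed.symm.trans h3.mixed
  simp only [h.det_metric, Real.sqrt_one, one_mul, mul_one] at hl hm
  have hl' : pd r (fun q => Real.sqrt (metric φ q).det) p = 0 := by linarith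
  refine ⟨hs, by rw [h.det_metric, Real.sqrt_one], hl', hl', ?_⟩
  rw [hl', Finset.sum_add_distrib] at hm
  linarith

lemma coordW_eq (h : GraphAt φ p) (Ω : E n [⋀^Fin m]→ₗ[ℝ] ℝ) :
    coordW Ω φ p = Ω fun i => pd i φ p := by
  rw [coordW, h.det_metric, Real.sqrt_one, div_one]

/-- Differentiate w √det g = Ω(∂_1φ, …, ∂_mφ) twice. The second derivative of √det g yields -|A|²w,
and flatness removes the terms with two differentiated slots. -/
lemma laplace_W (h : GraphAt φ p) (hR : RicciFlatAt φ p) (Ω : E n [⋀^Fin m]→ₗ[ℝ] ℝ) :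
    ContDiffAt ℝ ∞ (coordW Ω φ) p ∧ ∑ r, pd r (pd r (coordW Ω φ)) p =
      ∑ i, ∑ r, Ω (Function.update (fun j => pd j φ p) i (pd i (pd r (pd r φ)) p)) -
        coordNormSqA φ p * coordW Ω φ p := by
  have hs : ContDiffAt ℝ ∞ (coordW Ω φ) p := by
    refine (contDiffAt_multilinear (contForm Ω) fun i => contDiffAt_pd i h.smoothAt).div
      ((contDiffAt_metric_det h.smoothAt).sqrt ?_) ?_
    · rw [h.det_metric]; exact one_ne_zero
    · rw [h.det_metric, Real.sqrt_one]; exact one_ne_zero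
  refine ⟨hs, ?_⟩
  have h1 : ∀ r, pd r (pd r (coordW Ω φ)) p =
      ∑ i, Ω (Function.update (fun j => pd j φ p) i (pd i (pd r (pd r φ)) p)) +
      ∑ i, ∑ j ∈ Finset.univ.erase i, Ω (Function.update (Function.update (fun j => pd j φ p) i
        (pd i (pd r φ) p)) j (pd j (pd r φ) p)) -
      coordW Ω φ p * ∑ i, inner ℝ (pd r (pd i φ) p) (pd r (pd i φ) p) := by
    intro r
    have hj := (Jet.of_smooth hs r r).mul (h.jet_sqrt_det r)
    have hW := (Jet.multilinear (contForm Ω) fun i =>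
      Jet.of_smooth (contDiffAt_pd i h.smoothAt) r r).congr
      (g := fun q => coordW Ω φ q * Real.sqrt (metric φ q).det) (by
        have : ∀ᶠ q in 𝓝 p, 0 < (metric φ q).det :=
          (contDiffAt_metric_det h.smoothAt).continuousAt.eventually_const_lt
            (by simp [h.det_metric])
        filter_upwards [this] with q hq
        exact div_mul_cancel₀ _ (Real.sqrt_pos.2 hq).ne')
    have hm := hj.mixed.symm.trans hW.mixed
    simp only [mul_one, mul_zero, add_zero, Finset.sum_add_distrib, contForm_apply,
      (h.pd3_comm r _).eq_of_nhds, h.symm_pd_pd r _] at hm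
    simp only [h.symm_pd_pd r _]
    linarith
  have h2 : ∑ r, ∑ i, ∑ j ∈ Finset.univ.erase i,
      Ω (Function.update (Function.update (fun j => pd j φ p) i
        (pd i (pd r φ) p)) j (pd j (pd r φ) p)) = 0 := by
    rw [Finset.sum_comm]
    refine Finset.sum_eq_zero fun i _ => ?_
    rw [Finset.sum_comm]
    refine Finset.sum_eq_zero fun j hj => ?_
    exact sum_form_update_update_eq_zero Ω _ (Finset.ne_of_mem_erase hj).symm (h.ricci hR i j)
  simp only [h1, Finset.sum_sub_distrib, Finset.sum_add_distrib, h2, add_zero, ← Finset.mul_sum,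
    h.normSqA_eq]
  rw [Finset.sum_comm, mul_comm (coordW Ω φ p)]

/-- The tangent frame at p consists of unit vectors. The resulting upper bound on w, uniform in
space and time, is used in the localized estimate. -/
lemma abs_W_le (h : GraphAt φ p) (Ω : E n [⋀^Fin m]→ₗ[ℝ] ℝ) :
    |coordW Ω φ p| ≤ ‖contForm Ω‖ := by
  rw [h.coordW_eq, ← contForm_apply, ← Real.norm_eq_abs]
  have h1 : ∀ i, ‖pd i φ p‖ = 1 := fun i => by
    have := h.inner_pd i i
    rw [if_pos rfl, real_inner_self_eq_norm_sq] at this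
    exact (pow_eq_one_iff_of_nonneg (norm_nonneg _) two_ne_zero).1 this
  refine ((contForm Ω).le_opNorm _).trans ?_
  simp [h1]

lemma jet_normSq (h : GraphAt φ p) (r : Fin m) :
    Jet r r (fun q => (inner ℝ (φ q) (φ q) : ℝ)) p (inner ℝ (φ p) (φ p))
      (2 * inner ℝ (pd r φ p) (φ p)) (2 * inner ℝ (pd r φ p) (φ p))
      (2 + 2 * inner ℝ (pd r (pd r φ) p) (φ p)) := by
  have hj := (Jet.of_smooth h.smoothAt r r)
  convert hj.inner hj using 1
  · rw [real_inner_comm (pd r φ p)]; ring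
  · rw [real_inner_comm (pd r φ p)]; ring
  · rw [h.inner_pd, if_pos rfl, real_inner_comm (pd r (pd r φ) p)]; ring

lemma laplace_normSq (h : GraphAt φ p) :
    ∑ r, pd r (pd r fun q => (inner ℝ (φ q) (φ q) : ℝ)) p =
      2 * m + 2 * inner ℝ (coordH φ p) (φ p) := by
  simp only [(h.jet_normSq _).mixed, Finset.sum_add_distrib, h.coordH_eq, sum_inner,
    ← Finset.mul_sum]
  simp [mul_comm]

/-- Bessel's inequality: ∂_r|φ|² is twice the component of φ along an orthonormal frame. -/
lemma sum_pd_normSq_sq_le (h : GraphAt φ p) :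
    ∑ r, pd r (fun q => (inner ℝ (φ q) (φ q) : ℝ)) p ^ 2 ≤ 4 * inner ℝ (φ p) (φ p) := by
  have ho : Orthonormal ℝ fun r => pd r φ p :=
    orthonormal_iff_ite.2 fun i j => h.inner_pd i j
  have := ho.sum_inner_products_le (x := φ p) (s := Finset.univ)
  simp only [(h.jet_normSq _).left, mul_pow, ← Finset.mul_sum]
  rw [real_inner_self_eq_norm_sq]
  simp only [Real.norm_eq_abs, sq_abs] at this
  linarith

end GraphAt

namespace GraphSolution

variable {U : Set (E m)} {T : ℝ} {Φ : E m → ℝ → E n} {p : E m} {t : ℝ}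

lemma hasDeriv_det (h : GraphSolution U T Φ p t) :
    HasDerivWithinAt (fun s => (metric (fun y => Φ y s) p).det)
      (-2 * ∑ i, inner ℝ (coordH (fun y => Φ y t) p) (pd i (pd i fun y => Φ y t) p))
      (Ico 0 T) t := by
  have h1 := (HasFDerivWithinAt.multilinear_comp (detForm m) fun i =>
    (hasDerivWithinAt_pi.2 fun j => h.hasDeriv_metric i j).hasFDerivWithinAt).hasDerivWithinAt
  have hone : (fun i j => metric (fun y => Φ y t) p i j) = fun i j => if i = j then 1 else 0 := by
    ext i j
    rw [h.graphAt.metric_eq_one, Matrix.one_apply]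
  refine h1.congr_deriv ?_
  simp [hone, ContinuousMultilinearMap.toContinuousLinearMap, detForm_update_one, Finset.mul_sum]

/-- The evolution equation of `w`. -/
lemma evolution_W (h : GraphSolution U T Φ p t) (Ω : E n [⋀^Fin m]→ₗ[ℝ] ℝ) :
    HasDerivWithinAt (fun s => coordW Ω (fun y => Φ y s) p)
      (∑ r, pd r (pd r (coordW Ω fun y => Φ y t)) p +
        coordNormSqA (fun y => Φ y t) p * coordW Ω (fun y => Φ y t) p) (Ico 0 T) t := by
  have hd := h.hasDeriv_det.sqrt (by rw [h.graphAt.det_metric]; exact one_ne_zero)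
  have hΩ := (HasFDerivWithinAt.multilinear_comp (contForm Ω) fun i =>
    (h.hasDerivWithinAt_pd h.mem h.time i).hasFDerivWithinAt).hasDerivWithinAt
  have h1 := hΩ.div hd (by rw [h.graphAt.det_metric, Real.sqrt_one]; exact one_ne_zero)
  refine HasDerivWithinAt.congr_deriv (f := fun s => coordW Ω (fun y => Φ y s) p) h1 ?_
  rw [(h.graphAt.laplace_W h.ricci Ω).2, h.graphAt.coordW_eq]
  have hup : ∀ i l, Ω (Function.update (fun j => pd j (fun y => Φ y t) p) i
      (pd l (fun y => Φ y t) p)) = if i = l then Ω fun j => pd j (fun y => Φ y t) p else 0 := by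
    intro i l
    split_ifs with hil
    · subst hil
      rw [Function.update_eq_self]
    · exact Ω.map_update_self _ hil
  -- The tangential part of ∂_iH is -Σ_a⟨H,A_ia⟩∂_aφ; in slot i only a = i survives alternation. The
  -- resulting -|H|²w cancels the time derivative of √det g.
  have hH : ∀ i, Ω (Function.update (fun j => pd j (fun y => Φ y t) p) i
      (pd i (coordH fun y => Φ y t) p)) =
      ∑ r, Ω (Function.update (fun j => pd j (fun y => Φ y t) p) i
        (pd i (pd r (pd r fun y => Φ y t)) p)) -
      inner ℝ (coordH (fun y => Φ y t) p) (pd i (pd i fun y => Φ y t) p) *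
        Ω fun j => pd j (fun y => Φ y t) p := by
    intro i
    rw [h.graphAt.pd_H, AlternatingMap.map_update_sub, AlternatingMap.map_update_sum,
      AlternatingMap.map_update_sum]
    simp [AlternatingMap.map_update_smul, hup]
  simp only [h.graphAt.det_metric, Real.sqrt_one]
  simp [ContinuousMultilinearMap.toContinuousLinearMap, contForm_apply, hH,
    Finset.sum_sub_distrib, ← Finset.sum_mul]
  ring

lemma evolution_normSq (h : GraphSolution U T Φ p t) :
    HasDerivWithinAt (fun s => (inner ℝ (Φ p s) (Φ p s) : ℝ))
      (∑ r, pd r (pd r fun q => (inner ℝ (Φ q t) (Φ q t) : ℝ)) p - 2 * m) (Ico 0 T) t := by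
  have hf := h.flow p h.mem t h.time
  refine (hf.inner ℝ hf).congr_deriv ?_
  rw [h.graphAt.laplace_normSq, real_inner_comm]
  ring

end GraphSolution
end Graph

/-! ### Existence of graph coordinates -/

section GraphCoordinates

variable {m n : ℕ}

open scoped MatrixOrder in
-- L is the inverse of the positive square root of g, so det L > 0 and orientation is kept.
lemma exists_orthonormalizing {g : Matrix (Fin m) (Fin m) ℝ} (hg : g.PosDef) :
    ∃ L : Matrix (Fin m) (Fin m) ℝ, 0 < L.det ∧ L.transpose * g * L = 1 := by
  have h0 : 0 ≤ g := hg.posSemidef.nonneg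
  set B := CFC.sqrt g
  have hB : B * B = g := CFC.sqrt_mul_sqrt_self g h0
  have hBp : B.PosSemidef := Matrix.nonneg_iff_posSemidef.1 (CFC.sqrt_nonneg g)
  have hdet : 0 < B.det := by
    refine lt_of_le_of_ne hBp.det_nonneg fun h => hg.det_pos.ne' ?_
    rw [← hB, Matrix.det_mul, ← h, zero_mul]
  have hu : IsUnit B.det := isUnit_iff_ne_zero.2 hdet.ne'
  have hBt : B.transpose = B := by simpa using hBp.isHermitian.eq
  refine ⟨B⁻¹, ?_, ?_⟩
  · rw [Matrix.det_nonsing_inv, Ring.inverse_eq_inv']; positivity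
  · rw [Matrix.transpose_nonsing_inv, hBt, ← hB, ← Matrix.mul_assoc, Matrix.nonsing_inv_mul _ hu,
      Matrix.one_mul, Matrix.mul_nonsing_inv _ hu]

/-- An orientation preserving local inverse of a smooth map. -/
lemma exists_local_inverse {h : E m → E m} {U : Set (E m)} {q₀ : E m} (hU : IsOpen U)
    (hq₀ : q₀ ∈ U) (hs : ContDiffOn ℝ ∞ h U) (hdet : 0 < (fderiv ℝ h q₀).det) :
    ∃ (τ : E m → E m) (U' : Set (E m)), IsOpen U' ∧ h q₀ ∈ U' ∧ τ (h q₀) = q₀ ∧ MapsTo τ U' U ∧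
      (∀ x ∈ U', h (τ x) = x) ∧ (∀ x ∈ U', ContDiffAt ℝ ∞ τ x) ∧
      ∀ x ∈ U', 0 < (fderiv ℝ τ x).det := by
  have hsa : ∀ q ∈ U, ContDiffAt ℝ ∞ h q := fun q hq => hs.contDiffAt (hU.mem_nhds hq)
  have hfd : ∀ q ∈ U, HasFDerivAt h (fderiv ℝ h q) q := fun q hq =>
    (differentiableAt_of_smooth (hsa q hq)).hasFDerivAt
  let e := (hsa q₀ hq₀).toOpenPartialHomeomorph h
    (f' := (fderiv ℝ h q₀).toContinuousLinearEquivOfDetNeZero hdet.ne')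
    (by simpa using hfd q₀ hq₀) (by simp)
  have he : (e : E m → E m) = h := rfl
  have hes : q₀ ∈ e.source := ContDiffAt.mem_toOpenPartialHomeomorph_source _ _ _
  have hcont : ContinuousOn (fun q => (fderiv ℝ h q).det) U :=
    ContinuousLinearMap.continuous_det.comp_continuousOn
      (hs.continuousOn_fderiv_of_isOpen hU (by simp))
  -- Restricting to positive Jacobian makes the inverse smooth and orientation preserving at every
  -- point of U', not only at h q₀.
  set O : Set (E m) := U ∩ (fun q => (fderiv ℝ h q).det) ⁻¹' Ioi 0
  have hO : IsOpen O := hcont.isOpen_inter_preimage hU isOpen_Ioi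
  have hO₀ : q₀ ∈ O := ⟨hq₀, hdet⟩
  refine ⟨e.symm, e.target ∩ e.symm ⁻¹' O, e.isOpen_inter_preimage_symm hO, ?_, ?_, ?_, ?_, ?_, ?_⟩
  · refine ⟨e.map_source hes, ?_⟩
    have : e.symm (e q₀) = q₀ := e.left_inv hes
    rw [he] at this
    rw [mem_preimage, this]
    exact hO₀
  · exact e.left_inv hes
  · exact fun x hx => hx.2.1
  · exact fun x hx => e.right_inv hx.1
  · intro x hx
    refine e.contDiffAt_symm (f₀' := (fderiv ℝ h (e.symm x)).toContinuousLinearEquivOfDetNeZero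
      (ne_of_gt hx.2.2)) hx.1 ?_ (hsa _ hx.2.1)
    simpa [he] using hfd _ hx.2.1
  · intro x hx
    have hsm : HasFDerivAt e.symm (((fderiv ℝ h (e.symm x)).toContinuousLinearEquivOfDetNeZero
      (ne_of_gt hx.2.2)).symm : E m →L[ℝ] E m) x := by
      refine e.hasFDerivAt_symm hx.1 ?_
      simpa [he] using hfd _ hx.2.1
    have hcomp := (hfd _ hx.2.1).comp x hsm
    have hid : HasFDerivAt (h ∘ e.symm) (ContinuousLinearMap.id ℝ (E m)) x := by
      refine (hasFDerivAt_id x).congr_of_eventuallyEq ?_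
      filter_upwards [e.open_target.mem_nhds hx.1] with y hy using e.right_inv hy
    have h1 := congrArg ContinuousLinearMap.det (hcomp.unique hid)
    rw [hsm.fderiv]
    have h2 : (fderiv ℝ h (e.symm x)).det * (((fderiv ℝ h
        (e.symm x)).toContinuousLinearEquivOfDetNeZero (ne_of_gt hx.2.2)).symm :
          E m →L[ℝ] E m).det = 1 := by
      refine (LinearMap.det_comp _ _).symm.trans (Eq.trans h1 ?_)
      simp [ContinuousLinearMap.det]
    have h3 : 0 < (fderiv ℝ h (e.symm x)).det := hx.2.2
    exact pos_of_mul_pos_right (h2 ▸ one_pos) h3.le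

/-- Graph coordinates around a point of a local solution. -/
lemma LocalSolution.exists_graphSolution {U : Set (E m)} {T : ℝ} {Φ : E m → ℝ → E n}
    (hΦ : LocalSolution U T Φ) {q₀ : E m} (hq₀ : q₀ ∈ U) {t : ℝ} (ht : t ∈ Ico 0 T)
    (hR : RicciFlatAt (fun y => Φ y t) q₀) :
    ∃ (τ : E m → E m) (U' : Set (E m)), τ 0 = q₀ ∧ MapsTo τ U' U ∧
      (∀ x ∈ U', ContDiffAt ℝ ∞ τ x) ∧ (∀ x ∈ U', 0 < (fderiv ℝ τ x).det) ∧
      GraphSolution U' T (fun x s => Φ (τ x) s) 0 t := by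
  set φ : E m → E n := fun y => Φ y t
  have hφ : ∀ q ∈ U, ContDiffAt ℝ ∞ φ q := fun q hq => hΦ.contDiffAt hq ht
  have hg : (metric φ q₀).PosDef := by
    have hli : LinearIndependent ℝ fun i => pd i φ q₀ :=
      Matrix.linearIndependent_of_det_gram_ne_zero (hΦ.immersion q₀ hq₀ t ht).ne'
    exact Matrix.posDef_gram_of_linearIndependent hli
  obtain ⟨L, hL, hLg⟩ := exists_orthonormalizing hg
  -- The vectors a_i are an orthonormal basis of the tangent space at q₀; h records the components
  -- of φ - φ(q₀) along them, and its local inverse τ is the graph parametrization.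
  set a : Fin m → E n := fun i => ∑ k, L k i • pd k φ q₀ with ha
  set h : E m → E m := fun q => WithLp.toLp 2 fun i => (inner ℝ (φ q - φ q₀) (a i) : ℝ) with hh
  have hhs : ∀ q ∈ U, ContDiffAt ℝ ∞ h q := fun q hq =>
    contDiffAt_euclidean.2 fun i => ((hφ q hq).sub contDiffAt_const).inner ℝ contDiffAt_const
  have hpd : ∀ q ∈ U, ∀ i j, pd j h q i = inner ℝ (pd j φ q) (a i) := by
    intro q hq i j
    rw [← pd_coord (differentiableAt_of_smooth (hhs q hq))]
    have h1 := pd_inner (f := fun q => φ q - φ q₀) (g := fun _ => a i) j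
      ((differentiableAt_of_smooth (hφ q hq)).sub_const _) (differentiableAt_const _)
    rw [pd_const, inner_zero_right, add_zero, pd_sub j (differentiableAt_of_smooth (hφ q hq))
      (differentiableAt_const _), pd_const, sub_zero] at h1
    exact h1
  have hjac : jac h q₀ = L.transpose * metric φ q₀ := by
    ext i j
    simp only [jac, Matrix.of_apply, hpd q₀ hq₀, ha, inner_sum, real_inner_smul_right,
      Matrix.mul_apply, Matrix.transpose_apply]
    refine Finset.sum_congr rfl fun k _ => ?_
    rw [metric_symm]
    rfl
  have hdet : 0 < (fderiv ℝ h q₀).det := by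
    rw [← det_jac, hjac, Matrix.det_mul, Matrix.det_transpose]
    exact mul_pos hL (hΦ.immersion q₀ hq₀ t ht)
  obtain ⟨τ, U', hU', h0, hτ0, hmaps, hinv, hτs, hτd⟩ := exists_local_inverse hΦ.isOpen hq₀
    (fun q hq => (hhs q hq).contDiffWithinAt) hdet
  have hh0 : h q₀ = 0 := by ext i; simp [hh]
  rw [hh0] at h0 hτ0
  have hτt : ∀ x ∈ U', τ x ∈ U := hmaps
  have hinner : ∀ x ∈ U', ∀ i j, (inner ℝ (pd i (fun y => φ (τ y)) x) (a j) : ℝ) =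
      if i = j then 1 else 0 := by
    intro x hx i j
    have hd : DifferentiableAt ℝ (fun y => φ (τ y)) x :=
      differentiableAt_of_smooth ((hφ _ (hτt x hx)).comp x (hτs x hx))
    have h1 := pd_inner (f := fun y => φ (τ y) - φ q₀) (g := fun _ => a j) i
      (hd.sub_const _) (differentiableAt_const _)
    rw [pd_const, inner_zero_right, add_zero, pd_sub i hd (differentiableAt_const _), pd_const,
      sub_zero] at h1
    rw [← h1]
    have h2 : (fun y => (inner ℝ (φ (τ y) - φ q₀) (a j) : ℝ)) =ᶠ[𝓝 x] fun y => y j := by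
      filter_upwards [hU'.mem_nhds hx] with y hy
      have := congrArg (fun z : E m => z j) (hinv y hy)
      simpa [hh] using this
    rw [pd_congr i h2, pd_coord (τ := fun y => y) differentiableAt_id]
    have h3 : pd i (fun y : E m => y) x = EuclideanSpace.single i 1 := by
      simp [pd]
    rw [h3]
    simp [eq_comm]
  have hrep : Reparam τ 0 φ (fun x => φ (τ x)) :=
    ⟨hτs 0 h0, hτd 0 h0, hφ _ (hτt 0 h0), (hΦ.immersion _ (hτt 0 h0) t ht).ne', EventuallyEq.rfl⟩
  -- So far the derivatives of φ∘τ are dual to the frame a. Since Lᵀg is invertible, J = L, hence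
  -- a_i = ∂_i(φ∘τ)(0), and the duality is the graph condition.
  have hJ : jac τ 0 = L := by
    have h1 : L.transpose * metric φ q₀ * jac τ 0 = 1 := by
      rw [← hjac]
      ext j i
      have h2 := hinner 0 h0 i j
      rw [hrep.pd_map, hτ0, sum_inner] at h2
      simp only [real_inner_smul_left, ← hpd q₀ hq₀ j] at h2
      rw [Matrix.mul_apply, Matrix.one_apply, ← if_congr (eq_comm (a := i) (b := j)) rfl rfl, ← h2]
      exact Finset.sum_congr rfl fun k _ => mul_comm _ _
    have hu : IsUnit (L.transpose * metric φ q₀) := .of_mul_eq_one _ h1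
    exact hu.mul_left_cancel (h1.trans hLg.symm)
  have hframe : ∀ i, pd i (fun y => φ (τ y)) 0 = a i := by
    intro i
    rw [hrep.pd_map, hτ0, hJ]
  refine ⟨τ, U', hτ0, hmaps, hτs, hτd, ?_⟩
  refine ⟨hΦ.comp hU' hτs hτd hmaps, h0, ht, ⟨?_, ?_⟩, ?_⟩
  · filter_upwards [hU'.mem_nhds h0] with x hx using (hφ _ (hτt x hx)).comp x (hτs x hx)
  · filter_upwards [hU'.mem_nhds h0] with x hx i j
    have := hinner x hx i j
    rw [← hframe j] at this
    exact this
  · refine RicciFlatAt.reparam hrep ?_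
    rw [hτ0]
    exact hR

end GraphCoordinates

/-! ### Passage from the manifold to coordinates -/

section OnManifold

variable {m n : ℕ} {M : Type*} [TopologicalSpace M] [ChartedSpace (E m) M]
  {T : ℝ} {F : M → ℝ → E n}

/-- The flow `F` in the chart at `x`. -/
def chartFlow (F : M → ℝ → E n) (x : M) (q : E m) (s : ℝ) : E n := F ((chartAt (E m) x).symm q) s

lemma GraphSolution.coordLaplacian_eq {U : Set (E m)} {Φ : E m → ℝ → E n} {p : E m} {t : ℝ}
    (h : GraphSolution U T Φ p t) (f : E m → ℝ) :
    coordLaplacian (fun y => Φ y t) f p = ∑ r, pd r (pd r f) p := by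
  simp [coordLaplacian, h.metricInv_apply, h.christoffel_apply]

lemma GraphSolution.coordGradInner_eq {U : Set (E m)} {Φ : E m → ℝ → E n} {p : E m} {t : ℝ}
    (h : GraphSolution U T Φ p t) (f k : E m → ℝ) :
    coordGradInner (fun y => Φ y t) f k p = ∑ r, pd r f p * pd r k p := by
  simp [coordGradInner, h.metricInv_apply]

lemma IsSolution.contMDiff_slice (hF : IsSolution (m := m) T F) {t : ℝ} (ht : t ∈ Ico 0 T) :
    ContMDiff (𝓡 m) 𝓘(ℝ, E n) ∞ fun y => F y t :=
  contMDiffOn_univ.1 <| hF.smooth.comp (f := fun y : M => (y, t))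
    (contMDiff_id.prodMk contMDiff_const).contMDiffOn fun _ _ => ⟨mem_univ _, ht⟩

variable [IsManifold (𝓡 m) ∞ M]

lemma contDiffOn_transition (x y : M) : ContDiffOn ℝ ∞
    ((chartAt (E m) y).symm ≫ₕ chartAt (E m) x)
    ((chartAt (E m) y).symm ≫ₕ chartAt (E m) x).source :=
  contMDiffOn_iff_contDiffOn.1 <| ((contMDiffOn_chart (I := 𝓡 m) (n := ∞) (x := x)).comp
    ((contMDiffOn_chart_symm (I := 𝓡 m) (n := ∞) (x := y)).mono fun _ hq => hq.1)
    fun _ hq => hq.2)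

namespace IsSolution

lemma jointSmooth_chartFlow (hF : IsSolution (m := m) T F) (x : M) :
    JointSmooth (chartAt (E m) x).target T (chartFlow F x) := by
  refine contMDiffOn_iff_contDiffOn.1 ?_
  refine hF.smooth.comp (f := fun z : E m × ℝ => ((chartAt (E m) x).symm z.1, z.2)) ?_
    fun z hz => ⟨mem_univ _, hz.2⟩
  refine ContMDiffOn.prodMk ?_ contDiff_snd.contMDiff.contMDiffOn
  exact (contMDiffOn_chart_symm (I := 𝓡 m) (n := ∞) (x := x)).comp
    contDiff_fst.contMDiff.contMDiffOn fun z hz => hz.1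

lemma metric_det_pos (hF : IsSolution (m := m) T F) (x : M) {q : E m}
    (hq : q ∈ (chartAt (E m) x).target) {t : ℝ} (ht : t ∈ Ico 0 T) :
    0 < (metric (fun y => chartFlow F x y t) q).det := by
  refine MCF.metric_det_pos ?_
  have h1 : (chartAt (E m) x).MDifferentiable (𝓡 m) (𝓡 m) :=
    mdifferentiable_of_mem_atlas (chart_mem_atlas (E m) x)
  have h2 : MDifferentiableAt (𝓡 m) 𝓘(ℝ, E n) (fun y => F y t) ((chartAt (E m) x).symm q) :=
    (hF.contMDiff_slice ht).mdifferentiable (by simp) _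
  have h3 := mfderiv_comp q h2 (h1.symm.mdifferentiableAt hq)
  rw [← mfderiv_eq_fderiv]
  change Function.Injective (mfderiv (𝓡 m) 𝓘(ℝ, E n)
    ((fun y => F y t) ∘ (chartAt (E m) x).symm) q)
  rw [h3]
  exact (hF.immersion t ht _).comp (h1.symm.mfderiv_injective hq)

/-- Geometric quantities at y are defined in the preferred chart at y; to treat them as functions
near x they must be compared with the fixed chart at x. -/
lemma reparam_chart (hM : OrientedAtlas m M) (hF : IsSolution (m := m) T F) {x y : M}
    (hy : y ∈ (chartAt (E m) x).source) {t : ℝ} (ht : t ∈ Ico 0 T) :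
    Reparam ((chartAt (E m) y).symm ≫ₕ chartAt (E m) x) (coordPt m y)
      (inChart m x fun z => F z t) (inChart m y fun z => F z t) ∧
    ((chartAt (E m) y).symm ≫ₕ chartAt (E m) x) (coordPt m y) = chartAt (E m) x y := by
  have hy' := mem_chart_source (E m) y
  have hτ : ((chartAt (E m) y).symm ≫ₕ chartAt (E m) x) (coordPt m y) = chartAt (E m) x y := by
    simp [coordPt]
  have hmem : coordPt m y ∈ ((chartAt (E m) y).symm ≫ₕ chartAt (E m) x).source := by
    simp [coordPt, hy]
  have hnhds := ((chartAt (E m) y).symm ≫ₕ chartAt (E m) x).open_source.mem_nhds hmem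
  have htgt := (chartAt (E m) x).map_source hy
  refine ⟨⟨(contDiffOn_transition x y).contDiffAt hnhds,
    hM _ (chart_mem_atlas _ _) _ (chart_mem_atlas _ _) _ hmem, ?_, ?_, ?_⟩, hτ⟩
  · rw [hτ]
    exact (hF.jointSmooth_chartFlow x).contDiffAt (chartAt (E m) x).open_target htgt ht
  · rw [hτ]
    exact (hF.metric_det_pos x htgt ht).ne'
  · filter_upwards [hnhds] with q hq
    simp only [inChart, Function.comp, OpenPartialHomeomorph.coe_trans]
    exact congrArg (fun z => F z t) ((chartAt (E m) x).left_inv hq.2).symm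

lemma localSolution (hM : OrientedAtlas m M) (hF : IsSolution (m := m) T F) (x : M) :
    LocalSolution (chartAt (E m) x).target T (chartFlow F x) := by
  refine ⟨(chartAt (E m) x).open_target, hF.jointSmooth_chartFlow x,
    fun q hq t ht => hF.metric_det_pos x hq ht, fun q hq t ht => ?_⟩
  obtain ⟨hr, hτ⟩ := hF.reparam_chart hM ((chartAt (E m) x).map_target hq) ht
  have h := hF.flow t ht ((chartAt (E m) x).symm q)
  rw [meanCurvature, hr.coordH_eq, hτ, (chartAt (E m) x).right_inv hq] at h
  exact h

lemma normSqA_eq (hM : OrientedAtlas m M) (hF : IsSolution (m := m) T F) {x y : M}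
    (hy : y ∈ (chartAt (E m) x).source) {t : ℝ} (ht : t ∈ Ico 0 T) :
    normSqA (m := m) (fun z => F z t) y =
      coordNormSqA (fun z => chartFlow F x z t) (chartAt (E m) x y) := by
  obtain ⟨hr, hτ⟩ := hF.reparam_chart hM hy ht
  rw [normSqA, hr.coordNormSqA_eq, hτ]
  rfl

lemma graphW_eq (hM : OrientedAtlas m M) (hF : IsSolution (m := m) T F)
    (Ω : E n [⋀^Fin m]→ₗ[ℝ] ℝ) {x y : M}
    (hy : y ∈ (chartAt (E m) x).source) {t : ℝ} (ht : t ∈ Ico 0 T) :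
    graphW Ω (fun z => F z t) y = coordW Ω (fun z => chartFlow F x z t) (chartAt (E m) x y) := by
  obtain ⟨hr, hτ⟩ := hF.reparam_chart hM hy ht
  rw [graphW, hr.coordW_eq, hτ]
  rfl

end IsSolution

/-- A function on `M × [0, T)` is smooth if it is smooth in all charts. -/
lemma contMDiffOn_of_jointSmooth {f : M → ℝ → ℝ} {g : M → E m → ℝ → ℝ}
    (hg : ∀ x, JointSmooth (chartAt (E m) x).target T (g x))
    (hfg : ∀ x, ∀ y ∈ (chartAt (E m) x).source, ∀ t ∈ Ico 0 T,
      f y t = g x (chartAt (E m) x y) t) :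
    ContMDiffOn ((𝓡 m).prod 𝓘(ℝ, ℝ)) 𝓘(ℝ, ℝ) ∞ (fun p : M × ℝ => f p.1 p.2)
      (univ ×ˢ Ico 0 T) := by
  rintro ⟨x, t⟩ hx
  have hmem := mem_chart_source (E m) x
  have h1 : ContMDiffOn ((𝓡 m).prod 𝓘(ℝ, ℝ)) 𝓘(ℝ, ℝ) ∞ (fun p : M × ℝ => f p.1 p.2)
      ((chartAt (E m) x).source ×ˢ Ico 0 T) := by
    refine ContMDiffOn.congr (f := fun p : M × ℝ => g x (chartAt (E m) x p.1) p.2) ?_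
      fun p hp => hfg x p.1 hp.1 p.2 hp.2
    refine (ContDiffOn.contMDiffOn (hg x)).comp
      (f := fun p : M × ℝ => (chartAt (E m) x p.1, p.2)) ?_
      fun p hp => ⟨(chartAt (E m) x).map_source hp.1, hp.2⟩
    refine ContMDiffOn.prodMk_space ?_ contMDiff_snd.contMDiffOn
    exact (contMDiffOn_chart (I := 𝓡 m) (n := ∞) (x := x)).comp
      contMDiff_fst.contMDiffOn fun p hp => hp.1
  refine (h1 (x, t) ⟨hmem, hx.2⟩).mono_of_mem_nhdsWithin ?_
  rw [nhdsWithin_prod_eq, nhdsWithin_univ]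
  exact prod_mem_prod ((chartAt (E m) x).open_source.mem_nhds hmem) self_mem_nhdsWithin

/-- Graph coordinates for the flow `F` around the point `x` at time `t`. -/
structure GraphCoords (T : ℝ) (F : M → ℝ → E n) (x : M) (t : ℝ) (σ : E m → M) (U : Set (E m)) :
    Prop where
  zero : σ 0 = x
  continuousAt : ContinuousAt σ 0
  solution : GraphSolution U T (fun q s => F (σ q) s) 0 t
  normSqA_eq : ∀ s ∈ Ico 0 T, ∀ q ∈ U,
    normSqA (m := m) (fun y => F y s) (σ q) = coordNormSqA (fun q => F (σ q) s) q
  graphW_eq : ∀ Ω : E n [⋀^Fin m]→ₗ[ℝ] ℝ, ∀ s ∈ Ico 0 T, ∀ q ∈ U,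
    graphW Ω (fun y => F y s) (σ q) = coordW Ω (fun q => F (σ q) s) q
  laplacian_eq : ∀ f : M → ℝ, ContDiffAt ℝ ∞ (inChart m x f) (coordPt m x) →
    laplacian (m := m) (fun y => F y t) f x = ∑ r, pd r (pd r fun q => f (σ q)) 0
  gradInner_eq : ∀ f k : M → ℝ, ContDiffAt ℝ ∞ (inChart m x f) (coordPt m x) →
    ContDiffAt ℝ ∞ (inChart m x k) (coordPt m x) →
    gradInner (m := m) (fun y => F y t) f k x =
      ∑ r, pd r (fun q => f (σ q)) 0 * pd r (fun q => k (σ q)) 0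

lemma IsSolution.exists_graphCoords (hM : OrientedAtlas m M) (hF : IsSolution (m := m) T F)
    {t : ℝ} (ht : t ∈ Ico 0 T) (hflat : FlatNormalBundle (m := m) fun y => F y t) (x : M) :
    ∃ σ U, GraphCoords (m := m) T F x t σ U := by
  have hL := hF.localSolution hM x
  have hx := mem_chart_source (E m) x
  have hq₀ : coordPt m x ∈ (chartAt (E m) x).target := (chartAt (E m) x).map_source hx
  have hR : RicciFlatAt (fun y => chartFlow F x y t) (coordPt m x) :=
    ricciFlatAt_of_normalCurvature (hL.contDiffAt hq₀ ht) (hL.immersion _ hq₀ t ht).ne' (hflat x)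
  obtain ⟨τ, U, h0, hmaps, hτ, hdet, hS⟩ := hL.exists_graphSolution hq₀ ht hR
  have hrep : ∀ s ∈ Ico 0 T, ∀ q ∈ U, Reparam τ q (fun y => chartFlow F x y s)
      (fun y => chartFlow F x (τ y) s) := fun s hs q hq =>
    ⟨hτ q hq, hdet q hq, hL.contDiffAt (hmaps hq) hs, (hL.immersion _ (hmaps hq) s hs).ne',
      EventuallyEq.rfl⟩
  have hU : U ∈ 𝓝 (0 : E m) := hS.isOpen.mem_nhds hS.mem
  refine ⟨fun q => (chartAt (E m) x).symm (τ q), U, ?_, ?_, hS, ?_, ?_, ?_, ?_⟩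
  · simp [h0, coordPt]
  · refine ContinuousAt.comp ?_ (hτ 0 hS.mem).continuousAt
    rw [h0]
    exact (chartAt (E m) x).continuousAt_symm hq₀
  · intro s hs q hq
    rw [hF.normSqA_eq hM ((chartAt (E m) x).map_target (hmaps hq)) hs,
      (chartAt (E m) x).right_inv (hmaps hq), ← (hrep s hs q hq).coordNormSqA_eq]
    rfl
  · intro Ω s hs q hq
    rw [hF.graphW_eq hM Ω ((chartAt (E m) x).map_target (hmaps hq)) hs,
      (chartAt (E m) x).right_inv (hmaps hq), ← (hrep s hs q hq).coordW_eq]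
    rfl
  · intro f hf
    rw [← h0] at hf
    rw [laplacian, ← h0]
    exact ((hrep t ht 0 hS.mem).coordLaplacian_eq hf EventuallyEq.rfl).symm.trans
      (hS.coordLaplacian_eq _)
  · intro f k hf hk
    rw [← h0] at hf hk
    rw [gradInner, ← h0]
    exact ((hrep t ht 0 hS.mem).coordGradInner_eq (differentiableAt_of_smooth hf) EventuallyEq.rfl
      (differentiableAt_of_smooth hk) EventuallyEq.rfl).symm.trans (hS.coordGradInner_eq _ _)

end OnManifold

/-! ### The evolution inequality of |A|²v² -/

section FirstPart

variable {m n : ℕ} {T : ℝ}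

lemma coordNormSqA_nonneg_of_graphAt {φ : E m → E n} {p : E m} (h : GraphAt φ p) :
    0 ≤ coordNormSqA φ p := by
  rw [h.normSqA_eq]
  exact Finset.sum_nonneg fun i _ => Finset.sum_nonneg fun j _ => real_inner_self_nonneg

/-- Cauchy–Schwarz followed by Young's inequality 4aNg ≤ (bN + ag/b)². It is applied with a = |A|²,
b = w, N = |∇A|², g = |∇w|². -/
lemma sq_sum_mul_le {ι : Type*} (s : Finset ι) {a b N g : ℝ} {f k : ι → ℝ} (ha : 0 ≤ a)
    (hN : 0 ≤ N) (hb : 0 < b) (hg : ∑ r ∈ s, k r ^ 2 = g) (hf : ∑ r ∈ s, f r ^ 2 ≤ 4 * a * N) :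
    2 * ∑ r ∈ s, f r * k r ≤ 2 * b * N + 2 * a / b * g := by
  have hg0 : 0 ≤ g := hg ▸ Finset.sum_nonneg fun _ _ => sq_nonneg _
  have h1 := Finset.sum_mul_sq_le_sq_mul_sq s f k
  rw [hg] at h1
  have h2 : (∑ r ∈ s, f r * k r) ^ 2 ≤ (b * N + a / b * g) ^ 2 := by
    refine h1.trans ((mul_le_mul_of_nonneg_right hf hg0).trans ?_)
    have h3 : (b * N + a / b * g) ^ 2 - 4 * a * N * g = (b * N - a / b * g) ^ 2 := by
      field_simp
      ring
    linarith [sq_nonneg (b * N - a / b * g)]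
  have h4 := abs_le_of_sq_le_sq h2 (by positivity)
  have h5 := (le_abs_self _).trans h4
  have h6 : 2 * a / b * g = 2 * (a / b * g) := by ring
  linarith

namespace GraphSolution

variable {U : Set (E m)} {Φ : E m → ℝ → E n} {p : E m} {t : ℝ}

lemma contDiffAt_normSqA (h : GraphSolution U T Φ p t) :
    ContDiffAt ℝ ∞ (coordNormSqA fun y => Φ y t) p :=
  h.smooth_normSqA.contDiffAt h.isOpen h.mem h.time

lemma contDiffAt_W (h : GraphSolution U T Φ p t) (Ω : E n [⋀^Fin m]→ₗ[ℝ] ℝ) :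
    ContDiffAt ℝ ∞ (coordW Ω fun y => Φ y t) p :=
  (h.smooth_W Ω).contDiffAt h.isOpen h.mem h.time

lemma gradSqA_nonneg (φ : E m → E n) (p : E m) : 0 ≤ gradSqA φ p :=
  Finset.sum_nonneg fun _ _ => Finset.sum_nonneg fun _ _ => Finset.sum_nonneg fun _ _ =>
    real_inner_self_nonneg

/-- The evolution inequality of `|A|² v²`, in graph coordinates. -/
lemma evolution_normSqAV (h : GraphSolution U T Φ p t) (Ω : E n [⋀^Fin m]→ₗ[ℝ] ℝ)
    (hw : 0 < coordW Ω (fun y => Φ y t) p) :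
    ∃ f' : ℝ, HasDerivWithinAt (fun s => coordNormSqA (fun y => Φ y s) p *
        (1 / coordW Ω (fun y => Φ y s) p) ^ 2) f' (Ico 0 T) t ∧
      f' - ∑ r, pd r (pd r fun q => coordNormSqA (fun y => Φ y t) q *
        (1 / coordW Ω (fun y => Φ y t) q) ^ 2) p ≤
      -2 * (1 / coordW Ω (fun y => Φ y t) p)⁻¹ *
        ∑ r, pd r (fun q => 1 / coordW Ω (fun y => Φ y t) q) p *
          pd r (fun q => coordNormSqA (fun y => Φ y t) q *
            (1 / coordW Ω (fun y => Φ y t) q) ^ 2) p := by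
  obtain ⟨u', hu', hevo⟩ := h.evolution_normSqA
  have hw' := h.evolution_W Ω
  have hgrad := h.sum_pd_normSqA_sq_le
  have hN := gradSqA_nonneg (fun y => Φ y t) p
  have hu0 := coordNormSqA_nonneg_of_graphAt h.graphAt
  set u := coordNormSqA fun y => Φ y t
  set w := coordW Ω fun y => Φ y t
  set N := gradSqA (fun y => Φ y t) p
  have hus : ContDiffAt ℝ ∞ u p := h.contDiffAt_normSqA
  have hws : ContDiffAt ℝ ∞ w p := h.contDiffAt_W Ω
  have hvs : ContDiffAt ℝ ∞ (fun q => 1 / w q) p := contDiffAt_const.div hws hw.ne'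
  have hfs : ContDiffAt ℝ ∞ (fun q => u q * (1 / w q) ^ 2) p := hus.mul (hvs.pow 2)
  set v : E m → ℝ := fun q => 1 / w q
  set f : E m → ℝ := fun q => u q * (1 / w q) ^ 2
  have hne : ∀ᶠ q in 𝓝 p, w q ≠ 0 := hws.continuousAt.eventually_ne hw.ne'
  -- The product identities u = f w² and 1 = v w avoid second derivatives of quotients: those of f
  -- are solved from the product rule.
  have huf : u =ᶠ[𝓝 p] fun q => f q * (w q * w q) := by
    filter_upwards [hne] with q hq
    simp only [f]
    field_simp
  have hone : (fun _ => (1 : ℝ)) =ᶠ[𝓝 p] fun q => v q * w q := by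
    filter_upwards [hne] with q hq
    simp only [v]
    field_simp
  have hj : ∀ r, Jet r r u p _ _ _ _ := fun r => Jet.congr
    ((Jet.of_smooth hfs r r).mul ((Jet.of_smooth hws r r).mul (Jet.of_smooth hws r r))) huf
  have hjv : ∀ r, Jet r r (fun _ => (1 : ℝ)) p _ _ _ _ := fun r => Jet.congr
    ((Jet.of_smooth hvs r r).mul (Jet.of_smooth hws r r)) hone
  have huval : u p = f p * (w p * w p) := huf.eq_of_nhds
  have hvval : v p = (w p)⁻¹ := one_div _
  have hvr : ∀ r, pd r v p = -pd r w p / w p ^ 2 := fun r => by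
    have h1 := (hjv r).left
    rw [pd_const, hvval] at h1
    field_simp at h1 ⊢
    linarith
  have hur : ∀ r, pd r u p = w p ^ 2 * pd r f p + 2 * f p * w p * pd r w p := fun r => by
    rw [(hj r).left]; ring
  have hfr : ∀ r, pd r f p * pd r w p =
      (pd r u p * pd r w p) / w p ^ 2 - 2 * f p / w p * pd r w p ^ 2 := fun r => by
    rw [hur]
    field_simp
    ring
  have hvt : HasDerivWithinAt (fun s => 1 / coordW Ω (fun y => Φ y s) p)
      (-(∑ r, pd r (pd r w) p + u p * w p) / w p ^ 2) (Ico 0 T) t :=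
    ((hasDerivWithinAt_const t _ (1 : ℝ)).div hw' hw.ne').congr_deriv (by simp [w])
  have hft : HasDerivWithinAt (fun s => coordNormSqA (fun y => Φ y s) p *
      (1 / coordW Ω (fun y => Φ y s) p) ^ 2) (u' * (1 / w p) ^ 2 + u p * (2 * (1 / w p) *
        (-(∑ r, pd r (pd r w) p + u p * w p) / w p ^ 2))) (Ico 0 T) t :=
    (hu'.mul (hvt.pow 2)).congr_deriv (by simp [w, u])
  refine ⟨_, hft, ?_⟩
  have hurr : ∑ r, pd r (pd r u) p = w p ^ 2 * ∑ r, pd r (pd r f) p +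
      4 * w p * ∑ r, pd r f p * pd r w p + 2 * f p * ∑ r, pd r w p ^ 2 +
      2 * f p * w p * ∑ r, pd r (pd r w) p := by
    simp only [Finset.mul_sum, ← Finset.sum_add_distrib]
    refine Finset.sum_congr rfl fun r _ => ?_
    rw [(hj r).mixed]
    ring
  have hvf : ∑ r, pd r v p * pd r f p = -(∑ r, pd r f p * pd r w p) / w p ^ 2 := by
    rw [neg_div, Finset.sum_div, ← Finset.sum_neg_distrib]
    refine Finset.sum_congr rfl fun r _ => ?_
    rw [hvr]
    ring
  have hfw : ∑ r, pd r f p * pd r w p = (∑ r, pd r u p * pd r w p) / w p ^ 2 -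
      2 * f p / w p * ∑ r, pd r w p ^ 2 := by
    simp only [hfr, Finset.sum_sub_distrib, Finset.sum_div, Finset.mul_sum]
  have hcs := sq_sum_mul_le Finset.univ (f := fun r => pd r u p) (k := fun r => pd r w p)
    hu0 hN hw rfl hgrad
  set Lu := ∑ r, pd r (pd r u) p
  set Lw := ∑ r, pd r (pd r w) p
  set Lf := ∑ r, pd r (pd r f) p
  set P := ∑ r, pd r f p * pd r w p
  set Q := ∑ r, pd r u p * pd r w p
  set G := ∑ r, pd r w p ^ 2
  rw [hvf]
  have hf0 : f p = u p / w p ^ 2 := by rw [huval]; field_simp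
  rw [hf0] at hurr hfw
  have hLf : Lf = (Lu - 4 * w p * P - 2 * (u p / w p ^ 2) * G -
      2 * (u p / w p ^ 2) * w p * Lw) / w p ^ 2 := by
    field_simp at hurr ⊢
    linarith
  change _ ≤ -2 * (1 / w p)⁻¹ * _
  rw [hLf, hfw]
  -- The left side is the difference of the two sides of the claim. The first bracket is the
  -- evolution inequality of |A|², the second is Kato with Young; ±2N/w² cancel between them.
  have key : (u' - Lu + 2 * N - 2 * u p ^ 2) / w p ^ 2 +
      (2 * Q - 2 * w p * N - 2 * u p / w p * G) / w p ^ 3 ≤ 0 := by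
    have h1 : (u' - Lu + 2 * N - 2 * u p ^ 2) / w p ^ 2 ≤ 0 :=
      div_nonpos_of_nonpos_of_nonneg (by linarith) (by positivity)
    have h2 : (2 * Q - 2 * w p * N - 2 * u p / w p * G) / w p ^ 3 ≤ 0 :=
      div_nonpos_of_nonpos_of_nonneg (by linarith) (by positivity)
    linarith
  rw [← sub_nonpos]
  refine (le_of_eq ?_).trans key
  field_simp
  ring

end GraphSolution

variable {M : Type*} [TopologicalSpace M] [ChartedSpace (E m) M] {F : M → ℝ → E n}

/-- A function which is smooth in coordinates is smooth in the chart. -/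
lemma contDiffAt_inChart {f : M → ℝ} {g : E m → ℝ} (x : M)
    (hg : ContDiffAt ℝ ∞ g (coordPt m x))
    (hfg : ∀ y ∈ (chartAt (E m) x).source, f y = g (chartAt (E m) x y)) :
    ContDiffAt ℝ ∞ (inChart m x f) (coordPt m x) := by
  refine hg.congr_of_eventuallyEq ?_
  have hx := mem_chart_source (E m) x
  filter_upwards [(chartAt (E m) x).open_target.mem_nhds ((chartAt (E m) x).map_source hx)]
    with q hq
  rw [inChart, Function.comp, hfg _ ((chartAt (E m) x).map_target hq),
    (chartAt (E m) x).right_inv hq]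

variable [IsManifold (𝓡 m) ∞ M]

lemma IsSolution.jointSmooth_normSqAV (hM : OrientedAtlas m M) (hF : IsSolution (m := m) T F)
    (Ω : E n [⋀^Fin m]→ₗ[ℝ] ℝ)
    (hw : ∀ t ∈ Ico 0 T, ∀ x, 0 < graphW Ω (fun y => F y t) x) (x : M) :
    JointSmooth (chartAt (E m) x).target T fun q s =>
      coordNormSqA (fun y => chartFlow F x y s) q *
        (1 / coordW Ω (fun y => chartFlow F x y s) q) ^ 2 := by
  have hL := hF.localSolution hM x
  refine hL.smooth_normSqA.mul (ContDiffOn.pow ?_ 2)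
  refine contDiffOn_const.div (hL.smooth_W Ω) fun z hz => ?_
  have h1 := hw z.2 hz.2 ((chartAt (E m) x).symm z.1)
  rw [hF.graphW_eq hM Ω ((chartAt (E m) x).map_target hz.1) hz.2,
    (chartAt (E m) x).right_inv hz.1] at h1
  exact h1.ne'

lemma IsSolution.normSqAV_eq (hM : OrientedAtlas m M) (hF : IsSolution (m := m) T F)
    (Ω : E n [⋀^Fin m]→ₗ[ℝ] ℝ) {x y : M} (hy : y ∈ (chartAt (E m) x).source) {t : ℝ}
    (ht : t ∈ Ico 0 T) :
    normSqAV Ω F y t = coordNormSqA (fun z => chartFlow F x z t) (chartAt (E m) x y) *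
      (1 / coordW Ω (fun z => chartFlow F x z t) (chartAt (E m) x y)) ^ 2 := by
  rw [normSqAV, graphV, hF.normSqA_eq hM hy ht, hF.graphW_eq hM Ω hy ht]

lemma IsSolution.evolution_normSqAV (hM : OrientedAtlas m M) (hF : IsSolution (m := m) T F)
    (Ω : E n [⋀^Fin m]→ₗ[ℝ] ℝ)
    (hw : ∀ t ∈ Ico 0 T, ∀ x, 0 < graphW Ω (fun y => F y t) x)
    {t : ℝ} (ht : t ∈ Ico 0 T) (hflat : FlatNormalBundle (m := m) fun y => F y t) (x : M) :
    derivWithin (fun s => normSqAV Ω F x s) (Ico 0 T) t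
        - laplacian (m := m) (fun y => F y t) (fun y => normSqAV Ω F y t) x
      ≤ -2 * (graphV Ω (fun y => F y t) x)⁻¹ * gradInner (m := m) (fun y => F y t)
          (fun y => graphV Ω (fun z => F z t) y) (fun y => normSqAV Ω F y t) x := by
  obtain ⟨σ, U, hσ⟩ := hF.exists_graphCoords hM ht hflat x
  have hS := hσ.solution
  have hx := mem_chart_source (E m) x
  have hL := hF.localSolution hM x
  have hq₀ : coordPt m x ∈ (chartAt (E m) x).target := (chartAt (E m) x).map_source hx
  have hfs : ContDiffAt ℝ ∞ (inChart m x fun y => normSqAV Ω F y t) (coordPt m x) :=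
    contDiffAt_inChart x ((hF.jointSmooth_normSqAV hM Ω hw x).contDiffAt hL.isOpen hq₀ ht)
      fun y hy => hF.normSqAV_eq hM Ω hy ht
  have hvs : ContDiffAt ℝ ∞ (inChart m x fun y => graphV Ω (fun z => F z t) y)
      (coordPt m x) := by
    refine contDiffAt_inChart (g := fun q => 1 / coordW Ω (fun z => chartFlow F x z t) q) x
      (contDiffAt_const.div ((hL.smooth_W Ω).contDiffAt hL.isOpen hq₀ ht) ?_) fun y hy => by
        rw [graphV, hF.graphW_eq hM Ω hy ht]
    have h1 := hw t ht x
    rw [hF.graphW_eq hM Ω hx ht] at h1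
    exact h1.ne'
  have hfσ : ∀ s ∈ Ico 0 T, ∀ q ∈ U, normSqAV Ω F (σ q) s =
      coordNormSqA (fun q => F (σ q) s) q * (1 / coordW Ω (fun q => F (σ q) s) q) ^ 2 :=
    fun s hs q hq => by rw [normSqAV, graphV, hσ.normSqA_eq s hs q hq, hσ.graphW_eq Ω s hs q hq]
  have hvσ : ∀ q ∈ U, graphV Ω (fun z => F z t) (σ q) = 1 / coordW Ω (fun q => F (σ q) t) q :=
    fun q hq => by rw [graphV, hσ.graphW_eq Ω t ht q hq]
  have hU : U ∈ 𝓝 (0 : E m) := hS.isOpen.mem_nhds hS.mem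
  have hfe : (fun q => normSqAV Ω F (σ q) t) =ᶠ[𝓝 0] _ :=
    eventually_of_mem hU fun q hq => hfσ t ht q hq
  have hve : (fun q => graphV Ω (fun z => F z t) (σ q)) =ᶠ[𝓝 0] _ :=
    eventually_of_mem hU hvσ
  have hw0 : 0 < coordW Ω (fun q => F (σ q) t) 0 := by
    rw [← hσ.graphW_eq Ω t ht 0 hS.mem]
    exact hw t ht _
  obtain ⟨f', hf', hle⟩ := hS.evolution_normSqAV Ω hw0
  have hd : derivWithin (fun s => normSqAV Ω F x s) (Ico 0 T) t = f' := by
    refine HasDerivWithinAt.derivWithin ?_ (uniqueDiffOn_Ico 0 T t ht)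
    have h0 : ∀ s ∈ Ico 0 T, normSqAV Ω F x s = coordNormSqA (fun q => F (σ q) s) 0 *
        (1 / coordW Ω (fun q => F (σ q) s) 0) ^ 2 := fun s hs => by
      rw [← hfσ s hs 0 hS.mem, hσ.zero]
    exact hf'.congr h0 (h0 t ht)
  have hv0 : graphV Ω (fun y => F y t) x = 1 / coordW Ω (fun q => F (σ q) t) 0 := by
    rw [← hvσ 0 hS.mem, hσ.zero]
  rw [hd, hσ.laplacian_eq _ hfs, hσ.gradInner_eq _ _ hvs hfs, hv0]
  refine le_trans (le_of_eq ?_) (hle.trans (le_of_eq ?_))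
  · congr 1
    exact Finset.sum_congr rfl fun r _ => pd_congr r (eventuallyEq_pd r hfe)
  · congr 1
    exact Finset.sum_congr rfl fun r _ => by rw [pd_congr r hve, pd_congr r hfe]

end FirstPart

/-! ### The maximum principle in graph coordinates -/

section MaximumPrinciple

variable {m n : ℕ} {T : ℝ}

lemma pd_eq_zero_of_isLocalMax {f : E m → ℝ} {p : E m} (hmax : IsLocalMax f p) (r : Fin m) :
    pd r f p = 0 := by
  simp [pd, hmax.fderiv_eq_zero]

/-- If the second derivative along a line were positive, the point would also be a local minimum on
that line, so f would be constant there and the second derivative zero. -/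
lemma pd_pd_nonpos_of_isLocalMax {f : E m → ℝ} {p : E m} (hf : ContDiffAt ℝ ∞ f p)
    (hmax : IsLocalMax f p) (r : Fin m) : pd r (pd r f) p ≤ 0 := by
  by_contra! hpos
  set e : E m := EuclideanSpace.single r 1
  have hl : ∀ h : ℝ, HasDerivAt (fun h : ℝ => p + h • e) e h := fun h => by
    simpa using ((hasDerivAt_id h).smul_const e).const_add p
  have hl0 : Tendsto (fun h : ℝ => p + h • e) (𝓝 0) (𝓝 p) := by
    have := (hl 0).continuousAt.tendsto
    simpa using this
  have hd : ∀ {k : E m → ℝ} {h : ℝ}, DifferentiableAt ℝ k (p + h • e) →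
      HasDerivAt (fun h : ℝ => k (p + h • e)) (pd r k (p + h • e)) h := fun hk =>
    hk.hasFDerivAt.comp_hasDerivAt _ (hl _)
  have h1 : deriv (fun h : ℝ => f (p + h • e)) =ᶠ[𝓝 0] fun h => pd r f (p + h • e) := by
    filter_upwards [hl0.eventually (eventually_differentiableAt hf)] with h hh
    exact (hd hh).deriv
  have h2 : deriv (deriv fun h : ℝ => f (p + h • e)) 0 = pd r (pd r f) p := by
    rw [h1.deriv_eq]
    have := (hd (k := pd r f) (h := 0)
      (by simpa using differentiableAt_of_smooth (contDiffAt_pd r hf))).deriv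
    simpa using this
  have h3 : deriv (fun h : ℝ => f (p + h • e)) 0 = 0 := by
    rw [h1.eq_of_nhds]
    simpa using pd_eq_zero_of_isLocalMax hmax r
  have hmin : IsLocalMin (fun h : ℝ => f (p + h • e)) 0 :=
    isLocalMin_of_deriv_deriv_pos (by rw [h2]; exact hpos) h3
      (hd (by simpa using differentiableAt_of_smooth hf)).continuousAt
  have hconst : (fun h : ℝ => f (p + h • e)) =ᶠ[𝓝 0] fun _ => f p := by
    filter_upwards [hmin, hl0.eventually hmax] with h h4 h5
    simp only [zero_smul, add_zero] at h4
    exact le_antisymm h5 h4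
  have h4 : deriv (fun h : ℝ => f (p + h • e)) =ᶠ[𝓝 0] fun _ => 0 := by
    filter_upwards [hconst.deriv] with h hh
    rw [hh, deriv_const]
  rw [h4.deriv_eq, deriv_const] at h2
  exact hpos.ne h2

lemma deriv_nonneg_of_le_past {f : ℝ → ℝ} {f' t : ℝ} (ht : t ∈ Ioo 0 T)
    (hf : HasDerivWithinAt f f' (Ico 0 T) t) (hle : ∀ᶠ s in 𝓝[<] t, f s ≤ f t) : 0 ≤ f' := by
  have h1 : HasDerivWithinAt f f' (Iio t) t :=
    (hf.hasDerivAt (Ico_mem_nhds ht.1 ht.2)).hasDerivWithinAt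
  have h2 := (hasDerivWithinAt_iff_tendsto_slope' self_notMem_Iio).1 h1
  refine ge_of_tendsto h2 ?_
  filter_upwards [hle, self_mem_nhdsWithin] with s hs hst
  rw [slope_def_field]
  exact div_nonneg_of_nonpos (by linarith) (by linarith [mem_Iio.1 hst])

namespace GraphSolution

variable {U : Set (E m)} {Φ : E m → ℝ → E n} {p : E m} {t : ℝ}

/-- Applied to η - Cw, the heat operator gives 2m - b - C|A|²w < 0, whereas a spatial maximum not
exceeded in the recent past makes it nonnegative. -/
lemma not_isLocalMax_sub_W (h : GraphSolution U T Φ p t) (ht : 0 < t)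
    (Ω : E n [⋀^Fin m]→ₗ[ℝ] ℝ) (hw : 0 < coordW Ω (fun y => Φ y t) p) {a b C : ℝ} (hC : 0 ≤ C)
    (hb : 2 * m < b)
    (hmax : IsLocalMax (fun q => (a - (inner ℝ (Φ q t) (Φ q t) : ℝ) - b * t) -
      C * coordW Ω (fun y => Φ y t) q) p)
    (hpast : ∀ᶠ s in 𝓝[<] t, (a - (inner ℝ (Φ p s) (Φ p s) : ℝ) - b * s) -
      C * coordW Ω (fun y => Φ y s) p ≤ (a - (inner ℝ (Φ p t) (Φ p t) : ℝ) - b * t) -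
      C * coordW Ω (fun y => Φ y t) p) : False := by
  have hu0 := coordNormSqA_nonneg_of_graphAt h.graphAt
  have hj : ∀ r, Jet r r (fun q => (a - (inner ℝ (Φ q t) (Φ q t) : ℝ) - b * t) -
      C * coordW Ω (fun y => Φ y t) q) p _ _ _ _ := fun r =>
    (((Jet.const a).sub (Jet.of_smooth (h.graphAt.jet_normSq r).smooth r r)).sub
      (Jet.const (b * t))).sub ((Jet.const C).mul (Jet.of_smooth (h.contDiffAt_W Ω) r r))
  have h1 : ∀ r, _ ≤ (0 : ℝ) := fun r =>
    (hj r).mixed.symm.le.trans (pd_pd_nonpos_of_isLocalMax (hj r).smooth hmax r)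
  have h2 := Finset.sum_nonpos fun r (_ : r ∈ Finset.univ) => h1 r
  have h3 := deriv_nonneg_of_le_past ⟨ht, h.time.2⟩
    ((((hasDerivWithinAt_const t _ a).sub h.evolution_normSq).sub
      ((hasDerivWithinAt_id t _).const_mul b)).sub ((h.evolution_W Ω).const_mul C)) hpast
  simp only [zero_mul, zero_add, Finset.sum_sub_distrib, zero_sub, sub_zero,
    Finset.sum_neg_distrib, ← Finset.mul_sum] at h2
  have h4 : 0 ≤ C * (coordNormSqA (fun y => Φ y t) p * coordW Ω (fun y => Φ y t) p) := by
    positivity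
  linarith

/-- Here u = |A|², D = w² - k, N = |∇A|², U₂ = |∇u|², V = ⟨∇u,∇η⟩, P = |∇w|², q = ⟨∇w,∇η⟩, s =
|∇η|². `h1` is Kato; `h2` and `h3` come from the first-order condition at the maximum, `h5` from the
heat operator; `h4` is the square |kη∇w + wD∇η|². -/
lemma barrier_algebra {u η D k w N P q s U₂ V C : ℝ} (hu : 0 < u) (hη : 0 < η) (hk : 0 < k)
    (hD : 0 < D) (hDw : D = w ^ 2 - k) (hC : u * (η * η) = C * D)
    (h1 : U₂ ≤ 4 * u * N)
    (h2 : D ^ 2 * η ^ 2 * U₂ =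
      4 * u ^ 2 * (η ^ 2 * w ^ 2 * P - 2 * η * w * D * q + D ^ 2 * s))
    (h3 : D * η * V = 2 * u * (η * w * q - D * s))
    (h4 : 0 ≤ k ^ 2 * η ^ 2 * P + 2 * k * η * w * D * q + w ^ 2 * D ^ 2 * s)
    (h5 : 0 ≤ -2 * η ^ 2 * N - 2 * u * s - 4 * η * V - 2 * C * u * k + 2 * C * P) :
    C * k ^ 2 ≤ s * (w ^ 2 + 2 * k) := by
  have hN : u * (η ^ 2 * w ^ 2 * P - 2 * η * w * D * q + D ^ 2 * s) ≤ D ^ 2 * η ^ 2 * N := by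
    have h6 : D ^ 2 * η ^ 2 * U₂ ≤ D ^ 2 * η ^ 2 * (4 * u * N) :=
      mul_le_mul_of_nonneg_left h1 (by positivity)
    rw [h2] at h6
    have h7 : 4 * u * (u * (η ^ 2 * w ^ 2 * P - 2 * η * w * D * q + D ^ 2 * s)) ≤
        4 * u * (D ^ 2 * η ^ 2 * N) := by linarith
    exact le_of_mul_le_mul_left h7 (by positivity)
  have h6 : 0 ≤ D ^ 2 * (-2 * η ^ 2 * N - 2 * u * s - 4 * η * V - 2 * C * u * k + 2 * C * P) :=
    mul_nonneg (by positivity) h5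
  have h7 : D ^ 2 * (-2 * η ^ 2 * N - 2 * u * s - 4 * η * V - 2 * C * u * k + 2 * C * P) =
      -2 * (D ^ 2 * η ^ 2 * N) - 2 * u * D ^ 2 * s - 4 * D * (D * η * V) -
        2 * (C * D) * u * k * D + 2 * (C * D) * P * D := by ring
  rw [h7, h3, ← hC] at h6
  have h8 : 0 ≤ 2 * u * (-(k * η ^ 2 * P) - 2 * η * w * D * q + 2 * D ^ 2 * s -
      u * η ^ 2 * D * k) := by
    have : 2 * u * (-(k * η ^ 2 * P) - 2 * η * w * D * q + 2 * D ^ 2 * s -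
      u * η ^ 2 * D * k) = -2 * (u * (η ^ 2 * w ^ 2 * P - 2 * η * w * D * q + D ^ 2 * s)) -
      2 * u * D ^ 2 * s - 4 * D * (2 * u * (η * w * q - D * s)) - 2 * (u * (η * η)) * u * k * D +
      2 * (u * (η * η)) * P * D := by rw [hDw]; ring
    rw [this]
    linarith
  have h9 := nonneg_of_mul_nonneg_right h8 (by positivity)
  -- The factor k matches the coefficients of P and q in `h4`; adding `h4` eliminates both and
  -- leaves only s.
  have h10 : 0 ≤ k * (-(k * η ^ 2 * P) - 2 * η * w * D * q + 2 * D ^ 2 * s -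
      u * η ^ 2 * D * k) := mul_nonneg hk.le h9
  have h11 : u * (η * η) * (D * k ^ 2) ≤ D ^ 2 * (s * (w ^ 2 + 2 * k)) := by linarith
  rw [hC] at h11
  have h12 : D ^ 2 * (C * k ^ 2) ≤ D ^ 2 * (s * (w ^ 2 + 2 * k)) := by linarith
  exact le_of_mul_le_mul_left h12 (by positivity)

/-- With b = 2m the heat operator kills η, and it maps w² to 2uw² - 2|∇w|². At the maximum uη² =
C(w² - k), so the reaction terms 2u²η² - 2Cuw² reduce to -2Cuk. This negative term bounds C by
|∇η|², which is at most 4|F|². -/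
lemma le_of_isLocalMax_localized (h : GraphSolution U T Φ p t) (ht : 0 < t)
    (Ω : E n [⋀^Fin m]→ₗ[ℝ] ℝ) {a C k : ℝ} (hk : 0 < k)
    (hkw : k < coordW Ω (fun y => Φ y t) p ^ 2) (hC : 0 < C)
    (hη : 0 < a - (inner ℝ (Φ p t) (Φ p t) : ℝ) - 2 * m * t)
    (heq : coordNormSqA (fun y => Φ y t) p *
      ((a - (inner ℝ (Φ p t) (Φ p t) : ℝ) - 2 * m * t) *
        (a - (inner ℝ (Φ p t) (Φ p t) : ℝ) - 2 * m * t)) =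
      C * (coordW Ω (fun y => Φ y t) p * coordW Ω (fun y => Φ y t) p - k))
    (hmax : IsLocalMax (fun q => coordNormSqA (fun y => Φ y t) q *
      ((a - (inner ℝ (Φ q t) (Φ q t) : ℝ) - 2 * m * t) *
        (a - (inner ℝ (Φ q t) (Φ q t) : ℝ) - 2 * m * t)) -
      C * (coordW Ω (fun y => Φ y t) q * coordW Ω (fun y => Φ y t) q - k)) p)
    (hpast : ∀ᶠ τ in 𝓝[<] t, coordNormSqA (fun y => Φ y τ) p *
      ((a - (inner ℝ (Φ p τ) (Φ p τ) : ℝ) - 2 * m * τ) *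
        (a - (inner ℝ (Φ p τ) (Φ p τ) : ℝ) - 2 * m * τ)) -
      C * (coordW Ω (fun y => Φ y τ) p * coordW Ω (fun y => Φ y τ) p - k) ≤
      coordNormSqA (fun y => Φ y t) p *
      ((a - (inner ℝ (Φ p t) (Φ p t) : ℝ) - 2 * m * t) *
        (a - (inner ℝ (Φ p t) (Φ p t) : ℝ) - 2 * m * t)) -
      C * (coordW Ω (fun y => Φ y t) p * coordW Ω (fun y => Φ y t) p - k)) :
    C * k ^ 2 ≤ 4 * inner ℝ (Φ p t) (Φ p t) * (coordW Ω (fun y => Φ y t) p ^ 2 + 2 * k) := by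
  obtain ⟨u', hu', hevo⟩ := h.evolution_normSqA
  have hw' := h.evolution_W Ω
  have hgrad := h.sum_pd_normSqA_sq_le
  have hρ := h.graphAt.sum_pd_normSq_sq_le
  have hηt : HasDerivWithinAt (fun τ => a - (inner ℝ (Φ p τ) (Φ p τ) : ℝ) - 2 * m * τ)
      (-∑ r, pd r (pd r fun q => (inner ℝ (Φ q t) (Φ q t) : ℝ)) p) (Ico 0 T) t :=
    (((hasDerivWithinAt_const t _ a).sub h.evolution_normSq).sub
      ((hasDerivWithinAt_id t _).const_mul (2 * (m : ℝ)))).congr_deriv (by ring)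
  set u := coordNormSqA fun y => Φ y t
  set w := coordW Ω fun y => Φ y t
  set ρ : E m → ℝ := fun q => inner ℝ (Φ q t) (Φ q t) 
  have hus : ContDiffAt ℝ ∞ u p := h.contDiffAt_normSqA
  have hws : ContDiffAt ℝ ∞ w p := h.contDiffAt_W Ω
  have hηj : ∀ r, Jet r r (fun q => a - ρ q - 2 * m * t) p (a - ρ p - 2 * m * t) (-pd r ρ p)
      (-pd r ρ p) (-pd r (pd r ρ) p) := fun r => by
    have hρs : ContDiffAt ℝ ∞ ρ p := (h.graphAt.jet_normSq r).smooth
    simpa only [zero_sub, sub_zero] using ((Jet.const a).sub (Jet.of_smooth hρs r r)).sub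
      (Jet.const (2 * m * t))
  have hj : ∀ r, Jet r r (fun q => u q * ((a - ρ q - 2 * m * t) * (a - ρ q - 2 * m * t)) -
      C * (w q * w q - k)) p _ _ _ _ := fun r =>
    ((Jet.of_smooth hus r r).mul ((hηj r).mul (hηj r))).sub ((Jet.const C).mul
      (((Jet.of_smooth hws r r).mul (Jet.of_smooth hws r r)).sub (Jet.const k)))
  set η : ℝ := a - ρ p - 2 * m * t
  set D := w p * w p - k
  have hD : 0 < D := by simp only [D]; nlinarith
  have hu : 0 < u p := by
    have h1 : 0 < u p * (η * η) := heq ▸ mul_pos hC hD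
    exact pos_of_mul_pos_left h1 (by positivity)
  -- The first-order condition times D, with CD replaced by uη² so that a factor η can be cancelled.
  have hfirst : ∀ r, D * η * pd r u p = 2 * u p * (η * w p * pd r w p + D * pd r ρ p) := by
    intro r
    have h1 := (hj r).left.symm.trans (pd_eq_zero_of_isLocalMax hmax r)
    have h2 : η * pd r u p * (η * D) =
        2 * (C * D) * w p * pd r w p + 2 * u p * pd r ρ p * (η * D) := by
      linear_combination D * h1
    rw [← heq] at h2
    refine mul_left_cancel₀ hη.ne' ?_
    linear_combination h2
  have hsecond := Finset.sum_nonpos fun r (_ : r ∈ Finset.univ) =>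
    (hj r).mixed.symm.le.trans (pd_pd_nonpos_of_isLocalMax (hj r).smooth hmax r)
  have htime := deriv_nonneg_of_le_past ⟨ht, h.time.2⟩ ((hu'.mul (hηt.mul hηt)).sub
    (((hw'.mul hw').sub_const k).const_mul C)) hpast
  have hexp : ∑ r, (pd r (pd r u) p * (η * η) + 4 * η * (pd r u p * -pd r ρ p) +
      2 * u p * pd r ρ p ^ 2 - 2 * u p * η * pd r (pd r ρ) p - 2 * C * pd r w p ^ 2 -
      2 * C * w p * pd r (pd r w) p) ≤ 0 := by
    refine (le_of_eq ?_).trans hsecond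
    refine Finset.sum_congr rfl fun r _ => ?_
    ring
  simp only [Finset.sum_sub_distrib, Finset.sum_add_distrib, ← Finset.mul_sum,
    ← Finset.sum_mul] at hexp
  have hge := barrier_algebra (P := ∑ r, pd r w p ^ 2) (q := ∑ r, pd r w p * -pd r ρ p)
    (s := ∑ r, pd r ρ p ^ 2) (V := ∑ r, pd r u p * -pd r ρ p) hu hη hk hD
    (by simp only [D]; ring) heq hgrad ?_ ?_ ?_ ?_
  · refine hge.trans (mul_le_mul_of_nonneg_right hρ (by positivity))
  · simp only [Finset.mul_sum, ← Finset.sum_add_distrib, ← Finset.sum_sub_distrib]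
    refine Finset.sum_congr rfl fun r _ => ?_
    have h1 : D ^ 2 * η ^ 2 * pd r u p ^ 2 = (D * η * pd r u p) ^ 2 := by ring
    rw [h1, hfirst]
    ring
  · simp only [Finset.mul_sum, ← Finset.sum_sub_distrib]
    refine Finset.sum_congr rfl fun r _ => ?_
    rw [← mul_assoc, hfirst]
    ring
  · simp only [Finset.mul_sum, ← Finset.sum_add_distrib]
    refine Finset.sum_nonneg fun r _ => ?_
    have h1 : 0 ≤ (k * η * pd r w p - w p * D * pd r ρ p) ^ 2 := sq_nonneg _
    linarith
  · have h1 := mul_le_mul_of_nonneg_left hevo (mul_self_nonneg η)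
    have h2 : u p * (u p * (η * η)) = u p * (C * D) := by rw [heq]
    change 0 ≤ u' * (η * η) + u p * (_ * η + η * _) - C * (_ * w p + w p * _) at htime
    simp only [D] at h2
    linarith

end GraphSolution

end MaximumPrinciple

/-! ### Localization and preservation of a lower bound of w -/

section SecondPart

variable {m n : ℕ} {T : ℝ} {M : Type*} [TopologicalSpace M] [ChartedSpace (E m) M]
  {F : M → ℝ → E n}

/-- Positivity of a continuous function on `M × [0, T)` persists in space and into the past. -/
lemma eventually_pos_of_continuousOn {g : M × ℝ → ℝ} (hg : ContinuousOn g (univ ×ˢ Ico 0 T))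
    {x : M} {t : ℝ} (ht : t ∈ Ico 0 T) (hpos : 0 < g (x, t)) :
    (∀ᶠ y in 𝓝 x, 0 < g (y, t)) ∧
      (0 < t → ∀ᶠ s in 𝓝[<] t, s ∈ Ico 0 t ∧ 0 < g (x, s)) := by
  have h1 := (hg (x, t) ⟨mem_univ _, ht⟩).eventually (lt_mem_nhds hpos)
  rw [nhdsWithin_prod_eq, nhdsWithin_univ] at h1
  refine ⟨?_, fun h0 => ?_⟩
  · have h2 : Tendsto (fun y : M => (y, t)) (𝓝 x) (𝓝 x ×ˢ 𝓝[Ico 0 T] t) :=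
      tendsto_id.prodMk
      (tendsto_nhdsWithin_of_tendsto_nhds_of_eventually_within _ tendsto_const_nhds
        (Eventually.of_forall fun _ => ht))
    exact h2.eventually h1
  · have h3 : 𝓝[<] t ≤ 𝓝[Ico 0 T] t := by
      refine nhdsWithin_le_iff.2 (mem_nhdsWithin_of_mem_nhds (Ico_mem_nhds h0 ht.2))
    have h2 : Tendsto (fun s : ℝ => (x, s)) (𝓝[<] t) (𝓝 x ×ˢ 𝓝[Ico 0 T] t) :=
      tendsto_const_nhds.prodMk h3
    filter_upwards [h2.eventually h1, mem_nhdsWithin_of_mem_nhds (lt_mem_nhds h0),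
      self_mem_nhdsWithin] with s h4 h5 h6
    exact ⟨⟨h5.le, h6⟩, h4⟩

/-- The localization function `a - |F|² - b t`. -/
def localizer (F : M → ℝ → E n) (a b : ℝ) (z : M × ℝ) : ℝ :=
  a - inner ℝ (F z.1 z.2) (F z.1 z.2) - b * z.2

lemma IsSolution.continuousOn_localizer (hF : IsSolution (m := m) T F) (a b : ℝ) :
    ContinuousOn (localizer F a b) (univ ×ˢ Ico 0 T) := by
  have h := hF.smooth.continuousOn
  exact (continuousOn_const.sub (h.inner h)).sub (continuousOn_const.mul continuousOn_snd)

/-- For b, t ≥ 0, η ≥ 0 forces |F|² ≤ a, so the set is closed in the preimage of a ball, which is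
compact by properness. -/
lemma IsProperFlow.isCompact_localizer [T2Space M] (hF : IsSolution (m := m) T F)
    (hp : IsProperFlow T F) {a b t : ℝ} (hb : 0 ≤ b) (ht : t ∈ Ico 0 T) :
    IsCompact {z : M × ℝ | z.2 ∈ Icc 0 t ∧ 0 ≤ localizer F a b z} := by
  have hK := hp t ht _ (isCompact_closedBall (0 : E n) (Real.sqrt a))
  have hsub : {p : M × ℝ | p.2 ∈ Icc 0 t ∧ F p.1 p.2 ∈ Metric.closedBall 0 (Real.sqrt a)} ⊆
      univ ×ˢ Ico 0 T := fun p hp => ⟨mem_univ _, hp.1.1, hp.1.2.trans_lt ht.2⟩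
  have h1 := ((hF.continuousOn_localizer a b).mono hsub).preimage_isClosed_of_isClosed
    hK.isClosed isClosed_Ici (t := Ici 0)
  have h2 := hK.of_isClosed_subset h1 inter_subset_left
  refine (congrArg IsCompact (Set.ext fun z => ?_)).mp h2
  refine ⟨fun hz => ⟨hz.1.1, hz.2⟩, fun hz => ⟨⟨hz.1, ?_⟩, hz.2⟩⟩
  have h3 : 0 ≤ a - inner ℝ (F z.1 z.2) (F z.1 z.2) - b * z.2 := hz.2
  rw [real_inner_self_eq_norm_sq] at h3
  rw [mem_closedBall_zero_iff]
  exact (le_abs_self _).trans (Real.abs_le_sqrt (by linarith [mul_nonneg hb hz.1.1]))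

lemma GraphCoords.normSqA_nonneg {x : M} {t : ℝ} {σ : E m → M} {U : Set (E m)}
    (hσ : GraphCoords T F x t σ U) : 0 ≤ normSqA (m := m) (fun y => F y t) x := by
  have h := hσ.normSqA_eq t hσ.solution.time 0 hσ.solution.mem
  rw [hσ.zero] at h
  rw [h]
  exact coordNormSqA_nonneg_of_graphAt hσ.solution.graphAt

lemma GraphCoords.graphW_le {x : M} {t : ℝ} {σ : E m → M} {U : Set (E m)}
    (hσ : GraphCoords T F x t σ U) (Ω : E n [⋀^Fin m]→ₗ[ℝ] ℝ) :
    graphW Ω (fun y => F y t) x ≤ ‖contForm Ω‖ := by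
  have h := hσ.graphW_eq Ω t hσ.solution.time 0 hσ.solution.mem
  rw [hσ.zero] at h
  rw [h]
  exact (le_abs_self _).trans (hσ.solution.graphAt.abs_W_le Ω)

variable [IsManifold (𝓡 m) ∞ M]

lemma IsSolution.continuousOn_normSqA (hM : OrientedAtlas m M) (hF : IsSolution (m := m) T F) :
    ContinuousOn (fun z : M × ℝ => normSqA (m := m) (fun y => F y z.2) z.1)
      (univ ×ˢ Ico 0 T) :=
  (contMDiffOn_of_jointSmooth (f := fun x t => normSqA (m := m) (fun y => F y t) x)
    (fun x => (hF.localSolution hM x).smooth_normSqA)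
    fun _ _ hy _ ht => hF.normSqA_eq hM hy ht).continuousOn

lemma IsSolution.continuousOn_graphW (hM : OrientedAtlas m M) (hF : IsSolution (m := m) T F)
    (Ω : E n [⋀^Fin m]→ₗ[ℝ] ℝ) :
    ContinuousOn (fun z : M × ℝ => graphW Ω (fun y => F y z.2) z.1) (univ ×ˢ Ico 0 T) :=
  (contMDiffOn_of_jointSmooth (f := fun x t => graphW Ω (fun y => F y t) x)
    (fun x => (hF.localSolution hM x).smooth_W Ω)
    fun _ _ hy _ ht => hF.graphW_eq hM Ω hy ht).continuousOn

/-- A lower bound of `w` is preserved by a proper flow. -/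
lemma IsSolution.le_graphW_of_proper [T2Space M] (hM : OrientedAtlas m M)
    (hF : IsSolution (m := m) T F)
    (hflat : ∀ t ∈ Ico 0 T, FlatNormalBundle (m := m) fun y => F y t)
    (Ω : E n [⋀^Fin m]→ₗ[ℝ] ℝ)
    (hw : ∀ t ∈ Ico 0 T, ∀ x, 0 < graphW Ω (fun y => F y t) x)
    (hp : IsProperFlow T F) {w₀ : ℝ} (hw₀ : 0 < w₀)
    (h0 : ∀ x, w₀ ≤ graphW Ω (fun y => F y 0) x) {t : ℝ} (ht : t ∈ Ico 0 T) (x : M) :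
    w₀ ≤ graphW Ω (fun y => F y t) x := by
  -- Any b > 2m makes η a strict subsolution.
  set b : ℝ := 2 * m + 1
  have hb : 0 ≤ b := by positivity
  have key : ∀ a > 0, localizer F a b (x, t) ≤ a / w₀ * graphW Ω (fun y => F y t) x := by
    intro a ha
    by_contra! hlt
    -- At time 0, η ≤ a and w ≥ w₀, so the factor a/w₀ gives Z ≤ 0 there; a positive maximum can
    -- only occur later.
    set Z : M × ℝ → ℝ := fun z =>
      localizer F a b z - a / w₀ * graphW Ω (fun y => F y z.2) z.1 with hZ
    have hZc : ContinuousOn Z (univ ×ˢ Ico 0 T) := (hF.continuousOn_localizer a b).sub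
      (continuousOn_const.mul (hF.continuousOn_graphW hM Ω))
    set K := {z : M × ℝ | z.2 ∈ Icc 0 t ∧ 0 ≤ localizer F a b z}
    have hKsub : K ⊆ univ ×ˢ Ico 0 T := fun z hz => ⟨mem_univ _, hz.1.1, hz.1.2.trans_lt ht.2⟩
    have hpos : 0 < Z (x, t) := sub_pos.2 hlt
    have hcw : ∀ z ∈ K, 0 < a / w₀ * graphW Ω (fun y => F y z.2) z.1 := fun z hz =>
      mul_pos (by positivity) (hw _ (hKsub hz).2 _)
    have hxK : (x, t) ∈ K := ⟨right_mem_Icc.2 ht.1, by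
      have := mul_pos (a := a / w₀) (by positivity) (hw t ht x)
      simp only [hZ] at hpos
      linarith⟩
    obtain ⟨⟨y, s⟩, hyK, hymax⟩ := (hp.isCompact_localizer hF hb ht).exists_isMaxOn ⟨_, hxK⟩
      (hZc.mono hKsub)
    have hs : s ∈ Ico 0 T := (hKsub hyK).2
    have hys : 0 < Z (y, s) := hpos.trans_le (hymax hxK)
    have hη : 0 < localizer F a b (y, s) := by
      have := hcw _ hyK
      simp only [hZ] at hys
      linarith
    have hs0 : 0 < s := by
      refine hs.1.lt_of_ne fun h => ?_
      subst h
      have h1 : localizer F a b (y, 0) ≤ a := by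
        have := real_inner_self_nonneg (F := E n) (x := F y 0)
        simp only [localizer]
        linarith
      have h2 : a / w₀ * w₀ ≤ a / w₀ * graphW Ω (fun y => F y 0) y :=
        mul_le_mul_of_nonneg_left (h0 y) (by positivity)
      rw [div_mul_cancel₀ _ hw₀.ne'] at h2
      simp only [hZ] at hys
      linarith
    -- Where Z > 0 also η > 0, and this persists nearby and slightly earlier, so the maximum over K
    -- is a genuine local one.
    obtain ⟨hspace, hpast⟩ := eventually_pos_of_continuousOn (hF.continuousOn_localizer a b) hs hη
    obtain ⟨σ, U, hσ⟩ := hF.exists_graphCoords hM hs (hflat s hs) y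
    have hS := hσ.solution
    have hZσ : ∀ τ ∈ Ico 0 T, ∀ q ∈ U, Z (σ q, τ) =
        (a - (inner ℝ (F (σ q) τ) (F (σ q) τ) : ℝ) - b * τ) -
          a / w₀ * coordW Ω (fun q => F (σ q) τ) q := fun τ hτ q hq => by
      simp only [hZ, localizer, hσ.graphW_eq Ω τ hτ q hq]
    have hw0 : 0 < coordW Ω (fun q => F (σ q) s) 0 := by
      rw [← hσ.graphW_eq Ω s hs 0 hS.mem]
      exact hw s hs _
    have hbase : ∀ τ, Z (y, τ) = Z (σ 0, τ) := fun τ => by rw [hσ.zero]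
    refine hS.not_isLocalMax_sub_W hs0 Ω hw0 (a := a) (b := b) (C := a / w₀) (by positivity)
      (by simp [b]) ?_ ?_
    · have hσc : Tendsto σ (𝓝 0) (𝓝 y) := hσ.zero ▸ hσ.continuousAt
      filter_upwards [hσc.eventually hspace, hS.isOpen.mem_nhds hS.mem] with q h1 h2
      rw [← hZσ s hs q h2, ← hZσ s hs 0 hS.mem, ← hbase]
      exact hymax ⟨hyK.1, h1.le⟩
    · filter_upwards [hpast hs0] with τ hτ
      have hτT : τ ∈ Ico 0 T := ⟨hτ.1.1, hτ.1.2.trans hs.2⟩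
      rw [← hZσ τ hτT 0 hS.mem, ← hZσ s hs 0 hS.mem, ← hbase, ← hbase]
      exact hymax ⟨⟨hτ.1.1, (hτ.1.2.trans_le hyK.1.2).le⟩, hτ.2.le⟩
  by_contra! hlt
  set w := graphW Ω (fun y => F y t) x
  set c : ℝ := inner ℝ (F x t) (F x t) + b * t
  have hc : 0 ≤ c := add_nonneg real_inner_self_nonneg (mul_nonneg hb ht.1)
  have hd : 0 < w₀ - w := sub_pos.2 hlt
  -- `key` says a(w₀ - w) ≤ w₀c; this a makes the left side w₀c + 1.
  have h1 := key ((w₀ * c + 1) / (w₀ - w)) (by positivity)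
  have h2 : localizer F ((w₀ * c + 1) / (w₀ - w)) b (x, t) = (w₀ * c + 1) / (w₀ - w) - c := by
    simp only [localizer, c]
    ring
  rw [h2] at h1
  field_simp at h1
  linarith

end SecondPart

/-! ### The localized estimate and the limit -/

section SecondPartEstimate

variable {m n : ℕ} {T : ℝ} {M : Type*} [TopologicalSpace M] [ChartedSpace (E m) M]
  {F : M → ℝ → E n}

/-- Divide by X² and let X → ∞; the linear term disappears. -/
lemma le_of_forall_quadratic {u b P B d : ℝ}
    (h : ∀ X > 0, b < X → u * ((X - b) * (X - b)) ≤ (X ^ 2 * P + X * B) * d) : u ≤ P * d := by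
  have h0 : Tendsto (fun X : ℝ => b / X) atTop (𝓝 0) := tendsto_const_nhds.div_atTop tendsto_id
  have h1 : Tendsto (fun X : ℝ => u * ((1 - b / X) * (1 - b / X))) atTop (𝓝 u) := by
    have h2 := (tendsto_const_nhds (x := (1 : ℝ))).sub h0
    simpa using (h2.mul h2).const_mul u
  have h2 : Tendsto (fun X : ℝ => (P + B / X) * d) atTop (𝓝 (P * d)) := by
    have h3 : Tendsto (fun X : ℝ => B / X) atTop (𝓝 0) := tendsto_const_nhds.div_atTop tendsto_id
    simpa using (h3.const_add P).mul_const d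
  refine le_of_tendsto_of_tendsto h1 h2 ?_
  filter_upwards [eventually_gt_atTop 0, eventually_gt_atTop b] with X hX hbX
  have h3 := h X hX hbX
  have h4 : (P + B / X) * d - u * ((1 - b / X) * (1 - b / X)) =
      ((X ^ 2 * P + X * B) * d - u * ((X - b) * (X - b))) / X ^ 2 := by
    field_simp
  rw [← sub_nonneg, h4]
  exact div_nonneg (by linarith) (by positivity)

variable [IsManifold (𝓡 m) ∞ M]

/-- The localized estimate for `|A|²`. -/
lemma IsSolution.localized_normSqA_le [T2Space M] (hM : OrientedAtlas m M)
    (hF : IsSolution (m := m) T F)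
    (hflat : ∀ t ∈ Ico 0 T, FlatNormalBundle (m := m) fun y => F y t)
    (Ω : E n [⋀^Fin m]→ₗ[ℝ] ℝ) (hp : IsProperFlow T F) {w₀ S k : ℝ} (hw₀ : 0 < w₀)
    (hw : ∀ t ∈ Ico 0 T, ∀ x, w₀ ≤ graphW Ω (fun y => F y t) x) (hS0 : 0 ≤ S)
    (hS : ∀ x, normSqA (m := m) (fun y => F y 0) x ≤ S * graphW Ω (fun y => F y 0) x ^ 2)
    (hk : 0 < k) (hkw : k < w₀ ^ 2) {a : ℝ} (ha : 0 < a) {t : ℝ} (ht : t ∈ Ico 0 T) (x : M)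
    (hη : 0 < localizer F a (2 * m) (x, t)) :
    normSqA (m := m) (fun y => F y t) x *
        (localizer F a (2 * m) (x, t) * localizer F a (2 * m) (x, t)) ≤
      (a ^ 2 * (S * w₀ ^ 2 / (w₀ ^ 2 - k)) + a * (4 * (‖contForm Ω‖ ^ 2 + 2 * k) / k ^ 2)) *
        (graphW Ω (fun y => F y t) x ^ 2 - k) := by
  set η := localizer F a (2 * m) with hηdef
  set u : M × ℝ → ℝ := fun z => normSqA (m := m) (fun y => F y z.2) z.1
  set w : M × ℝ → ℝ := fun z => graphW Ω (fun y => F y z.2) z.1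
  -- The first summand bounds a maximum attained at time 0, the second one attained at positive
  -- time.
  set C₀ := a ^ 2 * (S * w₀ ^ 2 / (w₀ ^ 2 - k)) + a * (4 * (‖contForm Ω‖ ^ 2 + 2 * k) / k ^ 2)
  set Q : M × ℝ → ℝ := fun z => u z * (η z * η z) / (w z * w z - k) with hQ
  have hk' : 0 < w₀ ^ 2 - k := sub_pos.2 hkw
  have hD : ∀ z ∈ (univ : Set M) ×ˢ Ico 0 T, 0 < w z * w z - k := fun z hz => by
    have h1 := mul_self_le_mul_self hw₀.le (hw z.2 hz.2 z.1)
    have h2 : w₀ * w₀ ≤ w z * w z := h1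
    linarith [sq w₀]
  have hQc : ContinuousOn Q (univ ×ˢ Ico 0 T) := by
    have h1 := hF.continuousOn_localizer a (2 * m)
    have h2 := hF.continuousOn_graphW hM Ω
    exact ((hF.continuousOn_normSqA hM).mul (h1.mul h1)).div
      ((h2.mul h2).sub continuousOn_const) fun z hz => (hD z hz).ne'
  have hC₀ : 0 ≤ C₀ := by positivity
  set K := {z : M × ℝ | z.2 ∈ Icc 0 t ∧ 0 ≤ η z}
  have hKsub : K ⊆ univ ×ˢ Ico 0 T := fun z hz => ⟨mem_univ _, hz.1.1, hz.1.2.trans_lt ht.2⟩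
  have hxK : (x, t) ∈ K := ⟨right_mem_Icc.2 ht.1, hη.le⟩
  suffices h : Q (x, t) ≤ C₀ by
    have h1 := (div_le_iff₀ (hD _ (hKsub hxK))).1 h
    rw [sq (graphW Ω _ x)]
    exact h1
  obtain ⟨⟨y, s⟩, hyK, hymax⟩ := (hp.isCompact_localizer hF (a := a) (b := 2 * m)
    (by positivity) ht).exists_isMaxOn ⟨_, hxK⟩ (hQc.mono hKsub)
  refine (hymax hxK).trans ?_
  change Q (y, s) ≤ C₀
  have hs : s ∈ Ico 0 T := (hKsub hyK).2
  by_contra! hlt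
  have hCpos : 0 < Q (y, s) := hC₀.trans_lt hlt
  have hDy := hD _ (hKsub hyK)
  have hηy : 0 < η (y, s) := by
    refine lt_of_le_of_ne hyK.2 fun h => ?_
    simp only [hQ] at hCpos
    rw [← h] at hCpos
    simp at hCpos
  obtain ⟨σ, U, hσ⟩ := hF.exists_graphCoords hM hs (hflat s hs) y
  have hG := hσ.solution
  have hρ : inner ℝ (F y s) (F y s) ≤ a := by
    have h1 : 0 < a - inner ℝ (F y s) (F y s) - 2 * m * s := hηy
    have h2 : 0 ≤ 2 * (m : ℝ) * s := mul_nonneg (by positivity) hs.1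
    linarith
  -- At time 0, η ≤ a and u ≤ S w², and w²/(w² - k) decreases in w, so it is largest for w = w₀.
  rcases hs.1.eq_or_lt with h0 | hs0
  · subst h0
    refine hlt.not_ge ?_
    have h1 : η (y, 0) * η (y, 0) ≤ a ^ 2 := by
      have h2 : η (y, 0) ≤ a := by
        have := real_inner_self_nonneg (F := E n) (x := F y 0)
        simp only [hηdef, localizer]
        linarith
      rw [sq]
      exact mul_self_le_mul_self hηy.le h2
    have h2 : u (y, 0) / (w (y, 0) * w (y, 0) - k) ≤ S * w₀ ^ 2 / (w₀ ^ 2 - k) := by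
      have h3 : u (y, 0) ≤ S * w (y, 0) ^ 2 := hS y
      have h4 : w₀ ^ 2 ≤ w (y, 0) ^ 2 := pow_le_pow_left₀ hw₀.le (hw 0 hs y) 2
      rw [div_le_div_iff₀ hDy hk']
      have h5 : S * k * (w₀ ^ 2) ≤ S * k * w (y, 0) ^ 2 :=
        mul_le_mul_of_nonneg_left h4 (by positivity)
      have h6 := mul_le_mul_of_nonneg_right h3 hk'.le
      linarith
    have h3 : Q (y, 0) = (η (y, 0) * η (y, 0)) * (u (y, 0) / (w (y, 0) * w (y, 0) - k)) := by
      simp only [hQ]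
      ring
    have h4 : 0 ≤ u (y, 0) / (w (y, 0) * w (y, 0) - k) :=
      div_nonneg hσ.normSqA_nonneg hDy.le
    have h5 : 0 ≤ a * (4 * (‖contForm Ω‖ ^ 2 + 2 * k) / k ^ 2) := by positivity
    rw [h3]
    exact (mul_le_mul h1 h2 h4 (by positivity)).trans (le_add_of_nonneg_right h5)
  set C := Q (y, s) with hCdef
  -- Clearing the denominator turns the maximum C of Q into the maximum 0 of Z, which has no
  -- quotients to differentiate.
  set Z : M × ℝ → ℝ := fun z => u z * (η z * η z) - C * (w z * w z - k) with hZ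
  have hZle : ∀ z ∈ K, Z z ≤ 0 := fun z hz => by
    have h1 := (div_le_iff₀ (hD _ (hKsub hz))).1 (show Q z ≤ C from hymax hz)
    exact sub_nonpos.2 h1
  have hZy : Z (y, s) = 0 := by
    simp only [hZ, hCdef, hQ]
    rw [div_mul_cancel₀ _ hDy.ne', sub_self]
  have hZσ : ∀ τ ∈ Ico 0 T, ∀ q ∈ U, Z (σ q, τ) = coordNormSqA (fun q => F (σ q) τ) q *
      ((a - (inner ℝ (F (σ q) τ) (F (σ q) τ) : ℝ) - 2 * m * τ) *
        (a - (inner ℝ (F (σ q) τ) (F (σ q) τ) : ℝ) - 2 * m * τ)) -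
      C * (coordW Ω (fun q => F (σ q) τ) q * coordW Ω (fun q => F (σ q) τ) q - k) :=
    fun τ hτ q hq => by
      simp only [hZ, hηdef, localizer, u, w, hσ.graphW_eq Ω τ hτ q hq, hσ.normSqA_eq τ hτ q hq]
  have hZ0 : Z (σ 0, s) = 0 := by rw [hσ.zero, hZy]
  have hw0 : coordW Ω (fun q => F (σ q) s) 0 = w (y, s) := by
    rw [← hσ.graphW_eq Ω s hs 0 hG.mem, hσ.zero]
  obtain ⟨hspace, hpast⟩ := eventually_pos_of_continuousOn
    (hF.continuousOn_localizer a (2 * m)) hs hηy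
  have hle := hG.le_of_isLocalMax_localized hs0 Ω (a := a) (C := C) hk
    (by rw [hw0, sq]; linarith) hCpos (by rw [hσ.zero]; exact hηy)
    (by rw [← sub_eq_zero, ← hZσ s hs 0 hG.mem]; exact hZ0) ?_ ?_
  · have h1 : w (y, s) ^ 2 ≤ ‖contForm Ω‖ ^ 2 :=
      pow_le_pow_left₀ (hw₀.le.trans (hw s hs y)) (hσ.graphW_le Ω) 2
    rw [hw0, hσ.zero] at hle
    have h2 : C * k ^ 2 ≤ a * (4 * (‖contForm Ω‖ ^ 2 + 2 * k)) := by
      refine hle.trans ?_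
      have h3 := mul_le_mul hρ (by linarith : w (y, s) ^ 2 + 2 * k ≤ ‖contForm Ω‖ ^ 2 + 2 * k)
        (by positivity) ha.le
      linarith
    have h3 : C ≤ a * (4 * (‖contForm Ω‖ ^ 2 + 2 * k) / k ^ 2) := by
      rw [← mul_div_assoc, le_div_iff₀ (by positivity)]
      exact h2
    have h4 : 0 ≤ a ^ 2 * (S * w₀ ^ 2 / (w₀ ^ 2 - k)) := by positivity
    exact hlt.not_ge (h3.trans (le_add_of_nonneg_left h4))
  · have hσc : Tendsto σ (𝓝 0) (𝓝 y) := hσ.zero ▸ hσ.continuousAt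
    filter_upwards [hσc.eventually hspace, hG.isOpen.mem_nhds hG.mem] with q h1 h2
    rw [← hZσ s hs q h2, ← hZσ s hs 0 hG.mem, hZ0]
    exact hZle _ ⟨hyK.1, h1.le⟩
  · filter_upwards [hpast hs0] with τ hτ
    have hτT : τ ∈ Ico 0 T := ⟨hτ.1.1, hτ.1.2.trans hs.2⟩
    rw [← hZσ τ hτT 0 hG.mem, ← hZσ s hs 0 hG.mem, hZ0, hσ.zero]
    exact hZle _ ⟨⟨hτ.1.1, (hτ.1.2.trans_le hyK.1.2).le⟩, hτ.2.le⟩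

/-- An upper bound of `|A|² / w²` is preserved by a proper flow. -/
lemma IsSolution.normSqA_le_of_proper [T2Space M] (hM : OrientedAtlas m M)
    (hF : IsSolution (m := m) T F)
    (hflat : ∀ t ∈ Ico 0 T, FlatNormalBundle (m := m) fun y => F y t)
    (Ω : E n [⋀^Fin m]→ₗ[ℝ] ℝ) (hp : IsProperFlow T F) {w₀ S : ℝ} (hw₀ : 0 < w₀)
    (hw : ∀ t ∈ Ico 0 T, ∀ x, w₀ ≤ graphW Ω (fun y => F y t) x) (hS0 : 0 ≤ S)
    (hS : ∀ x, normSqA (m := m) (fun y => F y 0) x ≤ S * graphW Ω (fun y => F y 0) x ^ 2)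
    {t : ℝ} (ht : t ∈ Ico 0 T) (x : M) :
    normSqA (m := m) (fun y => F y t) x ≤ S * graphW Ω (fun y => F y t) x ^ 2 := by
  set u := normSqA (m := m) (fun y => F y t) x
  set w := graphW Ω (fun y => F y t) x
  -- The limit a → ∞ is taken first, at fixed k, because the coefficient B of the linear term blows
  -- up as k → 0.
  have h1 : ∀ k > 0, k < w₀ ^ 2 → u * (w₀ ^ 2 - k) ≤ S * w₀ ^ 2 * (w ^ 2 - k) := by
    intro k hk hkw
    have h2 : u ≤ S * w₀ ^ 2 / (w₀ ^ 2 - k) * (w ^ 2 - k) := by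
      refine le_of_forall_quadratic (b := inner ℝ (F x t) (F x t) + 2 * m * t)
        (B := 4 * (‖contForm Ω‖ ^ 2 + 2 * k) / k ^ 2) fun a ha hba => ?_
      have h3 : localizer F a (2 * m) (x, t) =
          a - (inner ℝ (F x t) (F x t) + 2 * m * t) := by
        simp only [localizer]
        ring
      have h4 := hF.localized_normSqA_le hM hflat Ω hp hw₀ hw hS0 hS hk hkw ha ht x
        (by rw [h3]; linarith)
      rwa [h3] at h4
    rw [div_mul_eq_mul_div, le_div_iff₀ (sub_pos.2 hkw)] at h2
    exact h2
  have h2 : u * (w₀ ^ 2 - 0) ≤ S * w₀ ^ 2 * (w ^ 2 - 0) := by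
    have hl : Tendsto (fun k : ℝ => u * (w₀ ^ 2 - k)) (𝓝[>] 0) (𝓝 (u * (w₀ ^ 2 - 0))) :=
      (Continuous.tendsto (by fun_prop) 0).mono_left nhdsWithin_le_nhds
    have hr : Tendsto (fun k : ℝ => S * w₀ ^ 2 * (w ^ 2 - k)) (𝓝[>] 0)
        (𝓝 (S * w₀ ^ 2 * (w ^ 2 - 0))) :=
      (Continuous.tendsto (by fun_prop) 0).mono_left nhdsWithin_le_nhds
    refine le_of_tendsto_of_tendsto hl hr ?_
    filter_upwards [self_mem_nhdsWithin,
      mem_nhdsWithin_of_mem_nhds (gt_mem_nhds (a := w₀ ^ 2) (by positivity))] with k hk hkw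
    exact h1 k hk hkw
  rw [sub_zero, sub_zero, mul_right_comm] at h2
  exact le_of_mul_le_mul_right h2 (by positivity)

/-- An upper bound B of v at time 0 is the lower bound 1/B of w, which persists; then the estimate
of |A|² applies with S the initial supremum. -/
lemma IsSolution.sup_normSqAV_le [T2Space M] (hM : OrientedAtlas m M)
    (hF : IsSolution (m := m) T F)
    (hflat : ∀ t ∈ Ico 0 T, FlatNormalBundle (m := m) fun y => F y t)
    (Ω : E n [⋀^Fin m]→ₗ[ℝ] ℝ)
    (hw : ∀ t ∈ Ico 0 T, ∀ x, 0 < graphW Ω (fun y => F y t) x)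
    (hp : IsProperFlow T F)
    (hv : BddAbove (range fun x => graphV Ω (fun y => F y 0) x))
    (hA : BddAbove (range fun x => normSqA (m := m) (fun y => F y 0) x))
    {t : ℝ} (ht : t ∈ Ico 0 T) :
    BddAbove (range fun x => normSqAV Ω F x 0) ∧ BddAbove (range fun x => normSqAV Ω F x t) ∧
      (⨆ x, normSqAV Ω F x t) ≤ ⨆ x, normSqAV Ω F x 0 := by
  have h0 : (0 : ℝ) ∈ Ico 0 T := ⟨le_rfl, ht.1.trans_lt ht.2⟩
  have hu : ∀ s ∈ Ico 0 T, ∀ x, 0 ≤ normSqA (m := m) (fun y => F y s) x := fun s hs x => by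
    obtain ⟨σ, U, hσ⟩ := hF.exists_graphCoords hM hs (hflat s hs) x
    exact hσ.normSqA_nonneg
  have hvpos : ∀ s ∈ Ico 0 T, ∀ x, 0 < graphV Ω (fun y => F y s) x := fun s hs x =>
    one_div_pos.2 (hw s hs x)
  obtain ⟨B, hB⟩ := hv
  obtain ⟨L, hL⟩ := hA
  have hB' : ∀ x, graphV Ω (fun y => F y 0) x ≤ B := fun x => hB (mem_range_self x)
  have hbdd : BddAbove (range fun x => normSqAV Ω F x 0) := by
    refine ⟨L * B ^ 2, ?_⟩
    rintro _ ⟨x, rfl⟩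
    exact mul_le_mul (hL (mem_range_self x)) (pow_le_pow_left₀ (hvpos 0 h0 x).le (hB' x) 2)
      (by positivity) ((hu 0 h0 x).trans (hL (mem_range_self x)))
  -- Also true for empty M, where the real supremum is 0 by convention.
  have hS0 : 0 ≤ ⨆ x, normSqAV Ω F x 0 :=
    Real.iSup_nonneg fun x => mul_nonneg (hu 0 h0 x) (sq_nonneg _)
  have hle : ∀ x, normSqAV Ω F x t ≤ ⨆ x, normSqAV Ω F x 0 := by
    intro x
    have hBpos : 0 < B := (hvpos 0 h0 x).trans_le (hB' x)
    have hw₀ : ∀ y, 1 / B ≤ graphW Ω (fun y => F y 0) y := fun y => by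
      rw [one_div_le hBpos (hw 0 h0 y)]
      exact hB' y
    have hall : ∀ s ∈ Ico 0 T, ∀ y, 1 / B ≤ graphW Ω (fun y => F y s) y := fun s hs y =>
      hF.le_graphW_of_proper hM hflat Ω hw hp (by positivity) hw₀ hs y
    have h1 := hF.normSqA_le_of_proper hM hflat Ω hp (by positivity) hall hS0
      (fun y => ?_) ht x
    · rw [normSqAV, graphV, one_div, inv_pow, ← div_eq_mul_inv,
        div_le_iff₀ (pow_pos (hw t ht x) 2)]
      exact h1
    · rw [← div_le_iff₀ (pow_pos (hw 0 h0 y) 2), div_eq_mul_inv, ← inv_pow, ← one_div]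
      exact le_ciSup hbdd y
  exact ⟨hbdd, ⟨_, forall_mem_range.2 hle⟩, Real.iSup_le hle hS0⟩

end SecondPartEstimate

end MCF

end

theorem mainTheorem5 (m n : ℕ) (M : Type*) [TopologicalSpace M] [T2Space M]
    [SecondCountableTopology M] [ChartedSpace (MCF.E m) M] [IsManifold (𝓡 m) ∞ M]
    (hM : MCF.OrientedAtlas m M)
    (Ω : MCF.E n [⋀^Fin m]→ₗ[ℝ] ℝ) (hΩ : MCF.formNormSq Ω = 1)
    (T : ℝ) (hT : 0 < T) (F : M → ℝ → MCF.E n) (hF : MCF.IsSolution (m := m) T F)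
    (hflat : ∀ t ∈ Set.Ico 0 T, MCF.FlatNormalBundle (m := m) (fun y => F y t))
    (hw : ∀ t ∈ Set.Ico 0 T, ∀ x, 0 < MCF.graphW Ω (fun y => F y t) x) :
    (ContMDiffOn ((𝓡 m).prod 𝓘(ℝ, ℝ)) 𝓘(ℝ, ℝ) ∞
        (fun p : M × ℝ => MCF.normSqAV Ω F p.1 p.2) (Set.univ ×ˢ Set.Ico 0 T) ∧
      ∀ t ∈ Set.Ico 0 T, ∀ x,
        derivWithin (fun s => MCF.normSqAV Ω F x s) (Set.Ico 0 T) t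
            - MCF.laplacian (m := m) (fun y => F y t) (fun y => MCF.normSqAV Ω F y t) x
          ≤ -2 * (MCF.graphV Ω (fun y => F y t) x)⁻¹ *
            MCF.gradInner (m := m) (fun y => F y t)
              (fun y => MCF.graphV Ω (fun z => F z t) y)
              (fun y => MCF.normSqAV Ω F y t) x) ∧
    (MCF.IsProperFlow T F →
      (∀ t ∈ Set.Ico 0 T, BddAbove (Set.range fun x => MCF.graphV Ω (fun y => F y t) x)) →
      (∀ t ∈ Set.Ico 0 T,
        BddAbove (Set.range fun x => MCF.normSqA (m := m) (fun y => F y t) x)) →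
      ∀ t ∈ Set.Ico 0 T,
        BddAbove (Set.range fun x => MCF.normSqAV Ω F x 0) ∧
        BddAbove (Set.range fun x => MCF.normSqAV Ω F x t) ∧
        (⨆ x, MCF.normSqAV Ω F x t) ≤ ⨆ x, MCF.normSqAV Ω F x 0) := by
  refine ⟨⟨?_, fun t ht x => hF.evolution_normSqAV hM Ω hw ht (hflat t ht) x⟩,
    fun hp hv hA t ht => ?_⟩
  · exact MCF.contMDiffOn_of_jointSmooth (f := MCF.normSqAV Ω F)
      (fun x => hF.jointSmooth_normSqAV hM Ω hw x) fun _ _ hy _ ht => hF.normSqAV_eq hM Ω hy ht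
  · have h0 : (0 : ℝ) ∈ Set.Ico 0 T := ⟨le_rfl, hT⟩
    exact hF.sup_normSqAV_le hM hflat Ω hw hp (hv 0 h0) (hA 0 h0) ht
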